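/- Let $\hat{\mathbb C}=\mathbb C\cup\{\infty\}$ be the Riemann sphere, let $\overline{\mathbb D}=\{|z|\le 1\}$, and let $\mathcal M=\{c\in\mathbb C:\ \sup_{n}|f_c^{n}(0)|<\infty\}$, $f_c(z)=z^2+c$, be the Mandelbrot set. There exists a unique conformal bijection $$\phi:\hat{\mathbb C}\setminus\overline{\mathbb D}\to\hat{\mathbb C}\setminus\mathcal M,\qquad \phi(\infty)=\infty,\quad \phi'(\infty)=\lim_{z\to\infty}\phi(z)/z>0$$ (the Riemann map), and $\phi$ is computable. Here $\hat{\mathbb C}$ is the computable metric space given by the chordal (spherical) metric $d$ and the dense sequence $(s_i)_{i\in\mathbb N}$ of ideal points obtained from an effective enumeration of the complex numbers with rational real and imaginary parts. An oracle for a point $z\in\hat{\mathbb C}$ is a function $p:\mathbb N\to\mathbb N$ with $d(s_{p(n)},z)<2^{-n}$ for all $n$. That $\phi$ is computable means: there is a single oracle algorithm which, for every $z\in\hat{\mathbb C}\setminus\overline{\mathbb D}$, every oracle $p$ for $z$ and every $n\in\mathbb N$, halts on input $n$ with oracle $p$ and outputs an index $i$ such that $d(s_i,\phi(z))<2^{-n}$.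 -/

import Mathlib

open Set Filter Topology

/-! ### Computable metric spaces and computable functions -/

/-- A computable metric space `(X, d, S)`: a metric space with a dense sequence of ideal points
whose mutual distances are computable real numbers, uniformly in the two indices: from `i`, `j`, `n`
one computes a rational number `a / (b + 1)` at distance less than `2⁻ⁿ` from `d (sᵢ, sⱼ)`. -/
structure ComputableMetricSpace (X : Type*) extends MetricSpace X where
  ideal : ℕ → X
  dense_ideal : DenseRange ideal
  dist_computable : ∃ a b : ℕ × ℕ × ℕ → ℕ, Computable a ∧ Computable b ∧
    ∀ i j n : ℕ, |dist (ideal i) (ideal j) - (a (i, j, n) : ℝ) / ((b (i, j, n) : ℝ) + 1)|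
      < (1 / 2 : ℝ) ^ n

/-- `p` is a name of (an oracle for) the point `x`: for every `n`, the `p n`-th ideal point is at
distance less than `2⁻ⁿ` from `x`. -/
def ComputableMetricSpace.IsName {X : Type*} (C : ComputableMetricSpace X) (p : ℕ → ℕ) (x : X) :
    Prop :=
  ∀ n : ℕ, C.dist (C.ideal (p n)) x < (1 / 2 : ℝ) ^ n

/-- `y` is the output of the oracle algorithm `M` on input `n` with oracle `p`. The algorithm reads
the oracle values `p 0, p 1, p 2, …` one after another; given the finite list of values read so far
and the input, `M` either asks for one more value (`none`) or halts with an output (`some y`). -/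
def OracleOutput (M : List ℕ × ℕ → Option ℕ) (p : ℕ → ℕ) (n y : ℕ) : Prop :=
  ∃ k : ℕ, M ((List.range k).map p, n) = some y ∧
    ∀ l < k, M ((List.range l).map p, n) = none

/-- The function `f`, restricted to `S ⊆ X`, is computable as a function between computable metric
spaces: there is a single oracle algorithm which, for every `x ∈ S`, given any oracle for `x` and any
`n`, halts and outputs (the index of) an ideal point at distance less than `2⁻ⁿ` from `f x`. -/
def ComputableFunctionOn {X Y : Type*} (C : ComputableMetricSpace X) (D : ComputableMetricSpace Y)
    (S : Set X) (f : X → Y) : Prop :=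
  ∃ M : List ℕ × ℕ → Option ℕ, Computable M ∧
    ∀ x ∈ S, ∀ p : ℕ → ℕ, C.IsName p x → ∀ n : ℕ,
      ∃ y : ℕ, OracleOutput M p n y ∧ D.dist (D.ideal y) (f x) < (1 / 2 : ℝ) ^ n

/-! ### The Riemann sphere `OnePoint ℂ` as a computable metric space -/

namespace RiemannSphere

/-- Inverse stereographic projection onto the unit sphere of `ℝ³`. -/
noncomputable def stereo : OnePoint ℂ → EuclideanSpace ℝ (Fin 3)
  | none => !₂[0, 0, 1]
  | some z => !₂[2 * z.re / (1 + Complex.normSq z), 2 * z.im / (1 + Complex.normSq z),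
      1 - 2 / (1 + Complex.normSq z)]

theorem stereo_infty : stereo OnePoint.infty = !₂[0, 0, 1] := rfl

theorem stereo_coe (z : ℂ) : stereo (z : OnePoint ℂ) =
    !₂[2 * z.re / (1 + Complex.normSq z), 2 * z.im / (1 + Complex.normSq z),
      1 - 2 / (1 + Complex.normSq z)] := rfl

theorem one_add_normSq_pos (z : ℂ) : 0 < 1 + Complex.normSq z := by
  have := Complex.normSq_nonneg z
  linarith

theorem stereo_injective : Function.Injective stereo := by
  intro p q h
  induction p using OnePoint.rec with
  | infty =>
    induction q using OnePoint.rec with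
    | infty => rfl
    | coe w =>
      exfalso
      rw [stereo_infty, stereo_coe] at h
      have h2 := congrArg (fun v : EuclideanSpace ℝ (Fin 3) => v 2) h
      simp only [Matrix.cons_val] at h2
      have := div_pos two_pos (one_add_normSq_pos w)
      linarith
  | coe z =>
    induction q using OnePoint.rec with
    | infty =>
      exfalso
      rw [stereo_infty, stereo_coe] at h
      have h2 := congrArg (fun v : EuclideanSpace ℝ (Fin 3) => v 2) h
      simp only [Matrix.cons_val] at h2
      have := div_pos two_pos (one_add_normSq_pos z)
      linarith
    | coe w =>
      rw [stereo_coe, stereo_coe] at h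
      have hz := one_add_normSq_pos z
      have hw := one_add_normSq_pos w
      have h0 := congrArg (fun v : EuclideanSpace ℝ (Fin 3) => v 0) h
      have h1 := congrArg (fun v : EuclideanSpace ℝ (Fin 3) => v 1) h
      have h2 := congrArg (fun v : EuclideanSpace ℝ (Fin 3) => v 2) h
      simp only [Matrix.cons_val, sub_right_inj] at h0 h1 h2
      have e : 1 + Complex.normSq z = 1 + Complex.normSq w := by
        field_simp at h2
        linarith
      rw [e] at h0 h1
      have a0 : z.re = w.re := by
        field_simp at h0
        linarith
      have a1 : z.im = w.im := by
        field_simp at h1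
        linarith
      rw [Complex.ext a0 a1]

theorem dist_stereo_coe (z w : ℂ) : dist (stereo (z : OnePoint ℂ)) (stereo (w : OnePoint ℂ)) =
    Real.sqrt (4 * Complex.normSq (z - w) /
      ((1 + Complex.normSq z) * (1 + Complex.normSq w))) := by
  have hz := one_add_normSq_pos z
  have hw := one_add_normSq_pos w
  rw [EuclideanSpace.dist_eq]
  congr 1
  simp only [Fin.sum_univ_three, stereo_coe, Real.dist_eq, sq_abs, Matrix.cons_val]
  field_simp
  simp only [Complex.normSq_apply, Complex.sub_re, Complex.sub_im]
  ring

theorem dist_stereo_infty (z : ℂ) : dist (stereo (z : OnePoint ℂ)) (stereo OnePoint.infty) =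
    Real.sqrt (4 / (1 + Complex.normSq z)) := by
  have hz := one_add_normSq_pos z
  rw [EuclideanSpace.dist_eq]
  congr 1
  simp only [Fin.sum_univ_three, stereo_coe, stereo_infty, Real.dist_eq, sq_abs, Matrix.cons_val]
  field_simp
  simp only [Complex.normSq_apply]
  ring

theorem continuous_stereo : Continuous stereo := by
  rw [OnePoint.continuous_iff]
  constructor
  · rw [tendsto_iff_dist_tendsto_zero]
    refine Tendsto.congr (fun z => (dist_stereo_infty z).symm) ?_
    rw [Filter.coclosedCompact_eq_cocompact, ← Metric.cobounded_eq_cocompact]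
    have h1 : Tendsto (fun z : ℂ => 1 + Complex.normSq z) (Bornology.cobounded ℂ) atTop := by
      refine tendsto_atTop_add_const_left _ 1 ?_
      refine ((tendsto_pow_atTop two_ne_zero).comp tendsto_norm_cobounded_atTop).congr ?_
      exact fun z => (Complex.normSq_eq_norm_sq z).symm
    have h2 := (h1.const_div_atTop (4 : ℝ)).sqrt
    simpa using h2
  · change Continuous fun z : ℂ => stereo (z : OnePoint ℂ)
    have h : ∀ z : ℂ, 1 + Complex.normSq z ≠ 0 := fun z => (one_add_normSq_pos z).ne'
    have hc := Complex.continuous_normSq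
    refine (PiLp.continuous_toLp 2 _).comp (continuous_pi fun i => ?_)
    fin_cases i
    · exact (continuous_const.mul Complex.continuous_re).div (continuous_const.add hc) h
    · exact (continuous_const.mul Complex.continuous_im).div (continuous_const.add hc) h
    · exact continuous_const.sub (continuous_const.div (continuous_const.add hc) h)

theorem isEmbedding_stereo : IsEmbedding stereo :=
  (continuous_stereo.isClosedEmbedding stereo_injective).isEmbedding

/-- The chordal metric on the Riemann sphere,
`d (z, w) = 2 |z - w| / √((1 + |z|²) (1 + |w|²))` and `d (z, ∞) = 2 / √(1 + |z|²)`.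
It induces the topology of `OnePoint ℂ`. -/
noncomputable abbrev chordalMetric : MetricSpace (OnePoint ℂ) := isEmbedding_stereo.comapMetricSpace

/-- An effective enumeration of the complex numbers with rational coordinates: the code
`⟨⟨⟨a, b⟩, ⟨c, d⟩⟩, m⟩` stands for `((a - b) + (c - d) i) / (m + 1)`. -/
noncomputable def rationalPoint (n : ℕ) : ℂ :=
  ⟨((n.unpair.1.unpair.1.unpair.1 : ℝ) - n.unpair.1.unpair.1.unpair.2) / (n.unpair.2 + 1),
    ((n.unpair.1.unpair.2.unpair.1 : ℝ) - n.unpair.1.unpair.2.unpair.2) / (n.unpair.2 + 1)⟩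

theorem exists_rationalPoint (x y : ℚ) : ∃ n, rationalPoint n = ⟨(x : ℝ), (y : ℝ)⟩ := by
  have key : ∀ k : ℤ, ∃ a b : ℕ, k = a - b := fun k =>
    ⟨k.toNat, (-k).toNat, (Int.toNat_sub_toNat_neg k).symm⟩
  obtain ⟨a, b, hab⟩ := key (x.num * y.den)
  obtain ⟨c, d, hcd⟩ := key (y.num * x.den)
  refine ⟨Nat.pair (Nat.pair (Nat.pair a b) (Nat.pair c d)) (x.den * y.den - 1), ?_⟩
  have hx : (x.den : ℝ) ≠ 0 := by exact_mod_cast x.den_nz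
  have hy : (y.den : ℝ) ≠ 0 := by exact_mod_cast y.den_nz
  have hm : ((x.den * y.den - 1 : ℕ) : ℝ) + 1 = x.den * y.den := by
    have : 1 ≤ x.den * y.den := Nat.mul_pos x.pos y.pos
    push_cast [Nat.cast_sub this]
    ring
  have hab' : (a : ℝ) - b = x.num * y.den := by exact_mod_cast hab.symm
  have hcd' : (c : ℝ) - d = y.num * x.den := by exact_mod_cast hcd.symm
  simp only [rationalPoint, Nat.unpair_pair]
  rw [hm, hab', hcd', Rat.cast_def x, Rat.cast_def y]
  congr 1 <;> field_simp

theorem denseRange_rationalPoint : DenseRange rationalPoint := by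
  have h : DenseRange (fun q : ℚ × ℚ => Complex.equivRealProdCLM.symm ((q.1 : ℝ), (q.2 : ℝ))) :=
    Complex.equivRealProdCLM.symm.surjective.denseRange.comp
      (Rat.denseRange_cast.prodMap Rat.denseRange_cast)
      Complex.equivRealProdCLM.symm.continuous
  refine h.mono ?_
  rintro _ ⟨q, rfl⟩
  obtain ⟨n, hn⟩ := exists_rationalPoint q.1 q.2
  exact ⟨n, by rw [hn]; rfl⟩


/-- Auxiliary: `natSqDist a b = (a - b)²`. -/
def natSqDist (a b : ℕ) : ℕ := (a - b) * (a - b) + (b - a) * (b - a)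

theorem natSqDist_cast (a b : ℕ) : (natSqDist a b : ℝ) = ((a : ℝ) - b) ^ 2 := by
  rcases le_total a b with h | h
  · simp only [natSqDist, Nat.sub_eq_zero_of_le h]
    push_cast [Nat.cast_sub h]
    ring
  · simp only [natSqDist, Nat.sub_eq_zero_of_le h]
    push_cast [Nat.cast_sub h]
    ring

theorem primrec_natSqDist : Primrec₂ natSqDist := by
  unfold natSqDist
  exact Primrec.nat_add.comp
    (Primrec.nat_mul.comp (Primrec.nat_sub.comp .fst .snd) (Primrec.nat_sub.comp .fst .snd))
    (Primrec.nat_mul.comp (Primrec.nat_sub.comp .snd .fst) (Primrec.nat_sub.comp .snd .fst))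

/-- Auxiliary: the components `a, b, c, d, m + 1` of a code of a rational point. -/
def codeA (n : ℕ) : ℕ := n.unpair.1.unpair.1.unpair.1
/-- Auxiliary, see `codeA`. -/
def codeB (n : ℕ) : ℕ := n.unpair.1.unpair.1.unpair.2
/-- Auxiliary, see `codeA`. -/
def codeC (n : ℕ) : ℕ := n.unpair.1.unpair.2.unpair.1
/-- Auxiliary, see `codeA`. -/
def codeD (n : ℕ) : ℕ := n.unpair.1.unpair.2.unpair.2
/-- Auxiliary, see `codeA`. -/
def codeM (n : ℕ) : ℕ := n.unpair.2 + 1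

/-- Auxiliary: numerator of the squared chordal distance of two rational points. -/
def distNum (i j : ℕ) : ℕ :=
  4 * (natSqDist (codeA i * codeM j + codeB j * codeM i) (codeB i * codeM j + codeA j * codeM i) +
    natSqDist (codeC i * codeM j + codeD j * codeM i) (codeD i * codeM j + codeC j * codeM i))

/-- Auxiliary: `(m + 1)² (1 + |z|²)` for the rational point `z`. -/
def distDen (i : ℕ) : ℕ :=
  codeM i * codeM i + (natSqDist (codeA i) (codeB i) + natSqDist (codeC i) (codeD i))

theorem primrec_codeM : Primrec codeM := Primrec.succ.comp (Primrec.snd.comp Primrec.unpair)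
theorem primrec_codeA : Primrec codeA :=
  Primrec.fst.comp <| Primrec.unpair.comp <| Primrec.fst.comp <| Primrec.unpair.comp <|
    Primrec.fst.comp Primrec.unpair
theorem primrec_codeB : Primrec codeB :=
  Primrec.snd.comp <| Primrec.unpair.comp <| Primrec.fst.comp <| Primrec.unpair.comp <|
    Primrec.fst.comp Primrec.unpair
theorem primrec_codeC : Primrec codeC :=
  Primrec.fst.comp <| Primrec.unpair.comp <| Primrec.snd.comp <| Primrec.unpair.comp <|
    Primrec.fst.comp Primrec.unpair
theorem primrec_codeD : Primrec codeD :=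
  Primrec.snd.comp <| Primrec.unpair.comp <| Primrec.snd.comp <| Primrec.unpair.comp <|
    Primrec.fst.comp Primrec.unpair

theorem primrec_distNum : Primrec₂ distNum := by
  have key : ∀ {u v u' v' : ℕ → ℕ}, Primrec u → Primrec v → Primrec u' → Primrec v' →
      Primrec₂ fun i j : ℕ => u i * v j + u' j * v' i := fun hu hv hu' hv' =>
    Primrec.nat_add.comp (Primrec.nat_mul.comp (hu.comp .fst) (hv.comp .snd))
      (Primrec.nat_mul.comp (hu'.comp .snd) (hv'.comp .fst))
  exact Primrec.nat_mul.comp (Primrec.const 4) (Primrec.nat_add.comp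
    (primrec_natSqDist.comp (key primrec_codeA primrec_codeM primrec_codeB primrec_codeM)
      (key primrec_codeB primrec_codeM primrec_codeA primrec_codeM))
    (primrec_natSqDist.comp (key primrec_codeC primrec_codeM primrec_codeD primrec_codeM)
      (key primrec_codeD primrec_codeM primrec_codeC primrec_codeM)))

theorem primrec_distDen : Primrec distDen :=
  Primrec.nat_add.comp (Primrec.nat_mul.comp primrec_codeM primrec_codeM)
    (Primrec.nat_add.comp (primrec_natSqDist.comp primrec_codeA primrec_codeB)
      (primrec_natSqDist.comp primrec_codeC primrec_codeD))

theorem rationalPoint_eq (n : ℕ) : rationalPoint n =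
    ⟨((codeA n : ℝ) - codeB n) / codeM n, ((codeC n : ℝ) - codeD n) / codeM n⟩ := by
  simp only [rationalPoint, codeA, codeB, codeC, codeD, codeM, Nat.cast_add, Nat.cast_one]

theorem distDen_pos (i : ℕ) : 0 < distDen i :=
  Nat.add_pos_left (Nat.mul_pos (Nat.succ_pos _) (Nat.succ_pos _)) _

theorem codeM_ne_zero (n : ℕ) : (codeM n : ℝ) ≠ 0 :=
  Nat.cast_ne_zero.2 (Nat.succ_ne_zero _)

theorem one_add_normSq_rationalPoint (n : ℕ) : 1 + Complex.normSq (rationalPoint n) =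
    (distDen n : ℝ) / ((codeM n : ℝ) * codeM n) := by
  have hk := codeM_ne_zero n
  rw [rationalPoint_eq, Complex.normSq_apply, distDen]
  push_cast [natSqDist_cast]
  generalize (codeM n : ℝ) = m at *
  field_simp

theorem four_mul_normSq_sub (i j : ℕ) :
    4 * Complex.normSq (rationalPoint i - rationalPoint j) =
      (distNum i j : ℝ) / ((codeM i : ℝ) * codeM i * (codeM j * codeM j)) := by
  have h1 := codeM_ne_zero i
  have h2 := codeM_ne_zero j
  rw [rationalPoint_eq i, rationalPoint_eq j, Complex.normSq_apply, distNum]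
  simp only [Complex.sub_re, Complex.sub_im]
  push_cast [natSqDist_cast]
  generalize (codeM i : ℝ) = m at *
  generalize (codeM j : ℝ) = m' at *
  field_simp
  ring

theorem dist_rationalPoint (i j : ℕ) :
    dist (stereo (rationalPoint i : OnePoint ℂ)) (stereo (rationalPoint j : OnePoint ℂ)) =
      Real.sqrt ((distNum i j : ℝ) / (distDen i * distDen j : ℕ)) := by
  rw [dist_stereo_coe, four_mul_normSq_sub, one_add_normSq_rationalPoint,
    one_add_normSq_rationalPoint, Nat.cast_mul, div_mul_div_comm, div_div_div_cancel_right₀]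
  exact mul_ne_zero (mul_ne_zero (codeM_ne_zero i) (codeM_ne_zero i))
    (mul_ne_zero (codeM_ne_zero j) (codeM_ne_zero j))

theorem primrec_pow_two : Primrec fun n : ℕ => 2 ^ n := by
  have h := Primrec.nat_rec₁ (f := fun _ r : ℕ => 2 * r) 1
    (Primrec.nat_mul.comp (Primrec.const 2) Primrec.snd)
  refine h.of_eq fun n => ?_
  induction n with
  | zero => rfl
  | succ n ih =>
    rw [pow_succ, ← ih]
    exact mul_comm _ _

theorem sqrt_approx (N D n : ℕ) (hD : 0 < D) :
    |Real.sqrt ((N : ℝ) / D) - (Nat.sqrt (N * (2 ^ n * 2 ^ n) / D) : ℝ) / 2 ^ n|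
      < (1 / 2 : ℝ) ^ n := by
  have hp : (0 : ℝ) < 2 ^ n := by positivity
  have hD' : (0 : ℝ) < D := Nat.cast_pos.2 hD
  set k := Nat.sqrt (N * (2 ^ n * 2 ^ n) / D)
  have l1 : k * k * D ≤ N * (2 ^ n * 2 ^ n) := (Nat.le_div_iff_mul_le hD).1 (Nat.sqrt_le _)
  have l2 : N * (2 ^ n * 2 ^ n) < (k + 1) * (k + 1) * D :=
    (Nat.div_lt_iff_lt_mul hD).1 (Nat.sqrt_lt.1 (Nat.lt_succ_self _))
  have l1' : (k : ℝ) * k * D ≤ N * (2 ^ n * 2 ^ n) := by exact_mod_cast l1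
  have l2' : (N : ℝ) * (2 ^ n * 2 ^ n) < (k + 1) * (k + 1) * D := by exact_mod_cast l2
  have u1 : (k : ℝ) / 2 ^ n ≤ Real.sqrt ((N : ℝ) / D) := by
    apply Real.le_sqrt_of_sq_le
    rw [div_pow, div_le_div_iff₀ (by positivity) hD']
    linarith
  have u2 : Real.sqrt ((N : ℝ) / D) < ((k : ℝ) + 1) / 2 ^ n := by
    rw [Real.sqrt_lt' (by positivity), div_pow, div_lt_div_iff₀ hD' (by positivity)]
    linarith
  rw [add_div, ← one_div_pow] at u2
  have := pow_pos (one_half_pos (α := ℝ)) n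
  rw [abs_lt]
  constructor <;> linarith

theorem dist_computable : ∃ a b : ℕ × ℕ × ℕ → ℕ, Computable a ∧ Computable b ∧
    ∀ i j n : ℕ, |dist (stereo (rationalPoint i : OnePoint ℂ))
        (stereo (rationalPoint j : OnePoint ℂ)) - (a (i, j, n) : ℝ) / ((b (i, j, n) : ℝ) + 1)|
      < (1 / 2 : ℝ) ^ n := by
  refine ⟨fun t => Nat.sqrt (distNum t.1 t.2.1 * (2 ^ t.2.2 * 2 ^ t.2.2) /
    (distDen t.1 * distDen t.2.1)), fun t => 2 ^ t.2.2 - 1, ?_, ?_, ?_⟩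
  · refine Primrec.to_comp (Primrec.nat_sqrt.comp (Primrec.nat_div.comp
      (Primrec.nat_mul.comp (primrec_distNum.comp .fst (Primrec.fst.comp .snd))
        (Primrec.nat_mul.comp ?_ ?_))
      (Primrec.nat_mul.comp (primrec_distDen.comp .fst)
        (primrec_distDen.comp (Primrec.fst.comp .snd)))))
    all_goals exact primrec_pow_two.comp (Primrec.snd.comp .snd)
  · exact Primrec.to_comp (Primrec.nat_sub.comp
      (primrec_pow_two.comp (Primrec.snd.comp .snd)) (Primrec.const 1))
  · intro i j n
    have h : (((2 ^ n - 1 : ℕ) : ℝ) + 1) = 2 ^ n := by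
      have : 1 ≤ 2 ^ n := Nat.one_le_two_pow
      push_cast [Nat.cast_sub this]
      ring
    simp only [h, dist_rationalPoint]
    exact sqrt_approx _ _ _ (Nat.mul_pos (distDen_pos i) (distDen_pos j))

/-- The Riemann sphere as a computable metric space: the chordal metric, and the complex numbers
with rational coordinates as ideal points. -/
noncomputable def computableSphere : ComputableMetricSpace (OnePoint ℂ) where
  toMetricSpace := chordalMetric
  ideal n := (rationalPoint n : OnePoint ℂ)
  dense_ideal := OnePoint.denseRange_coe.comp denseRange_rationalPoint OnePoint.continuous_coe
  dist_computable := dist_computable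

/-! ### Holomorphic maps of the Riemann sphere and the Riemann map at infinity -/

/-- The coordinate `z` of a finite point of the sphere (with the dummy value `0` at `∞`). -/
def toComplex : OnePoint ℂ → ℂ
  | none => 0
  | some z => z

open Classical in
/-- The standard chart of the sphere around `p`: the coordinate `z` if `p` is finite, and the
coordinate `1 / z` (which is `0` at `∞`) if `p = ∞`. -/
noncomputable def chart (p : OnePoint ℂ) : OnePoint ℂ → ℂ :=
  if p = OnePoint.infty then fun q => (toComplex q)⁻¹ else toComplex

open Classical in
/-- The inverse of `chart p`. -/
noncomputable def chartInv (p : OnePoint ℂ) : ℂ → OnePoint ℂ :=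
  if p = OnePoint.infty then fun u => if u = 0 then OnePoint.infty else ((u⁻¹ : ℂ) : OnePoint ℂ)
  else fun u => (u : OnePoint ℂ)

/-- `f` is holomorphic near `p`, as a map from the Riemann sphere to itself. -/
def HolomorphicAt (f : OnePoint ℂ → OnePoint ℂ) (p : OnePoint ℂ) : Prop :=
  ContinuousAt f p ∧ AnalyticAt ℂ (chart (f p) ∘ f ∘ chartInv p) (chart p p)

/-- The complement of the closed unit disk in the Riemann sphere. -/
def exteriorDisk : Set (OnePoint ℂ) := ((↑) '' Metric.closedBall (0 : ℂ) 1)ᶜ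

/-- `φ` restricts to a Riemann map of the domain `W` of the sphere with base point `∞`, that is, to
a conformal bijection of the complement of the closed unit disk onto `W` with `φ(∞) = ∞` and
`φ'(∞) > 0`, where `φ'(∞) = lim φ(z) / z` as `z → ∞`. -/
structure IsRiemannMap (W : Set (OnePoint ℂ)) (φ : OnePoint ℂ → OnePoint ℂ) : Prop where
  bijOn : BijOn φ exteriorDisk W
  holomorphic : ∀ p ∈ exteriorDisk, HolomorphicAt φ p
  map_infty : φ OnePoint.infty = OnePoint.infty
  deriv_pos : ∃ r : ℝ, 0 < r ∧
    Tendsto (fun z : ℂ => toComplex (φ z) / z) (Bornology.cobounded ℂ) (𝓝 (r : ℂ))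

end RiemannSphere

/-- The Mandelbrot set: the parameters `c` for which the orbit of `0` under `z ↦ z² + c` is
bounded. -/
def mandelbrotSet : Set ℂ :=
  {c | BddAbove (range fun n : ℕ => ‖(fun z : ℂ => z ^ 2 + c)^[n] 0‖)}

/-- The complement of the Mandelbrot set in the Riemann sphere. -/
def mandelbrotExterior : Set (OnePoint ℂ) := ((↑) '' mandelbrotSet)ᶜ

/-! This is the Douady–Hubbard uniformization: the Böttcher coordinate of the critical value `c` of
`quad c`, as a function of `c`, maps the exterior of the Mandelbrot set onto the exterior of the
disk.

Near infinity the Böttcher coordinate is the product `z ∏ (1 + c / f^k(z)^2)^(1 / 2^(k+1))`. Its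
inverse `w ↦ w * h (c, 1 / w)` solves `h(c,u)^2 = h(c,u^2) - c u^2`, so it extends inwards by square
roots as long as the critical value has not been met (`exists_extension`). For an escaping parameter
the extension reaches `c` itself (`exists_local_isBottcherInverse`), at exactly one `u`
(`IsExternalCoord.unique`), and this `u` depends holomorphically on `c`. In the coordinate `v = 1 /
c` the map `recipCoord : v ↦ u` is a proper holomorphic map of a bounded open set into the unit
disk, whose only zero is `0`, with derivative `1` there. Such a map is bijective
(`bijOn_ball_of_proper`), so no prior knowledge of the topology of the Mandelbrot set is needed. Its
inverse, read in the charts at infinity, is the Riemann map; the Schwarz lemma gives uniqueness.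

For computability put `c = c(u)`. The functions `u^(2^n) f_c^n(c)` satisfy a polynomial recursion in
`n` and are `1 + O(u^(2^(n+1)-1))`. Comparing coefficients gives a finite downward recursion over
the rationals for the Taylor coefficients of `u c(u)`, that is, for the Laurent coefficients of the
Riemann map (`beta_recursion`). Since `1/4 ≤ |u c(u)| ≤ 1000` on the whole disk, Cauchy's estimates
bound the tails explicitly, and a chordal error, being relative to the size of the value, stays
controlled near infinity. The algorithm reads the oracle until an approximation certifies `|1/z| ≤ 1
- 2^(-j)` at a precision adapted to `j`, and then evaluates a partial Laurent sum there. -/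

namespace MandelbrotRiemann

/-! ### The region of geometric escape -/

/-- The quadratic polynomial `z ↦ z ^ 2 + c`. -/
abbrev quad (c : ℂ) : ℂ → ℂ := fun z => z ^ 2 + c

/-- `z` is so large that its orbit under `quad c` escapes geometrically. -/
def Far (c z : ℂ) : Prop := 100 < ‖z‖ ∧ 10 * ‖c‖ < ‖z‖

theorem Far.ne_zero {c z : ℂ} (h : Far c z) : z ≠ 0 := by
  rintro rfl
  have := h.1
  norm_num at this

/-- `|z|^2 - |c| ≥ 100 |z| - |z| / 10`, far more than needed. -/
theorem Far.two_mul_norm_le {c z : ℂ} (h : Far c z) : 2 * ‖z‖ ≤ ‖quad c z‖ := by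
  obtain ⟨h1, h2⟩ := h
  have : ‖z‖ ^ 2 - ‖c‖ ≤ ‖quad c z‖ := by
    have := norm_sub_le_norm_add (z ^ 2) c
    rwa [norm_pow] at this
  nlinarith

theorem Far.map_quad {c z : ℂ} (h : Far c z) : Far c (quad c z) := by
  have h1 := h.two_mul_norm_le
  obtain ⟨h2, h3⟩ := h
  exact ⟨by linarith, by linarith⟩

theorem Far.iterate {c z : ℂ} (h : Far c z) (n : ℕ) :
    Far c ((quad c)^[n] z) := by
  induction n with
  | zero => exact h
  | succ n ih => rw [Function.iterate_succ_apply']; exact ih.map_quad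

theorem Far.norm_iterate {c z : ℂ} (h : Far c z) (n : ℕ) :
    2 ^ n * ‖z‖ ≤ ‖(quad c)^[n] z‖ := by
  induction n with
  | zero => simp
  | succ n ih =>
    rw [Function.iterate_succ_apply', pow_succ]
    have := (h.iterate n).two_mul_norm_le
    linarith

/-- `|c| / |z|^2 ≤ 1 / (10 |z|)`. This smallness keeps every factor of the Böttcher product near
`1`, where the principal logarithm is harmless. -/
theorem Far.norm_div_sq_le {c z : ℂ} (h : Far c z) : ‖c / z ^ 2‖ ≤ 1 / 1000 := by
  obtain ⟨h1, h2⟩ := h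
  rw [norm_div, norm_pow, div_le_div_iff₀ (by positivity) (by norm_num)]
  nlinarith

theorem isOpen_setOf_far : IsOpen {p : ℂ × ℂ | Far p.1 p.2} := by
  refine (isOpen_lt continuous_const ?_).and (isOpen_lt ?_ ?_) <;> fun_prop

theorem continuous_iterate_quad (n : ℕ) :
    Continuous fun p : ℂ × ℂ => (quad p.1)^[n] p.2 := by
  induction n with
  | zero => exact continuous_snd
  | succ n ih =>
    simp only [Function.iterate_succ_apply']
    exact (ih.pow 2).add continuous_fst

theorem differentiableOn_iterate_quad {p q : ℂ → ℂ} {U : Set ℂ} (hp : DifferentiableOn ℂ p U)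
    (hq : DifferentiableOn ℂ q U) (n : ℕ) :
    DifferentiableOn ℂ (fun t => (quad (p t))^[n] (q t)) U := by
  induction n with
  | zero => exact hq
  | succ n ih =>
    simp only [Function.iterate_succ_apply']
    exact (ih.pow 2).add hp

/-! ### The Böttcher coordinate near infinity -/

/-- The terms of the logarithm of the Böttcher product. -/
noncomputable def bottcherTerm (k : ℕ) (c z : ℂ) : ℂ :=
  (1 / 2) ^ (k + 1) * Complex.log (1 + c / ((quad c)^[k] z) ^ 2)

/-- The logarithm of the quotient of the Böttcher coordinate of `quad c` by the identity. -/
noncomputable def bottcherLog (c z : ℂ) : ℂ := ∑' k, bottcherTerm k c z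

/-- The Böttcher coordinate of `quad c` near infinity. -/
noncomputable def bottcher (c z : ℂ) : ℂ := z * Complex.exp (bottcherLog c z)

theorem Far.norm_bottcherTerm_le {c z : ℂ} (h : Far c z) (k : ℕ) :
    ‖bottcherTerm k c z‖ ≤ (1 / 2) ^ k * (1 / 1000) := by
  have h1 := (h.iterate k).norm_div_sq_le
  have h2 := Complex.norm_log_one_add_half_le_self (h1.trans (by norm_num))
  rw [bottcherTerm, norm_mul, norm_pow, pow_succ, mul_assoc]
  have h3 : ‖(1 / 2 : ℂ)‖ = 1 / 2 := by norm_num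
  rw [h3]
  gcongr
  linarith

theorem summable_half_pow_mul (C : ℝ) : Summable fun k : ℕ => (1 / 2 : ℝ) ^ k * C :=
  (summable_geometric_of_lt_one (by norm_num) (by norm_num)).mul_right _

theorem Far.summable_bottcherTerm {c z : ℂ} (h : Far c z) :
    Summable fun k => bottcherTerm k c z :=
  .of_norm_bounded (summable_half_pow_mul _) h.norm_bottcherTerm_le

theorem Far.norm_bottcherLog_le {c z : ℂ} (h : Far c z) : ‖bottcherLog c z‖ ≤ 1 / 500 := by
  refine (tsum_of_norm_bounded ((hasSum_geometric_of_lt_one (by norm_num)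
    (by norm_num)).mul_right (1 / 1000 : ℝ)) h.norm_bottcherTerm_le).trans ?_
  norm_num

theorem Far.norm_exp_bottcherLog_sub_one_le {c z : ℂ} (h : Far c z) :
    ‖Complex.exp (bottcherLog c z) - 1‖ ≤ 1 / 250 := by
  have h1 := h.norm_bottcherLog_le
  have := Complex.norm_exp_sub_one_le (h1.trans (by norm_num))
  linarith

theorem Far.norm_bottcher_sub_le {c z : ℂ} (h : Far c z) :
    ‖bottcher c z - z‖ ≤ ‖z‖ / 250 := by
  rw [bottcher, show z * Complex.exp (bottcherLog c z) - z
    = z * (Complex.exp (bottcherLog c z) - 1) by ring, norm_mul]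
  have := h.norm_exp_bottcherLog_sub_one_le
  nlinarith [norm_nonneg z]

theorem Far.norm_bottcher_le {c z : ℂ} (h : Far c z) : ‖bottcher c z‖ ≤ 2 * ‖z‖ := by
  have h1 := h.norm_bottcher_sub_le
  have h2 := norm_sub_norm_le (bottcher c z) z
  linarith [norm_nonneg z]

theorem Far.le_norm_bottcher {c z : ℂ} (h : Far c z) : 9 / 10 * ‖z‖ ≤ ‖bottcher c z‖ := by
  have h1 := h.norm_bottcher_sub_le
  have h2 := norm_sub_norm_le z (bottcher c z)
  rw [norm_sub_rev] at h2
  linarith [norm_nonneg z]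

theorem Far.one_lt_norm_bottcher {c z : ℂ} (h : Far c z) : 1 < ‖bottcher c z‖ := by
  have := h.le_norm_bottcher
  have := h.1
  linarith

theorem Far.bottcher_ne_zero {c z : ℂ} (h : Far c z) : bottcher c z ≠ 0 :=
  mul_ne_zero h.ne_zero (Complex.exp_ne_zero _)

/-- Doubling the series cancels one factor `1 / 2` and splits off the term `k = 0`; the rest is the
series at `quad c z`. Exponentiating, `z^2 (1 + c / z^2) = quad c z`. -/
theorem Far.bottcher_quad {c z : ℂ} (h : Far c z) : bottcher c (quad c z) = bottcher c z ^ 2 := by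
  have h0 : 2 * bottcherLog c z =
      Complex.log (1 + c / z ^ 2) + bottcherLog c (quad c z) := by
    rw [bottcherLog, h.summable_bottcherTerm.tsum_eq_zero_add, mul_add, ← tsum_mul_left,
      bottcherLog]
    congr 1
    · simp [bottcherTerm]
    · refine tsum_congr fun k => ?_
      simp only [bottcherTerm, Function.iterate_succ_apply]
      ring
  have hz := h.ne_zero
  have h1 : 1 + c / z ^ 2 ≠ 0 := by
    have := Complex.mem_slitPlane_of_norm_lt_one (h.norm_div_sq_le.trans_lt (by norm_num))
    exact Complex.slitPlane_ne_zero this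
  rw [bottcher, bottcher, mul_pow, ← Complex.exp_nat_mul, Nat.cast_ofNat, h0, Complex.exp_add,
    Complex.exp_log h1]
  field_simp

theorem Far.bottcher_iterate {c z : ℂ} (h : Far c z) (n : ℕ) :
    bottcher c ((quad c)^[n] z) = bottcher c z ^ 2 ^ n := by
  induction n with
  | zero => simp
  | succ n ih =>
    rw [Function.iterate_succ_apply', (h.iterate n).bottcher_quad, ih, ← pow_mul, ← pow_succ]

/-- A locally uniform limit of holomorphic functions. Both arguments may move with `t`, because
later the parameter itself is the variable. -/
theorem differentiableOn_bottcher {p q : ℂ → ℂ} {U : Set ℂ} (hU : IsOpen U)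
    (hp : DifferentiableOn ℂ p U) (hq : DifferentiableOn ℂ q U) (hf : ∀ t ∈ U, Far (p t) (q t)) :
    DifferentiableOn ℂ (fun t => bottcher (p t) (q t)) U := by
  refine hq.mul (DifferentiableOn.cexp ?_)
  refine Complex.differentiableOn_tsum_of_summable_norm (summable_half_pow_mul (1 / 1000))
    (fun k => ?_) hU fun k t ht => (hf t ht).norm_bottcherTerm_le k
  refine (differentiableOn_const _).mul (DifferentiableOn.clog ?_ fun t ht =>
    Complex.mem_slitPlane_of_norm_lt_one
      (((hf t ht).iterate k).norm_div_sq_le.trans_lt (by norm_num)))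
  exact (differentiableOn_const _).add (hp.div ((differentiableOn_iterate_quad hp hq k).pow 2)
    fun t ht => pow_ne_zero 2 ((hf t ht).iterate k).ne_zero)

/-! ### Escaping parameters -/

theorem iterate_quad_zero (c : ℂ) (n : ℕ) : (quad c)^[n + 1] 0 = (quad c)^[n] c := by
  rw [Function.iterate_succ_apply]
  simp [quad]

theorem exists_far_of_notMem {c : ℂ} (hc : c ∉ mandelbrotSet) :
    ∃ n, Far c ((quad c)^[n] c) := by
  rw [mandelbrotSet, mem_ofPred_eq, not_bddAbove_iff] at hc
  obtain ⟨_, ⟨n, rfl⟩, hn⟩ := hc (max 100 (10 * ‖c‖))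
  cases n with
  | zero =>
    have := (le_max_left _ _).trans_lt hn
    norm_num at this
  | succ n =>
    have hn' : max 100 (10 * ‖c‖) < ‖(quad c)^[n] c‖ := by
      rw [← iterate_quad_zero]; exact hn
    exact ⟨n, (le_max_left _ _).trans_lt hn', (le_max_right _ _).trans_lt hn'⟩

theorem notMem_of_far {c : ℂ} {n : ℕ} (h : Far c ((quad c)^[n] c)) : c ∉ mandelbrotSet := by
  rintro ⟨B, hB⟩
  obtain ⟨k, hk⟩ := pow_unbounded_of_one_lt B one_lt_two
  have h1 := hB ⟨k + n + 1, rfl⟩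
  have h2 : ‖(quad c)^[k + n + 1] 0‖ ≤ B := h1
  rw [iterate_quad_zero, Function.iterate_add_apply] at h2
  have h3 := h.norm_iterate k
  have h4 := h.1
  have : (0 : ℝ) < 2 ^ k := by positivity
  nlinarith

theorem zero_mem_mandelbrotSet : (0 : ℂ) ∈ mandelbrotSet := by
  refine ⟨0, ?_⟩
  rintro _ ⟨n, rfl⟩
  have : (fun z : ℂ => z ^ 2 + 0)^[n] 0 = 0 := Function.iterate_fixed (by simp) n
  simp only [this, norm_zero, le_refl]

theorem mem_mandelbrotSet_of_norm_le {c : ℂ} (hc : ‖c‖ ≤ 1 / 4) : c ∈ mandelbrotSet := by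
  refine ⟨1 / 2, ?_⟩
  rintro _ ⟨n, rfl⟩
  change ‖(quad c)^[n] 0‖ ≤ 1 / 2
  induction n with
  | zero => norm_num
  | succ n ih =>
    rw [Function.iterate_succ_apply']
    refine (norm_add_le _ _).trans ?_
    rw [norm_pow]
    nlinarith [norm_nonneg ((quad c)^[n] 0)]

end MandelbrotRiemann

namespace MandelbrotRiemann

/-! ### Square roots near `1` -/

/-- Here `|q + 1| ≥ 1`. Read backwards, the principal square root does not increase the distance to
`1`; the next lemma is the analogue for two points. -/
theorem norm_sub_one_le_norm_sq_sub_one {q : ℂ} (hq : 0 ≤ q.re) : ‖q - 1‖ ≤ ‖q ^ 2 - 1‖ := by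
  have h1 : 1 ≤ ‖q + 1‖ := by
    refine le_trans ?_ (Complex.re_le_norm _)
    simpa using hq
  rw [show q ^ 2 - 1 = (q - 1) * (q + 1) by ring, norm_mul]
  exact le_mul_of_one_le_right (norm_nonneg _) h1

theorem norm_sub_le_norm_sq_sub_sq {p q : ℂ} (hp : 1 / 2 ≤ p.re) (hq : 1 / 2 ≤ q.re) :
    ‖p - q‖ ≤ ‖p ^ 2 - q ^ 2‖ := by
  have h1 : 1 ≤ ‖p + q‖ := by
    refine le_trans ?_ (Complex.re_le_norm _)
    rw [Complex.add_re]
    linarith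
  rw [show p ^ 2 - q ^ 2 = (p - q) * (p + q) by ring, norm_mul]
  exact le_mul_of_one_le_right (norm_nonneg _) h1

theorem one_sub_le_re {z : ℂ} {r : ℝ} (h : ‖z - 1‖ ≤ r) : 1 - r ≤ z.re := by
  have := (Complex.abs_re_le_norm (z - 1)).trans h
  rw [Complex.sub_re, Complex.one_re] at this
  linarith [(abs_le.1 this).1]

theorem sqrt_sq (z : ℂ) : Complex.sqrt z ^ 2 = z := by
  have := Complex.cpow_nat_inv_pow z two_ne_zero
  rwa [Nat.cast_ofNat] at this

theorem re_sqrt_nonneg (z : ℂ) : 0 ≤ (Complex.sqrt z).re := by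
  rw [Complex.sqrt, Complex.cpow_inv_two_re]
  exact Real.sqrt_nonneg _

/-- Uniqueness device: an error that can only grow under `u ↦ u^2` but tends to `0` along `u^(2^k)`
vanishes. -/
theorem eq_zero_of_le_succ_of_tendsto {e : ℕ → ℝ} (h0 : 0 ≤ e 0) (h : ∀ k, e k ≤ e (k + 1))
    (ht : Tendsto e atTop (𝓝 0)) : e 0 = 0 :=
  le_antisymm ((monotone_nat_of_le_succ h).ge_of_tendsto ht 0) h0

theorem tendsto_pow_two_pow {u : ℂ} (hu : ‖u‖ < 1) :
    Tendsto (fun k : ℕ => u ^ 2 ^ k) atTop (𝓝 0) :=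
  (tendsto_pow_atTop_nhds_zero_of_norm_lt_one hu).comp
    (tendsto_pow_atTop_atTop_of_one_lt one_lt_two)

/-! ### The inverse Böttcher coordinate near infinity -/

/-- Approximations of the inverse Böttcher coordinate: `f_c ^ n` maps `h / u` to `1 / u ^ 2 ^ n`,
where `h = bottcherInvApprox n c u`. -/
noncomputable def bottcherInvApprox : ℕ → ℂ → ℂ → ℂ
  | 0, _, _ => 1
  | n + 1, c, u => Complex.sqrt (bottcherInvApprox n c (u ^ 2) - c * u ^ 2)

theorem bottcherInvApprox_succ_sq (n : ℕ) (c u : ℂ) :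
    bottcherInvApprox (n + 1) c u ^ 2 = bottcherInvApprox n c (u ^ 2) - c * u ^ 2 := by
  rw [bottcherInvApprox, sqrt_sq]

/-- The pairs `(c, u)` for which the approximations converge. -/
def invDomain : Set (ℂ × ℂ) := {p | ‖p.2‖ ^ 2 < 1 / 2 ∧ ‖p.1‖ * ‖p.2‖ ^ 2 < 1 / 8}

theorem sq_mem_invDomain {c u : ℂ} (h : (c, u) ∈ invDomain) : (c, u ^ 2) ∈ invDomain := by
  obtain ⟨h1, h2⟩ := h
  simp only at h1 h2
  constructor <;> simp only [norm_pow] <;>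
    nlinarith [norm_nonneg u, norm_nonneg c, mul_nonneg (norm_nonneg c) (sq_nonneg ‖u‖)]

/-- One root step adds `|c| |u|^2` to the bound at `u^2`, which is `2 |c| |u|^4 ≤ |c| |u|^2` because
`|u|^2 < 1/2`. The condition `|c| |u|^2 < 1/8` then keeps all approximations in the half-plane where
square roots contract. -/
theorem norm_bottcherInvApprox_sub_one_le (n : ℕ) {c u : ℂ} (h : (c, u) ∈ invDomain) :
    ‖bottcherInvApprox n c u - 1‖ ≤ 2 * (‖c‖ * ‖u‖ ^ 2) := by
  induction n generalizing u with
  | zero =>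
    simp only [bottcherInvApprox, sub_self, norm_zero]
    positivity
  | succ n ih =>
    have h1 := ih (sq_mem_invDomain h)
    refine (norm_sub_one_le_norm_sq_sub_one (re_sqrt_nonneg _)).trans ?_
    rw [sqrt_sq, sub_right_comm]
    refine (norm_sub_le _ _).trans ?_
    rw [norm_mul, norm_pow]
    rw [norm_pow] at h1
    have h2 := h.1
    simp only at h2
    nlinarith [mul_nonneg (norm_nonneg c) (sq_nonneg ‖u‖)]

theorem half_le_re_bottcherInvApprox (n : ℕ) {c u : ℂ} (h : (c, u) ∈ invDomain) :
    1 / 2 ≤ (bottcherInvApprox n c u).re := by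
  have h1 := one_sub_le_re (norm_bottcherInvApprox_sub_one_le n h)
  have h2 := h.2
  simp only at h2
  linarith

/-- Taking squares passes from `u` to `u^2` and cancels the common `c u^2`; each passage gains a
factor `|u|^2 < 1/2`. -/
theorem norm_bottcherInvApprox_succ_sub_le (n : ℕ) {c u : ℂ} (h : (c, u) ∈ invDomain) :
    ‖bottcherInvApprox (n + 1) c u - bottcherInvApprox n c u‖ ≤
      (1 / 2) ^ n * (2 * (‖c‖ * ‖u‖ ^ 2)) := by
  induction n generalizing u with
  | zero => simpa [bottcherInvApprox] using norm_bottcherInvApprox_sub_one_le 1 h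
  | succ n ih =>
    refine (norm_sub_le_norm_sq_sub_sq (half_le_re_bottcherInvApprox _ h)
      (half_le_re_bottcherInvApprox _ h)).trans ?_
    rw [bottcherInvApprox_succ_sq, bottcherInvApprox_succ_sq, sub_sub_sub_cancel_right]
    refine (ih (sq_mem_invDomain h)).trans ?_
    rw [norm_pow, pow_succ (1 / 2 : ℝ) n, mul_assoc]
    have h2 := h.1
    simp only at h2
    refine mul_le_mul_of_nonneg_left ?_ (by positivity)
    nlinarith [mul_nonneg (norm_nonneg c) (sq_nonneg ‖u‖)]

theorem continuousOn_bottcherInvApprox (n : ℕ) :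
    ContinuousOn (fun p : ℂ × ℂ => bottcherInvApprox n p.1 p.2) invDomain := by
  induction n with
  | zero => exact continuousOn_const
  | succ n ih =>
    refine Complex.continuousOn_sqrt.comp ?_ ?_
    · refine ContinuousOn.sub ?_ (by fun_prop)
      exact ih.comp (f := fun p : ℂ × ℂ => (p.1, p.2 ^ 2)) (by fun_prop)
        fun p hp => sq_mem_invDomain hp
    · rintro ⟨c, u⟩ hp
      refine Or.inl ?_
      have h1 := norm_bottcherInvApprox_sub_one_le (n + 1) hp
      have h2 := norm_bottcherInvApprox_sub_one_le n (sq_mem_invDomain hp)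
      have h3 := hp.1
      have h4 := hp.2
      simp only [norm_pow] at h2 h3 h4 ⊢
      have h5 : ‖bottcherInvApprox n c (u ^ 2) - c * u ^ 2 - 1‖ ≤ 1 / 2 := by
        rw [sub_right_comm]
        refine (norm_sub_le _ _).trans ?_
        rw [norm_mul, norm_pow]
        nlinarith [mul_nonneg (norm_nonneg c) (sq_nonneg ‖u‖)]
      have := one_sub_le_re h5
      linarith

/-- The inverse Böttcher coordinate of `quad c` is `w ↦ w * bottcherInv (c, 1 / w)`. -/
noncomputable def bottcherInv (p : ℂ × ℂ) : ℂ :=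
  1 + ∑' n, (bottcherInvApprox (n + 1) p.1 p.2 - bottcherInvApprox n p.1 p.2)

theorem norm_bottcherInvApprox_succ_sub_le' (n : ℕ) {p : ℂ × ℂ} (h : p ∈ invDomain) :
    ‖bottcherInvApprox (n + 1) p.1 p.2 - bottcherInvApprox n p.1 p.2‖ ≤
      (1 / 2) ^ n * (1 / 4) := by
  refine (norm_bottcherInvApprox_succ_sub_le n h).trans ?_
  have := h.2
  gcongr
  linarith

theorem continuousOn_bottcherInv : ContinuousOn bottcherInv invDomain := by
  refine continuousOn_const.add (continuousOn_tsum (fun n =>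
    (continuousOn_bottcherInvApprox _).sub (continuousOn_bottcherInvApprox _))
    (summable_half_pow_mul (1 / 4)) fun n p hp => norm_bottcherInvApprox_succ_sub_le' n hp)

theorem tendsto_bottcherInvApprox {c u : ℂ} (h : (c, u) ∈ invDomain) :
    Tendsto (fun n => bottcherInvApprox n c u) atTop (𝓝 (bottcherInv (c, u))) := by
  have h1 : Summable fun n => bottcherInvApprox (n + 1) c u - bottcherInvApprox n c u :=
    .of_norm_bounded (summable_half_pow_mul (1 / 4))
      fun n => norm_bottcherInvApprox_succ_sub_le' n h
  have h2 := h1.hasSum.tendsto_sum_nat.const_add 1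
  refine h2.congr fun n => ?_
  rw [Finset.sum_range_sub fun i => bottcherInvApprox i c u]
  simp [bottcherInvApprox]

theorem norm_bottcherInv_sub_one_le {c u : ℂ} (h : (c, u) ∈ invDomain) :
    ‖bottcherInv (c, u) - 1‖ ≤ 2 * (‖c‖ * ‖u‖ ^ 2) :=
  le_of_tendsto ((tendsto_bottcherInvApprox h).sub_const 1).norm
    (.of_forall fun n => norm_bottcherInvApprox_sub_one_le n h)

/-- The limit of the recursion that defines the approximations. -/
theorem bottcherInv_sq {c u : ℂ} (h : (c, u) ∈ invDomain) :
    bottcherInv (c, u) ^ 2 = bottcherInv (c, u ^ 2) - c * u ^ 2 := by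
  have h1 := ((tendsto_bottcherInvApprox h).comp (tendsto_add_atTop_nat 1)).pow 2
  have h2 := (tendsto_bottcherInvApprox (sq_mem_invDomain h)).sub_const (c * u ^ 2)
  refine tendsto_nhds_unique h1 (h2.congr fun n => ?_)
  simp only [Function.comp_apply, bottcherInvApprox_succ_sq]

/-! ### Inverse Böttcher coordinates on large disks -/

/-- For the parameters `c ∈ N`, the map `w ↦ w * h (c, 1 / w)` is an inverse Böttcher coordinate of
`quad c` on the exterior of the disk of radius `1 / s`, without zeros. -/
structure IsBottcherInverse (N : Set ℂ) (s : ℝ) (h : ℂ × ℂ → ℂ) : Prop where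
  pos : 0 < s
  le_one : s ≤ 1
  continuousOn : ContinuousOn h (N ×ˢ Metric.ball 0 s)
  map_zero : ∀ c ∈ N, h (c, 0) = 1
  ne_zero : ∀ c ∈ N, ∀ u, ‖u‖ < s → h (c, u) ≠ 0
  sq_eq : ∀ c ∈ N, ∀ u, ‖u‖ < s → h (c, u) ^ 2 = h (c, u ^ 2) - c * u ^ 2

theorem norm_sq_lt_of_norm_lt {s : ℝ} (hs : s ≤ 1) {u : ℂ} (hu : ‖u‖ < s) : ‖u ^ 2‖ < s := by
  rw [norm_pow]
  nlinarith [norm_nonneg u]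

theorem norm_pow_lt_of_norm_lt {s : ℝ} (hs : s ≤ 1) {u : ℂ} (hu : ‖u‖ < s) {n : ℕ} (hn : n ≠ 0) :
    ‖u ^ n‖ < s := by
  rw [norm_pow]
  exact (pow_le_of_le_one (norm_nonneg _) (hu.le.trans hs) hn).trans_lt hu

theorem isBottcherInverse_bottcherInv {N : Set ℂ} {s : ℝ} (hs : 0 < s) (hs1 : s ≤ 1)
    (h : N ×ˢ Metric.ball 0 s ⊆ invDomain) : IsBottcherInverse N s bottcherInv where
  pos := hs
  le_one := hs1
  continuousOn := continuousOn_bottcherInv.mono h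
  map_zero c hc := by
    have := norm_bottcherInv_sub_one_le (h (mk_mem_prod hc (Metric.mem_ball_self hs)))
    simpa [sub_eq_zero] using this
  ne_zero c hc u hu h0 := by
    have hd := h (mk_mem_prod hc (mem_ball_zero_iff.2 hu))
    have h1 := norm_bottcherInv_sub_one_le hd
    have h2 := hd.2
    rw [h0] at h1
    norm_num at h1 h2
    linarith
  sq_eq c hc u hu := bottcherInv_sq (h (mk_mem_prod hc (mem_ball_zero_iff.2 hu)))

namespace IsBottcherInverse

variable {N N' : Set ℂ} {s s' : ℝ} {h h' : ℂ × ℂ → ℂ} {c u : ℂ}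

theorem mono (H : IsBottcherInverse N s h) (hN : N' ⊆ N) (hs : 0 < s') (hs' : s' ≤ s) :
    IsBottcherInverse N' s' h where
  pos := hs
  le_one := hs'.trans H.le_one
  continuousOn := H.continuousOn.mono (prod_mono hN (Metric.ball_subset_ball hs'))
  map_zero c hc := H.map_zero c (hN hc)
  ne_zero c hc u hu := H.ne_zero c (hN hc) u (hu.trans_le hs')
  sq_eq c hc u hu := H.sq_eq c (hN hc) u (hu.trans_le hs')

theorem continuousOn_slice (H : IsBottcherInverse N s h) (hc : c ∈ N) :
    ContinuousOn (fun u => h (c, u)) (Metric.ball 0 s) :=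
  H.continuousOn.comp (f := fun u => (c, u)) (by fun_prop) fun _ hu => mk_mem_prod hc hu

theorem continuousAt_slice_zero (H : IsBottcherInverse N s h) (hc : c ∈ N) :
    Tendsto (fun u => h (c, u)) (𝓝 0) (𝓝 1) := by
  rw [← H.map_zero c hc]
  exact (H.continuousOn_slice hc).continuousAt (Metric.ball_mem_nhds 0 H.pos)

theorem eventually_half_le_re (H : IsBottcherInverse N s h) (hc : c ∈ N) :
    ∀ᶠ u in 𝓝 0, 1 / 2 ≤ (h (c, u)).re := by
  have h1 := (Complex.continuous_re.tendsto _).comp (H.continuousAt_slice_zero hc)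
  filter_upwards [h1.eventually (lt_mem_nhds (show (1 / 2 : ℝ) < (1 : ℂ).re by norm_num))]
    with u hu using hu.le

/-- Close to `0` both values lie in `re ≥ 1/2`, so their difference is at most the difference at
`u^2`, hence at `u^(2^k)`, which tends to `0`. Farther out, equality at `u^2` gives equal squares on
a disk; two continuous nonvanishing roots that agree at `0` agree on it. -/
theorem eqOn (H : IsBottcherInverse N s h) (H' : IsBottcherInverse N' s' h') (hc : c ∈ N)
    (hc' : c ∈ N') (hu : ‖u‖ < s) (hu' : ‖u‖ < s') : h (c, u) = h' (c, u) := by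
  obtain ⟨δ, hδ, hδ1⟩ := Metric.eventually_nhds_iff_ball.1
    ((H.eventually_half_le_re hc).and (H'.eventually_half_le_re hc'))
  have near : ∀ u : ℂ, ‖u‖ < s → ‖u‖ < s' → ‖u‖ < δ → h (c, u) = h' (c, u) := by
    intro u h1 h2 h3
    have hlt : ∀ k : ℕ, ‖u ^ 2 ^ k‖ < s ∧ ‖u ^ 2 ^ k‖ < s' ∧ ‖u ^ 2 ^ k‖ < δ := fun k => by
      have h0 : ‖u ^ 2 ^ k‖ ≤ ‖u‖ := by
        rw [norm_pow]
        exact pow_le_of_le_one (norm_nonneg _) (h1.le.trans H.le_one) (by positivity)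
      exact ⟨h0.trans_lt h1, h0.trans_lt h2, h0.trans_lt h3⟩
    have ht := tendsto_pow_two_pow (h1.trans_le H.le_one)
    have := eq_zero_of_le_succ_of_tendsto
      (e := fun k => ‖h (c, u ^ 2 ^ k) - h' (c, u ^ 2 ^ k)‖) (norm_nonneg _) (fun k => ?_) ?_
    · simpa [sub_eq_zero] using this
    · obtain ⟨a1, a2, a3⟩ := hlt k
      have b := hδ1 _ (mem_ball_zero_iff.2 a3)
      refine (norm_sub_le_norm_sq_sub_sq b.1 b.2).trans_eq ?_
      rw [H.sq_eq c hc _ a1, H'.sq_eq c hc' _ a2, sub_sub_sub_cancel_right, ← pow_mul,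
        ← pow_succ]
    · have := ((H.continuousAt_slice_zero hc).sub (H'.continuousAt_slice_zero hc')).comp ht
      simpa using this.norm
  -- Each induction step enlarges the disk of agreement from radius `r` to `√r`.
  have key : ∀ n : ℕ, ∀ u : ℂ, ‖u‖ < s → ‖u‖ < s' → ‖u‖ ^ 2 ^ n < δ → h (c, u) = h' (c, u) := by
    intro n
    induction n with
    | zero => simpa using near
    | succ n ih =>
      intro u h1 h2 h3
      have hsub : ∀ v ∈ Metric.closedBall (0 : ℂ) ‖u‖, ‖v‖ ≤ ‖u‖ := fun v hv =>
        mem_closedBall_zero_iff.1 hv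
      refine (convex_closedBall (0 : ℂ) ‖u‖).isPreconnected.eq_of_sq_eq
        (f := fun v => h (c, v)) (g := fun v => h' (c, v)) (y := 0)
        ((H.continuousOn_slice hc).mono fun v hv => mem_ball_zero_iff.2 ((hsub v hv).trans_lt h1))
        ((H'.continuousOn_slice hc').mono fun v hv => mem_ball_zero_iff.2 ((hsub v hv).trans_lt h2))
        (fun v hv => ?_) (fun hv => H'.ne_zero c hc' _ ((hsub _ hv).trans_lt h2)) (by simp)
        ((H.map_zero c hc).trans (H'.map_zero c hc').symm) (by simp)
      have h1' := (hsub v hv).trans_lt h1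
      have h2' := (hsub v hv).trans_lt h2
      simp only [Pi.pow_apply]
      rw [H.sq_eq c hc v h1', H'.sq_eq c hc' v h2', ih _ (norm_sq_lt_of_norm_lt H.le_one h1')
        (norm_sq_lt_of_norm_lt H'.le_one h2')]
      rw [norm_pow, ← pow_mul, ← pow_succ']
      exact (pow_le_pow_left₀ (norm_nonneg _) (hsub v hv) _).trans_lt h3
  have ht := (tendsto_pow_two_pow (hu.trans_le H.le_one)).norm
  rw [norm_zero] at ht
  obtain ⟨n, hn⟩ := (ht.eventually (gt_mem_nhds hδ)).exists
  exact key n u hu hu' (by rwa [norm_pow] at hn)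

/-- The functional equation sees only `u^2`, so `h (c, -u)` and `h (c, u)` are roots of the same
function with the same value at `0`. -/
theorem map_neg (H : IsBottcherInverse N s h) (hc : c ∈ N) (hu : ‖u‖ < s) :
    h (c, -u) = h (c, u) := by
  refine (convex_ball (0 : ℂ) s).isPreconnected.eq_of_sq_eq (f := fun v => h (c, -v))
    (g := fun v => h (c, v)) (y := 0) ?_ (H.continuousOn_slice hc) (fun v hv => ?_)
    (fun hv => H.ne_zero c hc _ (mem_ball_zero_iff.1 hv)) (Metric.mem_ball_self H.pos) (by simp)
    (mem_ball_zero_iff.2 hu)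
  · exact (H.continuousOn_slice hc).comp (f := fun v => -v) (by fun_prop) fun v hv => by
      simpa using hv
  · have hv' := mem_ball_zero_iff.1 hv
    simp only [Pi.pow_apply]
    rw [H.sq_eq c hc v hv', H.sq_eq c hc (-v) (by rwa [norm_neg]), neg_sq]

theorem quad_div (H : IsBottcherInverse N s h) (hc : c ∈ N) (hu : ‖u‖ < s) (hu0 : u ≠ 0) :
    quad c (h (c, u) / u) = h (c, u ^ 2) / u ^ 2 := by
  rw [quad, div_pow, H.sq_eq c hc u hu]
  field_simp
  ring

theorem iterate_div (H : IsBottcherInverse N s h) (hc : c ∈ N) (hu : ‖u‖ < s) (hu0 : u ≠ 0)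
    (n : ℕ) : (quad c)^[n] (h (c, u) / u) = h (c, u ^ 2 ^ n) / u ^ 2 ^ n := by
  induction n with
  | zero => simp
  | succ n ih =>
    rw [Function.iterate_succ_apply', ih, H.quad_div hc
      (norm_pow_lt_of_norm_lt H.le_one hu (by positivity)) (pow_ne_zero _ hu0), ← pow_mul,
      ← pow_succ]

/-- Uniqueness transfers the estimate from the explicit solution `bottcherInv` to every inverse
coordinate. -/
theorem norm_sub_one_le (H : IsBottcherInverse N s h) (hc : c ∈ N) (hu : ‖u‖ < s)
    (hd : (c, u) ∈ invDomain) : ‖h (c, u) - 1‖ ≤ 2 * (‖c‖ * ‖u‖ ^ 2) := by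
  have h1 := hd.1
  have h2 := hd.2
  simp only at h1 h2
  have hopen : ∀ᶠ r in 𝓝 ‖u‖, r ^ 2 < 1 / 2 ∧ ‖c‖ * r ^ 2 < 1 / 8 :=
    ((isOpen_lt (by fun_prop) (by fun_prop)).and
      (isOpen_lt (by fun_prop) (by fun_prop))).mem_nhds ⟨h1, h2⟩
  -- A radius slightly above `‖u‖` is needed because the disks of definition are open.
  obtain ⟨r, ⟨hr1, hr2⟩, hr3⟩ :=
    ((hopen.filter_mono (nhdsWithin_le_nhds (s := Ioi ‖u‖))).and self_mem_nhdsWithin).exists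
  have hr0 : 0 < r := (norm_nonneg u).trans_lt hr3
  have H' : IsBottcherInverse {c} r bottcherInv := by
    refine isBottcherInverse_bottcherInv hr0 (by nlinarith) ?_
    rintro ⟨c', v⟩ ⟨hc', hv⟩
    obtain rfl : c' = c := hc'
    have hv' : ‖v‖ < r := mem_ball_zero_iff.1 hv
    have hv2 : ‖v‖ ^ 2 ≤ r ^ 2 := pow_le_pow_left₀ (norm_nonneg _) hv'.le 2
    exact ⟨hv2.trans_lt hr1, (mul_le_mul_of_nonneg_left hv2 (norm_nonneg _)).trans_lt hr2⟩
  rw [H.eqOn H' hc rfl hu hr3]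
  exact norm_bottcherInv_sub_one_le hd

end IsBottcherInverse

end MandelbrotRiemann

/-! ### Injectivity of the Böttcher coordinate -/

namespace MandelbrotRiemann

/-- The point `1` is repelling for squaring: within distance `1/2` of it, `|q + 1| ≥ 3/2`. -/
theorem eq_one_of_forall_norm_pow_sub_one_le {q : ℂ} (h : ∀ k : ℕ, ‖q ^ 2 ^ k - 1‖ ≤ 1 / 2) :
    q = 1 := by
  have key : ∀ k : ℕ, (3 / 2) ^ k * ‖q - 1‖ ≤ ‖q ^ 2 ^ k - 1‖ := by
    intro k
    induction k with
    | zero => simp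
    | succ k ih =>
      have h1 := one_sub_le_re (h k)
      have h2 : 3 / 2 ≤ ‖q ^ 2 ^ k + 1‖ := by
        refine le_trans ?_ (Complex.re_le_norm _)
        rw [Complex.add_re, Complex.one_re]
        linarith
      have h3 : q ^ 2 ^ (k + 1) - 1 = (q ^ 2 ^ k - 1) * (q ^ 2 ^ k + 1) := by
        rw [pow_succ 2 k, pow_mul]
        ring
      rw [h3, norm_mul, pow_succ]
      nlinarith [norm_nonneg (q ^ 2 ^ k - 1)]
  by_contra hq
  have hpos : 0 < ‖q - 1‖ := norm_pos_iff.2 (sub_ne_zero.2 hq)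
  obtain ⟨k, hk⟩ := pow_unbounded_of_one_lt (1 / ‖q - 1‖) (show (1 : ℝ) < 3 / 2 by norm_num)
  have := (key k).trans (h k)
  rw [div_lt_iff₀ hpos] at hk
  linarith

/-- Equal coordinates keep the two orbits relatively close for ever, since each iterate is within
relative error `1/250` of the same number. But the relative distance of distinct orbits grows by
`3/2` per step, as `|x + y| ≥ 1.9 |y|` and `|quad c y| ≤ 1.1 |y|^2`. -/
theorem Far.bottcher_injective {c z z' : ℂ} (h : Far c z) (h' : Far c z')
    (he : bottcher c z = bottcher c z') : z = z' := by
  have close : ∀ k : ℕ, ‖(quad c)^[k] z - (quad c)^[k] z'‖ ≤ ‖(quad c)^[k] z'‖ / 10 := by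
    intro k
    have h1 := (h.iterate k).norm_bottcher_sub_le
    have h2 := (h'.iterate k).norm_bottcher_sub_le
    rw [h.bottcher_iterate, he] at h1
    rw [h'.bottcher_iterate] at h2
    generalize bottcher c z' ^ 2 ^ k = b at *
    generalize (quad c)^[k] z = x at *
    generalize (quad c)^[k] z' = y at *
    have h3 : ‖x - y‖ ≤ ‖b - x‖ + ‖b - y‖ := by
      rw [norm_sub_rev b x]
      exact norm_sub_le_norm_sub_add_norm_sub x b y
    have h4 := norm_sub_norm_le x y
    linarith [norm_nonneg y]
  have key : ∀ k : ℕ, (3 / 2) ^ k * ‖z - z'‖ * ‖(quad c)^[k] z'‖ ≤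
      ‖(quad c)^[k] z - (quad c)^[k] z'‖ * ‖z'‖ := by
    intro k
    induction k with
    | zero => simp
    | succ k ih =>
      have h1 := close k
      have h2 := (h'.iterate k)
      rw [Function.iterate_succ_apply', Function.iterate_succ_apply']
      generalize (quad c)^[k] z = x at *
      generalize (quad c)^[k] z' = y at *
      have e1 : quad c x - quad c y = (x - y) * (x + y) := by simp only [quad]; ring
      have e2 : 19 / 10 * ‖y‖ ≤ ‖x + y‖ := by
        have : ‖2 * y‖ - ‖x - y‖ ≤ ‖2 * y + (x - y)‖ := norm_sub_le_norm_add _ _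
        rw [show 2 * y + (x - y) = x + y by ring, norm_mul, Complex.norm_ofNat] at this
        linarith
      have e3 : ‖quad c y‖ ≤ 11 / 10 * ‖y‖ ^ 2 := by
        refine (norm_add_le _ _).trans ?_
        rw [norm_pow]
        nlinarith [h2.1, h2.2]
      rw [e1, norm_mul, pow_succ]
      calc (3 / 2 : ℝ) ^ k * (3 / 2) * ‖z - z'‖ * ‖quad c y‖
          ≤ (3 / 2 : ℝ) ^ k * (3 / 2) * ‖z - z'‖ * (11 / 10 * ‖y‖ ^ 2) := by gcongr
        _ = 33 / 20 * ‖y‖ * ((3 / 2) ^ k * ‖z - z'‖ * ‖y‖) := by ring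
        _ ≤ 33 / 20 * ‖y‖ * (‖x - y‖ * ‖z'‖) := by gcongr
        _ ≤ 19 / 10 * ‖y‖ * (‖x - y‖ * ‖z'‖) := by
            refine mul_le_mul_of_nonneg_right ?_ (by positivity)
            linarith [norm_nonneg y]
        _ ≤ ‖x + y‖ * (‖x - y‖ * ‖z'‖) := by gcongr
        _ = ‖x - y‖ * ‖x + y‖ * ‖z'‖ := by ring
  by_contra hne
  have hpos : 0 < ‖z - z'‖ := norm_pos_iff.2 (sub_ne_zero.2 hne)
  obtain ⟨k, hk⟩ := pow_unbounded_of_one_lt (‖z'‖ / ‖z - z'‖) (show (1 : ℝ) < 3 / 2 by norm_num)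
  rw [div_lt_iff₀ hpos] at hk
  have h1 := key k
  have h2 := close k
  have h3 : 0 < ‖(quad c)^[k] z'‖ := norm_pos_iff.2 (h'.iterate k).ne_zero
  have h4 : 0 < ‖z'‖ := norm_pos_iff.2 h'.ne_zero
  nlinarith [mul_lt_mul_of_pos_right hk h3, mul_le_mul_of_nonneg_right h2 h4.le]

/-! ### Extension of inverse coordinates, and their relation to the Böttcher coordinate -/

namespace IsBottcherInverse

variable {N : Set ℂ} {s : ℝ} {h : ℂ × ℂ → ℂ} {c u : ℂ}

/-- The right side `h(c,u^2) - c u^2` is already defined for `‖u‖ < t`. By `hne` the critical value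
`c` is not attained, so it has no zeros, and on the convex set `N × ball` it has a continuous square
root. -/
theorem exists_extension {t : ℝ} (ht : 0 < t) (ht1 : t ≤ 1) (H : IsBottcherInverse N (t ^ 2) h)
    (hNo : IsOpen N) (hNc : Convex ℝ N) (hNn : N.Nonempty)
    (hne : ∀ c ∈ N, ∀ v, ‖v‖ < t ^ 2 → h (c, v) ≠ c * v) :
    ∃ h', IsBottcherInverse N t h' := by
  obtain ⟨c₀, hc₀⟩ := hNn
  set U : Set (ℂ × ℂ) := N ×ˢ Metric.ball 0 t
  have hUo : IsOpen U := hNo.prod Metric.isOpen_ball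
  have hUc : Convex ℝ U := hNc.prod (convex_ball _ _)
  have hmem : ∀ {c : ℂ}, c ∈ N → (c, (0 : ℂ)) ∈ U := fun hc =>
    mk_mem_prod hc (Metric.mem_ball_self ht)
  have hUs : IsSimplyConnected U := by
    have : ContractibleSpace U := hUc.contractibleSpace ⟨_, hmem hc₀⟩
    exact SimplyConnectedSpace.ofContractible U
  set g : ℂ × ℂ → ℂ := fun p => h (p.1, p.2 ^ 2) - p.1 * p.2 ^ 2
  have hlt : ∀ {u : ℂ}, ‖u‖ < t → ‖u ^ 2‖ < t ^ 2 := fun hu => by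
    rw [norm_pow]
    exact pow_lt_pow_left₀ hu (norm_nonneg _) two_ne_zero
  have hgc : ContinuousOn g U := by
    refine ContinuousOn.sub ?_ (by fun_prop)
    refine H.continuousOn.comp (f := fun p : ℂ × ℂ => (p.1, p.2 ^ 2)) (by fun_prop) fun p hp => ?_
    exact mk_mem_prod hp.1 (mem_ball_zero_iff.2 (hlt (mem_ball_zero_iff.1 hp.2)))
  have hg0 : ∀ c ∈ N, ∀ u, ‖u‖ < t → g (c, u) ≠ 0 := fun c hc u hu =>
    sub_ne_zero.2 (hne c hc _ (hlt hu))
  obtain ⟨f, hfc, hf⟩ := Complex.exists_continuousOn_pow_eq hUs hUo hgc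
    (by
      rintro ⟨⟨c, u⟩, ⟨hc, hu⟩, h0⟩
      exact hg0 c hc u (mem_ball_zero_iff.1 hu) h0) two_ne_zero
  have hg1 : ∀ c ∈ N, g (c, 0) = 1 := fun c hc => by
    simp only [g]
    rw [zero_pow two_ne_zero, H.map_zero c hc, mul_zero, sub_zero]
  -- The factor `f (c₀, 0)` is `1` or `-1`, and makes the root equal to `1` at `(c₀, 0)`.
  set h' : ℂ × ℂ → ℂ := fun p => f p * f (c₀, 0)
  have hsq : ∀ p, h' p ^ 2 = g p := fun p => by
    simp only [h']
    rw [mul_pow, hf, hf, hg1 c₀ hc₀, mul_one]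
  have hcont : ContinuousOn h' U := hfc.mul continuousOn_const
  have hzero : ∀ c ∈ N, h' (c, 0) = 1 := fun c hc =>
    hNc.isPreconnected.eq_of_sq_eq (f := fun c => h' (c, 0)) (g := fun _ => 1) (y := c₀)
      (hcont.comp (f := fun c : ℂ => (c, (0 : ℂ))) (by fun_prop) fun c hc => hmem hc)
      continuousOn_const (fun c hc => by simp [hsq, hg1 c hc]) (fun _ => one_ne_zero) hc₀
      (by simp only [h']; rw [← sq, hf, hg1 c₀ hc₀]) hc
  have hslice : ∀ c ∈ N, ContinuousOn (fun u => h' (c, u)) (Metric.ball 0 t) := fun c hc =>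
    hcont.comp (f := fun u => (c, u)) (by fun_prop) fun _ hu => mk_mem_prod hc hu
  have ht2 : t ^ 2 ≤ t := by nlinarith
  -- The root squares to an expression in the old `h`; agreement on the small disk turns it into the
  -- functional equation for `h'`.
  have heq : ∀ c ∈ N, ∀ v, ‖v‖ < t ^ 2 → h' (c, v) = h (c, v) := fun c hc v hv =>
    (convex_ball (0 : ℂ) (t ^ 2)).isPreconnected.eq_of_sq_eq (f := fun v => h' (c, v))
      (g := fun v => h (c, v)) (y := 0)
      ((hslice c hc).mono (Metric.ball_subset_ball ht2)) (H.continuousOn_slice hc)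
      (fun v hv => by
        simp only [Pi.pow_apply]
        rw [hsq, H.sq_eq c hc v (mem_ball_zero_iff.1 hv)])
      (fun hv => H.ne_zero c hc _ (mem_ball_zero_iff.1 hv)) (Metric.mem_ball_self H.pos)
      ((hzero c hc).trans (H.map_zero c hc).symm) (mem_ball_zero_iff.2 hv)
  exact ⟨h', ht, ht1, hcont, hzero,
    fun c hc u hu h0 => hg0 c hc u hu (by rw [← hsq, h0, zero_pow two_ne_zero]),
    fun c hc u hu => by rw [hsq, heq c hc _ (hlt hu)]⟩

/-- The hypotheses give `|c| |u|^2 ≤ 1/4000`, so `|h| ≥ 9/10`; then `|h / u| ≥ 180` and `10 |c| |u|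
≤ 1/2 < |h|`. -/
theorem far_div (H : IsBottcherInverse N s h) (hc : c ∈ N) (hu : ‖u‖ < s) (hu0 : u ≠ 0)
    (hu1 : ‖u‖ ≤ 1 / 200) (hcu : ‖c‖ * ‖u‖ ≤ 1 / 20) :
    ‖h (c, u) - 1‖ ≤ 1 / 2000 ∧ Far c (h (c, u) / u) := by
  have hpos : 0 < ‖u‖ := norm_pos_iff.2 hu0
  have h1 : ‖c‖ * ‖u‖ ^ 2 ≤ 1 / 4000 := by
    rw [pow_two, ← mul_assoc]
    nlinarith
  have h2 : ‖h (c, u) - 1‖ ≤ 1 / 2000 := by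
    refine (H.norm_sub_one_le hc hu ⟨?_, ?_⟩).trans ?_
    · simp only
      nlinarith
    · exact h1.trans_lt (by norm_num)
    · linarith
  have h3 : 9 / 10 ≤ ‖h (c, u)‖ := by
    have := one_sub_le_re h2
    linarith [Complex.re_le_norm (h (c, u))]
  refine ⟨h2, ?_, ?_⟩
  · rw [norm_div, lt_div_iff₀ hpos]
    linarith
  · rw [norm_div, lt_div_iff₀ hpos]
    linarith

/-- Let `q` be the product of the left side and `u`. Its power `q^(2^k)` is the same product for
`u^(2^k)`, by the two functional equations, and is always close to `1`. Hence `q = 1`. -/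
theorem bottcher_div (H : IsBottcherInverse N s h) (hc : c ∈ N) (hu : ‖u‖ < s) (hu0 : u ≠ 0)
    (hu1 : ‖u‖ ≤ 1 / 200) (hcu : ‖c‖ * ‖u‖ ≤ 1 / 20) : bottcher c (h (c, u) / u) = u⁻¹ := by
  have hfar := (H.far_div hc hu hu0 hu1 hcu).2
  rw [← mul_eq_one_iff_eq_inv₀ hu0]
  refine eq_one_of_forall_norm_pow_sub_one_le fun k => ?_
  have h0 : ‖u ^ 2 ^ k‖ ≤ ‖u‖ := by
    rw [norm_pow]
    exact pow_le_of_le_one (norm_nonneg _) (hu1.trans (by norm_num)) (by positivity)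
  have hk0 : u ^ 2 ^ k ≠ 0 := pow_ne_zero _ hu0
  obtain ⟨h1, h2⟩ := H.far_div hc (h0.trans_lt hu) hk0 (h0.trans hu1)
    ((mul_le_mul_of_nonneg_left h0 (norm_nonneg _)).trans hcu)
  rw [mul_pow, ← hfar.bottcher_iterate, H.iterate_div hc hu hu0]
  generalize u ^ 2 ^ k = v at *
  have h3 := h2.norm_bottcher_sub_le
  have hv : 0 < ‖v‖ := norm_pos_iff.2 hk0
  rw [norm_div] at h3
  have h4 : ‖bottcher c (h (c, v) / v) * v - h (c, v)‖ ≤ ‖h (c, v)‖ / 250 := by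
    have : bottcher c (h (c, v) / v) * v - h (c, v) =
        (bottcher c (h (c, v) / v) - h (c, v) / v) * v := by field_simp
    rw [this, norm_mul]
    calc _ ≤ ‖h (c, v)‖ / ‖v‖ / 250 * ‖v‖ := by gcongr
      _ = _ := by field_simp
  have h5 : ‖h (c, v)‖ ≤ 1 + 1 / 2000 := by
    have := norm_sub_norm_le (h (c, v)) 1
    rw [norm_one] at this
    linarith
  have h6 := norm_sub_le_norm_sub_add_norm_sub (bottcher c (h (c, v) / v) * v) (h (c, v)) 1
  linarith

theorem div_inv_bottcher (H : IsBottcherInverse N s h) (hc : c ∈ N) {z : ℂ} (hz : Far c z)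
    (hu : ‖(bottcher c z)⁻¹‖ < s) (hu1 : ‖(bottcher c z)⁻¹‖ ≤ 1 / 200)
    (hcu : ‖c‖ * ‖(bottcher c z)⁻¹‖ ≤ 1 / 20) :
    h (c, (bottcher c z)⁻¹) / (bottcher c z)⁻¹ = z := by
  have hu0 : (bottcher c z)⁻¹ ≠ 0 := inv_ne_zero hz.bottcher_ne_zero
  refine (H.far_div hc hu hu0 hu1 hcu).2.bottcher_injective hz ?_
  rw [H.bottcher_div hc hu hu0 hu1 hcu, inv_inv]

/-- The powers of `u` are eventually as small as the lemmas above require. -/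
theorem eventually_small (H : IsBottcherInverse N s h) (hu : ‖u‖ < 1) (c : ℂ) :
    ∀ᶠ k : ℕ in atTop, ‖u ^ 2 ^ k‖ < s ∧ ‖u ^ 2 ^ k‖ ≤ 1 / 200 ∧
      ‖c‖ * ‖u ^ 2 ^ k‖ ≤ 1 / 20 := by
  have h1 := (tendsto_pow_two_pow hu).norm
  rw [norm_zero] at h1
  have h2 := h1.const_mul ‖c‖
  rw [mul_zero] at h2
  filter_upwards [h1.eventually (gt_mem_nhds H.pos),
    h1.eventually (gt_mem_nhds (show (0 : ℝ) < 1 / 200 by norm_num)),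
    h2.eventually (gt_mem_nhds (show (0 : ℝ) < 1 / 20 by norm_num))] with k a b d
  exact ⟨a, b.le, d.le⟩

/-- Iterating brings both points to where the Böttcher coordinate recovers `u^(2^n)`. Going back,
each squaring leaves only a sign, and `u ↦ h (c, u) / u` is odd without zeros. -/
theorem injective (H : IsBottcherInverse N s h) (hc : c ∈ N) {u₁ u₂ : ℂ} (h₁ : ‖u₁‖ < s)
    (h₂ : ‖u₂‖ < s) (hn₁ : u₁ ≠ 0) (hn₂ : u₂ ≠ 0) (he : h (c, u₁) / u₁ = h (c, u₂) / u₂) :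
    u₁ = u₂ := by
  have key : ∀ n : ℕ, ∀ u₁ u₂ : ℂ, ‖u₁‖ < s → ‖u₂‖ < s → u₁ ≠ 0 → u₂ ≠ 0 →
      h (c, u₁) / u₁ = h (c, u₂) / u₂ → u₁ ^ 2 ^ n = u₂ ^ 2 ^ n → u₁ = u₂ := by
    intro n
    induction n with
    | zero => simp
    | succ n ih =>
      intro u₁ u₂ h₁ h₂ hn₁ hn₂ he hp
      have h3 : u₁ ^ 2 = u₂ ^ 2 := by
        refine ih _ _ (norm_sq_lt_of_norm_lt H.le_one h₁) (norm_sq_lt_of_norm_lt H.le_one h₂)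
          (pow_ne_zero 2 hn₁) (pow_ne_zero 2 hn₂) ?_ ?_
        · rw [← H.quad_div hc h₁ hn₁, ← H.quad_div hc h₂ hn₂, he]
        · rw [← pow_mul, ← pow_mul, ← pow_succ', hp]
      rcases sq_eq_sq_iff_eq_or_eq_neg.1 h3 with h4 | h4
      · exact h4
      · exfalso
        rw [h4, H.map_neg hc h₂, div_neg, neg_eq_iff_add_eq_zero, ← two_mul] at he
        simp [H.ne_zero c hc u₂ h₂, hn₂] at he
  obtain ⟨n, ⟨a1, a2, a3⟩, b1, b2, b3⟩ := ((H.eventually_small (h₁.trans_le H.le_one) c).and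
    (H.eventually_small (h₂.trans_le H.le_one) c)).exists
  refine key n u₁ u₂ h₁ h₂ hn₁ hn₂ he (inv_injective ?_)
  rw [← H.bottcher_div hc a1 (pow_ne_zero _ hn₁) a2 a3,
    ← H.bottcher_div hc b1 (pow_ne_zero _ hn₂) b2 b3, ← H.iterate_div hc h₁ hn₁,
    ← H.iterate_div hc h₂ hn₂, he]

/-- Pull back along the orbit: a square root of `U` gives the next point up to sign, and oddness of
`h / u` allows the sign to be corrected. -/
theorem exists_preimage (H : IsBottcherInverse N s h) (hc : c ∈ N) (j : ℕ) {z U : ℂ} (hU : U ≠ 0)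
    (hs : ‖U‖ < s ^ 2 ^ j) (he : h (c, U) / U = (quad c)^[j] z) :
    ∃ u, u ≠ 0 ∧ ‖u‖ < s ∧ u ^ 2 ^ j = U ∧ h (c, u) / u = z := by
  induction j generalizing U with
  | zero => exact ⟨U, hU, by simpa using hs, by simp, by simpa using he⟩
  | succ j ih =>
    obtain ⟨u, rfl⟩ : ∃ u, u ^ 2 = U := ⟨_, sqrt_sq U⟩
    have hu0 : u ≠ 0 := fun h0 => hU (by rw [h0, zero_pow two_ne_zero])
    have hu : ‖u‖ < s ^ 2 ^ j := by
      rw [norm_pow, pow_succ 2 j, pow_mul] at hs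
      exact lt_of_pow_lt_pow_left₀ 2 (pow_nonneg H.pos.le _) hs
    have hus : ‖u‖ < s := hu.trans_le (pow_le_of_le_one H.pos.le H.le_one (by positivity))
    rw [Function.iterate_succ_apply', ← H.quad_div hc hus hu0] at he
    have h2 : (h (c, u) / u) ^ 2 = ((quad c)^[j] z) ^ 2 := add_right_cancel he
    rcases sq_eq_sq_iff_eq_or_eq_neg.1 h2 with h3 | h3
    · obtain ⟨v, hv0, hv, hvu, hvz⟩ := ih hu0 hu h3
      exact ⟨v, hv0, hv, by rw [pow_succ, pow_mul, hvu], hvz⟩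
    · obtain ⟨v, hv0, hv, hvu, hvz⟩ := ih (neg_ne_zero.2 hu0) (by rwa [norm_neg])
        (by rw [H.map_neg hc hus, div_neg, h3, neg_neg])
      exact ⟨v, hv0, hv, by rw [pow_succ, pow_mul, hvu, neg_sq], hvz⟩

/-- A point in the image of the inverse Böttcher coordinate has the corresponding rate of escape. -/
theorem norm_bottcher_iterate (H : IsBottcherInverse N s h) (hc : c ∈ N) (hu : ‖u‖ < s)
    (hu0 : u ≠ 0) {n : ℕ} (hn : Far c ((quad c)^[n] (h (c, u) / u))) :
    ‖u‖ ^ 2 ^ n * ‖bottcher c ((quad c)^[n] (h (c, u) / u))‖ = 1 := by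
  -- Both sides are compared after `k` further iterations, where `bottcher_div` applies, and the
  -- positive `2^k`-th root is taken.
  obtain ⟨k, hk, hk1, hk2⟩ :=
    ((tendsto_add_atTop_iff_nat n).2 tendsto_id |>.eventually
      (H.eventually_small (hu.trans_le H.le_one) c)).exists
  simp only [id] at hk hk1 hk2
  have h1 := hn.bottcher_iterate k
  rw [← Function.iterate_add_apply, H.iterate_div hc hu hu0,
    H.bottcher_div hc hk (pow_ne_zero _ hu0) hk1 hk2] at h1
  have h2 := congrArg norm h1
  rw [norm_inv, norm_pow, norm_pow, pow_add, mul_comm (2 ^ k), pow_mul, ← inv_pow] at h2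
  rw [← (pow_left_inj₀ (by positivity) (norm_nonneg _) (by positivity)).1 h2]
  exact mul_inv_cancel₀ (pow_ne_zero _ (norm_ne_zero_iff.2 hu0))

end IsBottcherInverse

end MandelbrotRiemann

namespace MandelbrotRiemann

/-! ### The external coordinate of an escaping parameter -/

theorem isOpen_setOf_far_iterate (n : ℕ) : IsOpen {c : ℂ | Far c ((quad c)^[n] c)} :=
  isOpen_setOf_far.preimage (f := fun c : ℂ => (c, (quad c)^[n] c))
    (continuous_id.prodMk ((continuous_iterate_quad n).comp (continuous_id.prodMk continuous_id)))

theorem differentiableOn_bottcher_iterate (n : ℕ) :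
    DifferentiableOn ℂ (fun c => bottcher c ((quad c)^[n] c)) {c | Far c ((quad c)^[n] c)} :=
  differentiableOn_bottcher (isOpen_setOf_far_iterate n) differentiableOn_id
    (differentiableOn_iterate_quad differentiableOn_id differentiableOn_id n) fun _ hc => hc

theorem continuousAt_norm_bottcher_iterate {n : ℕ} {c : ℂ} (hc : Far c ((quad c)^[n] c)) :
    ContinuousAt (fun c => ‖bottcher c ((quad c)^[n] c)‖) c :=
  ((differentiableOn_bottcher_iterate n).continuousOn.continuousAt
    ((isOpen_setOf_far_iterate n).mem_nhds hc)).norm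

/-- The radius grows from `σ^(2^m)` to `σ` in `m` square root steps. An obstruction `h (c, v) = c v`
has `|v| ≤ σ^2`, but the escape rate forces `|v|^(2^n)` times the Böttcher modulus of `f^n(c)` to be
`1`, against the bound on `σ^(2^(n+1))`. -/
theorem exists_isBottcherInverse_of_pow {N : Set ℂ} (hNo : IsOpen N) (hNc : Convex ℝ N)
    (hNn : N.Nonempty) {σ : ℝ} (hσ : 0 < σ) (hσ1 : σ ≤ 1) {n : ℕ}
    (hn : ∀ c ∈ N, Far c ((quad c)^[n] c) ∧
      σ ^ 2 ^ (n + 1) * ‖bottcher c ((quad c)^[n] c)‖ < 1) (m : ℕ) {h : ℂ × ℂ → ℂ}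
    (H : IsBottcherInverse N (σ ^ 2 ^ m) h) : ∃ h', IsBottcherInverse N σ h' := by
  induction m generalizing h with
  | zero => exact ⟨h, by simpa using H⟩
  | succ m ih =>
    rw [pow_succ 2 m, pow_mul] at H
    have hne : ∀ c ∈ N, ∀ v, ‖v‖ < (σ ^ 2 ^ m) ^ 2 → h (c, v) ≠ c * v := by
      intro c hc v hv he
      have hv0 : v ≠ 0 := by
        rintro rfl
        rw [H.map_zero c hc, mul_zero] at he
        exact one_ne_zero he
      have hcv : h (c, v) / v = c := by rw [he, mul_div_cancel_right₀ _ hv0]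
      obtain ⟨h1, h2⟩ := hn c hc
      have h3 := H.norm_bottcher_iterate hc hv hv0 (n := n) (by rwa [hcv])
      rw [hcv] at h3
      have h4 : ‖v‖ ≤ σ ^ 2 := by
        refine hv.le.trans ?_
        rw [← pow_mul, mul_comm, pow_mul]
        exact pow_le_of_le_one (by positivity) (pow_le_one₀ hσ.le hσ1) (by positivity)
      have h5 : ‖v‖ ^ 2 ^ n ≤ σ ^ 2 ^ (n + 1) := by
        rw [pow_succ' 2 n, pow_mul]
        exact pow_le_pow_left₀ (norm_nonneg _) h4 _
      have := mul_le_mul_of_nonneg_right h5 (norm_nonneg (bottcher c ((quad c)^[n] c)))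
      linarith
    obtain ⟨h', H'⟩ :=
      H.exists_extension (pow_pos hσ _) (pow_le_one₀ hσ.le hσ1) hNo hNc hNn hne
    exact ih H'

theorem exists_local_isBottcherInverse {c₀ : ℂ} (hc₀ : c₀ ∉ mandelbrotSet) :
    ∃ (N : Set ℂ) (s : ℝ) (h : ℂ × ℂ → ℂ) (n : ℕ), IsOpen N ∧ c₀ ∈ N ∧ IsBottcherInverse N s h ∧
      ∀ c ∈ N, Far c ((quad c)^[n] c) ∧ 1 < s ^ 2 ^ n * ‖bottcher c ((quad c)^[n] c)‖ := by
  obtain ⟨n, hn⟩ := exists_far_of_notMem hc₀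
  set T := ‖bottcher c₀ ((quad c₀)^[n] c₀)‖
  have hT : 1 < T := hn.one_lt_norm_bottcher
  have hT0 : 0 < T := one_pos.trans hT
  -- The expected modulus of `u` is `T^(-1/2^n)`. The exponent `3/4`, strictly between `1/2` and
  -- `1`, puts it below `σ`, so that `c` is reached, and above `σ^2`, so that nothing obstructs the
  -- extension.
  set σ : ℝ := T ^ (-(3 / 4) / 2 ^ n : ℝ) with hσdef
  have hσ : 0 < σ := Real.rpow_pos_of_pos hT0 _
  have hσ1 : σ < 1 := Real.rpow_lt_one_of_one_lt_of_neg hT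
    (div_neg_of_neg_of_pos (by norm_num) (by positivity))
  have e1 : σ ^ 2 ^ n = T ^ (-(3 / 4) : ℝ) := by
    rw [hσdef, ← Real.rpow_natCast, ← Real.rpow_mul hT0.le]
    congr 1
    push_cast
    field_simp
  have e2 : 1 < σ ^ 2 ^ n * T := by
    rw [e1, ← Real.rpow_add_one hT0.ne']
    exact Real.one_lt_rpow hT (by norm_num)
  have e3 : σ ^ 2 ^ (n + 1) * T < 1 := by
    rw [pow_succ 2 n, pow_mul, e1, ← Real.rpow_natCast, ← Real.rpow_mul hT0.le,
      ← Real.rpow_add_one hT0.ne']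
    exact Real.rpow_lt_one_of_one_lt_of_neg hT (by norm_num)
  have hcont := continuousAt_norm_bottcher_iterate hn
  have hev : ∀ᶠ c in 𝓝 c₀, Far c ((quad c)^[n] c) ∧
      1 < σ ^ 2 ^ n * ‖bottcher c ((quad c)^[n] c)‖ ∧
      σ ^ 2 ^ (n + 1) * ‖bottcher c ((quad c)^[n] c)‖ < 1 :=
    (show ∀ᶠ c in 𝓝 c₀, Far c ((quad c)^[n] c) from
      (isOpen_setOf_far_iterate n).mem_nhds hn).and
      (((hcont.const_mul (σ ^ 2 ^ n)).eventually (lt_mem_nhds e2)).and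
        ((hcont.const_mul (σ ^ 2 ^ (n + 1))).eventually (gt_mem_nhds e3)))
  obtain ⟨ε, hε, hball⟩ := Metric.eventually_nhds_iff_ball.1 hev
  set N := Metric.ball c₀ (min ε 1)
  have hN0 : c₀ ∈ N := Metric.mem_ball_self (lt_min hε one_pos)
  have hN : ∀ c ∈ N, _ := fun c hc => hball c (Metric.ball_subset_ball (min_le_left _ _) hc)
  have hNb : ∀ c ∈ N, ‖c‖ ≤ ‖c₀‖ + 1 := fun c hc => by
    have h1 : dist c c₀ < 1 := Metric.ball_subset_ball (min_le_right _ _) hc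
    rw [dist_eq_norm] at h1
    have := norm_sub_norm_le c c₀
    linarith
  -- Parameters in `N` have norm at most `‖c₀‖ + 1`, so a single `m` puts the starting disk into
  -- `invDomain` for all of them.
  obtain ⟨m, hm1, hm2⟩ : ∃ m : ℕ, (σ ^ 2 ^ m) ^ 2 < 1 / 2 ∧
      (‖c₀‖ + 1) * (σ ^ 2 ^ m) ^ 2 < 1 / 8 := by
    have h1 : Tendsto (fun m : ℕ => (σ ^ 2 ^ m) ^ 2) atTop (𝓝 0) := by
      have := (tendsto_pow_two_pow (u := (σ : ℂ)) (by simpa [abs_of_pos hσ] using hσ1)).norm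
      simpa [abs_of_pos hσ] using this.pow 2
    have h2 := h1.const_mul (‖c₀‖ + 1)
    rw [mul_zero] at h2
    exact ((h1.eventually (gt_mem_nhds (by norm_num))).and
      (h2.eventually (gt_mem_nhds (by norm_num)))).exists
  have hbase : IsBottcherInverse N (σ ^ 2 ^ m) bottcherInv := by
    refine isBottcherInverse_bottcherInv (by positivity) (pow_le_one₀ hσ.le hσ1.le) ?_
    rintro ⟨c, u⟩ ⟨hc, hu⟩
    have h1 : ‖u‖ ^ 2 ≤ (σ ^ 2 ^ m) ^ 2 :=
      pow_le_pow_left₀ (norm_nonneg _) (mem_ball_zero_iff.1 hu).le 2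
    refine ⟨h1.trans_lt hm1, lt_of_le_of_lt ?_ hm2⟩
    exact mul_le_mul (hNb c hc) h1 (by positivity) (by positivity)
  obtain ⟨h, H⟩ := exists_isBottcherInverse_of_pow Metric.isOpen_ball (convex_ball _ _) ⟨c₀, hN0⟩
    hσ hσ1.le (fun c hc => ⟨(hN c hc).1, (hN c hc).2.2⟩) m hbase
  exact ⟨N, σ, h, n, Metric.isOpen_ball, hN0, H, fun c hc => ⟨(hN c hc).1, (hN c hc).2.1⟩⟩

/-- `1 / u` is the Böttcher coordinate of the critical value `c` of `quad c`. -/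
def IsExternalCoord (c u : ℂ) : Prop :=
  ∃ (s : ℝ) (h : ℂ × ℂ → ℂ), IsBottcherInverse {c} s h ∧ u ≠ 0 ∧ ‖u‖ < s ∧ h (c, u) = c * u

theorem IsBottcherInverse.isExternalCoord {N : Set ℂ} {s : ℝ} {h : ℂ × ℂ → ℂ}
    (H : IsBottcherInverse N s h) {c u : ℂ} (hc : c ∈ N) (hu : ‖u‖ < s)
    (he : h (c, u) = c * u) : IsExternalCoord c u := by
  refine ⟨s, h, H.mono (singleton_subset_iff.2 hc) H.pos le_rfl, ?_, hu, he⟩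
  rintro rfl
  rw [H.map_zero c hc, mul_zero] at he
  exact one_ne_zero he

theorem IsExternalCoord.norm_eq {c u : ℂ} (hu : IsExternalCoord c u) {n : ℕ}
    (hn : Far c ((quad c)^[n] c)) : ‖u‖ ^ 2 ^ n * ‖bottcher c ((quad c)^[n] c)‖ = 1 := by
  obtain ⟨s, h, H, hu0, hus, he⟩ := hu
  have hcu : h (c, u) / u = c := by rw [he, mul_div_cancel_right₀ _ hu0]
  have := H.norm_bottcher_iterate rfl hus hu0 (n := n) (by rwa [hcu])
  rwa [hcu] at this

theorem IsExternalCoord.norm_lt_one {c u : ℂ} (hu : IsExternalCoord c u) : ‖u‖ < 1 := by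
  obtain ⟨s, h, H, hu0, hus, he⟩ := hu
  exact hus.trans_le H.le_one

theorem IsExternalCoord.notMem {c u : ℂ} (hu : IsExternalCoord c u) : c ∉ mandelbrotSet := by
  have h1 := hu.norm_lt_one
  obtain ⟨s, h, H, hu0, hus, he⟩ := hu
  obtain ⟨k, a, b, d⟩ := (H.eventually_small h1 c).exists
  have h2 := (H.far_div rfl a (pow_ne_zero _ hu0) b d).2
  rw [← H.iterate_div rfl hus hu0, he, mul_div_cancel_right₀ _ hu0] at h2
  exact notMem_of_far h2

/-- The escape rate determines `‖u‖`, so both points lie in both disks, where the inverse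
coordinates agree and are injective. -/
theorem IsExternalCoord.unique {c u u' : ℂ} (hu : IsExternalCoord c u)
    (hu' : IsExternalCoord c u') : u = u' := by
  obtain ⟨n, hn⟩ := exists_far_of_notMem hu.notMem
  have h1 := (hu.norm_eq hn).trans (hu'.norm_eq hn).symm
  have h2 : ‖u‖ = ‖u'‖ := (pow_left_inj₀ (norm_nonneg _) (norm_nonneg _) (by positivity)).1
    (mul_right_cancel₀ (norm_ne_zero_iff.2 hn.bottcher_ne_zero) h1)
  obtain ⟨s, h, H, hu0, hus, he⟩ := hu
  obtain ⟨s', h', H', hu0', hus', he'⟩ := hu'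
  refine H.injective rfl hus (h2 ▸ hus) hu0 hu0' ?_
  rw [H.eqOn H' rfl rfl (h2 ▸ hus) hus', he, he', mul_div_cancel_right₀ _ hu0,
    mul_div_cancel_right₀ _ hu0']

/-- At `f^n(c)` the coordinate may still be too large to invert. Going `k` steps further makes it
small; then `k + n` pullbacks lead to `c`. -/
theorem IsBottcherInverse.exists_isExternalCoord {N : Set ℂ} {s : ℝ} {h : ℂ × ℂ → ℂ}
    (H : IsBottcherInverse N s h) {c : ℂ} (hc : c ∈ N) {n : ℕ} (hn : Far c ((quad c)^[n] c))
    (hs : 1 < s ^ 2 ^ n * ‖bottcher c ((quad c)^[n] c)‖) : ∃ u, IsExternalCoord c u := by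
  set b := (bottcher c ((quad c)^[n] c))⁻¹ with hb
  have hT := hn.one_lt_norm_bottcher
  have hb1 : ‖b‖ < 1 := by
    rw [hb, norm_inv]
    exact inv_lt_one_of_one_lt₀ hT
  have hbs : ‖b‖ < s ^ 2 ^ n := by
    rw [hb, norm_inv, inv_lt_iff_one_lt_mul₀ (one_pos.trans hT)]
    exact hs
  obtain ⟨k, h1, h2, h3⟩ := (H.eventually_small hb1 c).exists
  have h4 : b ^ 2 ^ k = (bottcher c ((quad c)^[k] ((quad c)^[n] c)))⁻¹ := by
    rw [hn.bottcher_iterate, hb, inv_pow]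
  have h5 := H.div_inv_bottcher hc (hn.iterate k) (h4 ▸ h1) (h4 ▸ h2) (h4 ▸ h3)
  rw [← h4, ← Function.iterate_add_apply] at h5
  have hb0 : b ≠ 0 := inv_ne_zero hn.bottcher_ne_zero
  obtain ⟨u, hu0, hu, -, hc'⟩ := H.exists_preimage hc (k + n) (pow_ne_zero _ hb0) (by
    rw [norm_pow, add_comm, pow_add, pow_mul]
    exact pow_lt_pow_left₀ hbs (norm_nonneg _) (by positivity)) h5
  exact ⟨u, H.isExternalCoord hc hu ((div_eq_iff hu0).1 hc')⟩

/-- The reciprocal of the Böttcher coordinate of the critical value `c` of `quad c`. -/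
noncomputable def externalCoord (c : ℂ) : ℂ := Classical.epsilon (IsExternalCoord c)

theorem isExternalCoord_externalCoord {c : ℂ} (hc : c ∉ mandelbrotSet) :
    IsExternalCoord c (externalCoord c) := by
  obtain ⟨N, s, h, n, -, hcN, H, hN⟩ := exists_local_isBottcherInverse hc
  exact Classical.epsilon_spec (H.exists_isExternalCoord hcN (hN c hcN).1 (hN c hcN).2)

theorem IsExternalCoord.eq {c u : ℂ} (hu : IsExternalCoord c u) : u = externalCoord c :=
  hu.unique (isExternalCoord_externalCoord hu.notMem)

/-! ### Holomorphic dependence of the external coordinate on the parameter -/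

/-- By continuity `f / f a` stays in the sector around `1` where the principal `k`-th root inverts
the power. -/
theorem differentiableAt_of_pow_eq {f g : ℂ → ℂ} {a : ℂ} {k : ℕ} (hk : k ≠ 0)
    (hf : ContinuousAt f a) (hfa : f a ≠ 0) (hg : DifferentiableAt ℂ g a)
    (h : ∀ᶠ z in 𝓝 a, f z ^ k = g z) : DifferentiableAt ℂ f a := by
  have hga : f a ^ k = g a := h.self_of_nhds
  have h1 : ContinuousAt (fun z => Complex.arg (f z / f a)) a :=
    ContinuousAt.comp (g := Complex.arg)
      (by rw [div_self hfa]; exact Complex.continuousAt_arg Complex.one_mem_slitPlane)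
      (hf.div_const _)
  have hpos : 0 < Real.pi / k := by positivity
  have h2 : ∀ᶠ z in 𝓝 a, Complex.arg (f z / f a) ∈ Ioo (-(Real.pi / k)) (Real.pi / k) :=
    h1.eventually_mem (Ioo_mem_nhds (by simpa [div_self hfa] using hpos)
      (by simpa [div_self hfa] using hpos))
  have h3 : DifferentiableAt ℂ (fun z => f a * (g z / g a) ^ ((k : ℂ)⁻¹)) a := by
    refine (differentiableAt_const _).mul
      (DifferentiableAt.cpow (hg.div_const _) (differentiableAt_const _) ?_)
    rw [div_self (hga ▸ pow_ne_zero k hfa)]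
    exact Complex.one_mem_slitPlane
  refine h3.congr_of_eventuallyEq ?_
  filter_upwards [h, h2] with z hz1 hz2
  rw [← hz1, ← hga, ← div_pow, Complex.pow_cpow_nat_inv hk hz2.1 hz2.2.le,
    mul_div_cancel₀ _ hfa]

/-- Continuity is compactness plus uniqueness: a cluster point of the coordinates solves the
limiting equation, so it is the coordinate of `c₀`. Then a high power is the reciprocal of a
Böttcher value, which is holomorphic in the parameter. -/
theorem continuousAt_differentiableAt_externalCoord {c₀ : ℂ} (hc₀ : c₀ ∉ mandelbrotSet) :
    ContinuousAt externalCoord c₀ ∧ DifferentiableAt ℂ externalCoord c₀ := by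
  obtain ⟨N, s, h, n, hNo, hcN, H, hN⟩ := exists_local_isBottcherInverse hc₀
  have hNn : N ∈ 𝓝 c₀ := hNo.mem_nhds hcN
  have hM : ∀ c ∈ N, c ∉ mandelbrotSet := fun c hc => notMem_of_far (hN c hc).1
  obtain ⟨hn, hs⟩ := hN c₀ hcN
  -- Shrinking `s` to `t` confines nearby coordinates to a compact disk inside the domain of `h`.
  obtain ⟨t, ⟨ht1, ht0⟩, hts⟩ : ∃ t, (1 < t ^ 2 ^ n * ‖bottcher c₀ ((quad c₀)^[n] c₀)‖ ∧ 0 < t) ∧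
      t < s := by
    have h1 : ∀ᶠ t in 𝓝 s, 1 < t ^ 2 ^ n * ‖bottcher c₀ ((quad c₀)^[n] c₀)‖ ∧ 0 < t :=
      ((isOpen_lt (by fun_prop) (by fun_prop)).and
        (isOpen_lt (by fun_prop) (by fun_prop))).mem_nhds ⟨hs, H.pos⟩
    exact ((h1.filter_mono (nhdsWithin_le_nhds (s := Iio s))).and self_mem_nhdsWithin).exists
  have hbound : ∀ᶠ c in 𝓝 c₀, c ∈ N ∧ ‖externalCoord c‖ < t := by
    filter_upwards [hNn, ((continuousAt_norm_bottcher_iterate hn).const_mul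
      (t ^ 2 ^ n)).eventually (lt_mem_nhds ht1)] with c hc h1
    refine ⟨hc, lt_of_pow_lt_pow_left₀ (2 ^ n) ht0.le ?_⟩
    have h2 := (isExternalCoord_externalCoord (hM c hc)).norm_eq (hN c hc).1
    rw [← h2] at h1
    exact lt_of_mul_lt_mul_right h1 (norm_nonneg _)
  have hsol : ∀ c ∈ N, ‖externalCoord c‖ < s → h (c, externalCoord c) = c * externalCoord c := by
    intro c hc hu
    obtain ⟨s', h', H', hu0, hus, he⟩ := isExternalCoord_externalCoord (hM c hc)
    rw [H.eqOn H' hc rfl hu hus, he]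
  have hcont : ContinuousAt externalCoord c₀ := by
    refine (isCompact_closedBall (0 : ℂ) t).tendsto_nhds_of_unique_mapClusterPt
      (hbound.mono fun c hc => mem_closedBall_zero_iff.2 hc.2.le) fun u hu hcl => ?_
    have hus : ‖u‖ < s := (mem_closedBall_zero_iff.1 hu).trans_lt hts
    obtain ⟨F, hF, hFu⟩ := mapClusterPt_iff_ultrafilter.1 hcl
    have h1 : Tendsto (fun c => (c, externalCoord c)) F (𝓝 (c₀, u)) :=
      (tendsto_id.mono_left hF).prodMk_nhds hFu
    have h2 : ContinuousAt (fun p : ℂ × ℂ => h p - p.1 * p.2) (c₀, u) :=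
      (H.continuousOn.continuousAt (prod_mem_nhds hNn
        (Metric.isOpen_ball.mem_nhds (mem_ball_zero_iff.2 hus)))).sub (by fun_prop)
    have h3 := h2.tendsto.comp h1
    have h4 : Tendsto ((fun p : ℂ × ℂ => h p - p.1 * p.2) ∘ fun c => (c, externalCoord c))
        F (𝓝 0) := by
      refine tendsto_const_nhds.congr' ?_
      filter_upwards [hF hbound] with c hc
      simp only [Function.comp_apply]
      rw [hsol c hc.1 (hc.2.trans hts), sub_self]
    exact (H.isExternalCoord hcN hus (sub_eq_zero.1 (tendsto_nhds_unique h3 h4))).eq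
  refine ⟨hcont, ?_⟩
  obtain ⟨m, hm1, hm2, hm3⟩ := (H.eventually_small (u := (t : ℂ))
    (by simpa [abs_of_pos ht0] using hts.trans_le H.le_one) (‖c₀‖ + 1 : ℝ)).exists
  have hsmall : ∀ᶠ c in 𝓝 c₀, Far c ((quad c)^[m] c) ∧
      externalCoord c ^ 2 ^ m = (bottcher c ((quad c)^[m] c))⁻¹ := by
    have h1 : ∀ᶠ c : ℂ in 𝓝 c₀, ‖c‖ < ‖c₀‖ + 1 :=
      continuous_norm.continuousAt.eventually (gt_mem_nhds (lt_add_one _))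
    filter_upwards [hbound, h1] with c ⟨hcN, hct⟩ hc1
    have hu0 : externalCoord c ≠ 0 := (isExternalCoord_externalCoord (hM c hcN)).choose_spec.choose_spec.2.1
    have hus := hct.trans hts
    have h2 : ‖externalCoord c ^ 2 ^ m‖ ≤ ‖(t : ℂ) ^ 2 ^ m‖ := by
      rw [norm_pow, norm_pow, Complex.norm_real, Real.norm_of_nonneg ht0.le]
      exact pow_le_pow_left₀ (norm_nonneg _) hct.le _
    have h3 : ‖c‖ * ‖externalCoord c ^ 2 ^ m‖ ≤ 1 / 20 := by
      refine (mul_le_mul ?_ h2 (norm_nonneg _) (norm_nonneg _)).trans hm3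
      rw [Complex.norm_real, Real.norm_of_nonneg (by positivity)]
      exact hc1.le
    have h4 : (quad c)^[m] c = h (c, externalCoord c ^ 2 ^ m) / externalCoord c ^ 2 ^ m := by
      rw [← H.iterate_div hcN hus hu0, hsol c hcN hus, mul_div_cancel_right₀ _ hu0]
    rw [h4]
    refine ⟨(H.far_div hcN (h2.trans_lt hm1) (pow_ne_zero _ hu0) (h2.trans hm2) h3).2, ?_⟩
    rw [H.bottcher_div hcN (h2.trans_lt hm1) (pow_ne_zero _ hu0) (h2.trans hm2) h3, inv_inv]
  obtain ⟨hfar, -⟩ := hsmall.self_of_nhds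
  exact differentiableAt_of_pow_eq (k := 2 ^ m) (by positivity) hcont
    (isExternalCoord_externalCoord hc₀).choose_spec.choose_spec.2.1
    (((differentiableOn_bottcher_iterate m).differentiableAt
      ((isOpen_setOf_far_iterate m).mem_nhds hfar)).inv hfar.bottcher_ne_zero)
    (hsmall.mono fun c hc => hc.2)

end MandelbrotRiemann

namespace MandelbrotRiemann

/-! ### Injective and proper holomorphic functions -/

/-- The symmetric difference quotient vanishes at pairs of distinct points with equal values and, on
the diagonal, at critical points. It treats both failures of local injectivity together. -/
theorem dslope_comm {F : ℂ → ℂ} (a b : ℂ) : dslope F a b = dslope F b a := by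
  rcases eq_or_ne a b with rfl | h
  · rfl
  · rw [dslope_of_ne _ h.symm, dslope_of_ne _ h, slope_comm]

theorem eq_of_dslope_eq_zero {F : ℂ → ℂ} {a b : ℂ} (h : dslope F b a = 0) : F a = F b := by
  have := sub_smul_dslope F b a
  rw [h, smul_zero] at this
  exact (sub_eq_zero.1 this.symm)

theorem dslope_ne_zero_of_ne {F : ℂ → ℂ} {a b : ℂ} (h : F a ≠ F b) : dslope F b a ≠ 0 :=
  fun h0 => h (eq_of_dslope_eq_zero h0)

theorem continuousAt_dslope_uncurry {F : ℂ → ℂ} {a b : ℂ} (hab : a ≠ b) (ha : ContinuousAt F a)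
    (hb : ContinuousAt F b) : ContinuousAt (fun p : ℂ × ℂ => dslope F p.2 p.1) (a, b) := by
  have h1 : ∀ᶠ p : ℂ × ℂ in 𝓝 (a, b), p.1 ≠ p.2 :=
    (isOpen_ne_fun continuous_fst continuous_snd).mem_nhds hab
  have h2 : ContinuousAt (fun p : ℂ × ℂ => (p.1 - p.2)⁻¹ * (F p.1 - F p.2)) (a, b) := by
    refine ContinuousAt.mul (ContinuousAt.inv₀ (by fun_prop) (sub_ne_zero.2 hab)) ?_
    exact (ContinuousAt.comp (f := Prod.fst) (x := (a, b)) ha continuousAt_fst).sub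
      (ContinuousAt.comp (f := Prod.snd) (x := (a, b)) hb continuousAt_snd)
  refine h2.congr ?_
  filter_upwards [h1] with p hp
  rw [dslope_of_ne _ hp, slope_def_field, div_eq_inv_mul]

section

variable {F : ℂ → ℂ} {E : Set ℂ}

theorem eventually_dslope_ne_zero (hE : IsOpen E) (hF : DifferentiableOn ℂ F E) {a b : ℂ}
    (ha : a ∈ E) (hb : b ∈ E) (h : dslope F b a ≠ 0) :
    ∀ᶠ p : ℂ × ℂ in 𝓝 (a, b), dslope F p.2 p.1 ≠ 0 := by
  have hc : ∀ x ∈ E, ContinuousAt F x := fun x hx => hF.continuousOn.continuousAt (hE.mem_nhds hx)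
  rcases eq_or_ne a b with rfl | hab
  · rw [dslope_same] at h
    have hA : AnalyticAt ℂ F a := hF.analyticAt (hE.mem_nhds ha)
    -- On the diagonal strict differentiability excludes nearby distinct points with equal values.
    have h1 := (hA.hasStrictDerivAt.hasStrictFDerivAt.isLittleO).bound
      (half_pos (norm_pos_iff.2 h))
    have h2 : ∀ᶠ p : ℂ × ℂ in 𝓝 (a, a), deriv F p.1 ≠ 0 :=
      (continuousAt_fst (p := (a, a))).eventually (hA.deriv.continuousAt.eventually_ne h)
    filter_upwards [h1, h2] with p hp1 hp2
    rcases eq_or_ne p.1 p.2 with hp | hp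
    · rw [← hp, dslope_same]
      exact hp2
    · refine dslope_ne_zero_of_ne fun he => ?_
      simp only [he, sub_self, zero_sub, norm_neg, ContinuousLinearMap.toSpanSingleton_apply,
        smul_eq_mul, norm_mul] at hp1
      have h3 : 0 < ‖p.1 - p.2‖ := norm_pos_iff.2 (sub_ne_zero.2 hp)
      have h4 : 0 < ‖deriv F a‖ := norm_pos_iff.2 h
      nlinarith
  · exact (continuousAt_dslope_uncurry hab (hc a ha) (hc b hb)).eventually_ne h

/-- Zeros of the difference quotient of a holomorphic function persist. -/
theorem eventually_exists_dslope_eq_zero (hE : IsOpen E) (hF : DifferentiableOn ℂ F E) {a b : ℂ}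
    (ha : a ∈ E) (hb : b ∈ E) (hne : ¬∀ᶠ z in 𝓝 a, F z = F a) (h : dslope F b a = 0) :
    ∀ᶠ b' in 𝓝 b, b' ∈ E ∧ ∃ a' ∈ E, dslope F b' a' = 0 := by
  have hc : ∀ x ∈ E, ContinuousAt F x := fun x hx => hF.continuousOn.continuousAt (hE.mem_nhds hx)
  have hA : AnalyticAt ℂ F a := hF.analyticAt (hE.mem_nhds ha)
  have hab := eq_of_dslope_eq_zero h
  have h1 : ∀ᶠ z in 𝓝[≠] a, F z ≠ F b := by
    rw [← hab]
    exact (hA.eventually_eq_or_eventually_ne analyticAt_const).resolve_left hne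
  rw [eventually_nhdsWithin_iff] at h1
  obtain ⟨R, hR, hRs⟩ := Metric.nhds_basis_closedBall.mem_iff.1
    (inter_mem (hE.mem_nhds ha) h1)
  have hRE : Metric.closedBall a R ⊆ E := fun z hz => (hRs hz).1
  have hsph : ∀ z ∈ Metric.sphere a R, z ∈ E ∧ F z ≠ F b := fun z hz =>
    have hz' := hRs (Metric.sphere_subset_closedBall hz)
    ⟨hz'.1, hz'.2 (Metric.ne_of_mem_sphere hz hR.ne')⟩
  have hcs : ∀ z ∈ Metric.sphere a R, ContinuousAt (fun p : ℂ × ℂ => dslope F p.2 p.1) (z, b) :=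
    fun z hz => continuousAt_dslope_uncurry (fun he => (hsph z hz).2 (by rw [he]))
      (hc z (hsph z hz).1) (hc b hb)
  obtain ⟨m, hm, hmin⟩ : ∃ m, 0 < m ∧ ∀ z ∈ Metric.sphere a R, m < ‖dslope F b z‖ := by
    obtain ⟨z₀, hz₀, hz₀m⟩ := (isCompact_sphere a R).exists_isMinOn
      ((NormedSpace.sphere_nonempty (E := ℂ)).2 hR.le) (f := fun z => ‖dslope F b z‖)
      (fun z hz => (ContinuousAt.norm (ContinuousAt.comp (f := fun z => (z, b)) (hcs z hz)
        (by fun_prop))).continuousWithinAt)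
    have hpos : 0 < ‖dslope F b z₀‖ := norm_pos_iff.2 (dslope_ne_zero_of_ne (hsph z₀ hz₀).2)
    exact ⟨_, half_pos hpos, fun z hz => (half_lt_self hpos).trans_le (hz₀m hz)⟩
  have h2 : ∀ᶠ b' in 𝓝 b, ∀ z ∈ Metric.sphere a R, m < ‖dslope F b' z‖ := by
    refine (isCompact_sphere a R).eventually_forall_of_forall_eventually fun z hz => ?_
    have h3 : ContinuousAt (fun p : ℂ × ℂ => ‖dslope F p.1 p.2‖) (b, z) :=
      (ContinuousAt.comp (f := Prod.swap) (x := (b, z)) (hcs z hz)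
        continuous_swap.continuousAt).norm
    exact h3.eventually (lt_mem_nhds (hmin z hz))
  have h3 : ∀ᶠ b' in 𝓝 b, ‖dslope F b' a‖ < m := by
    have h4 : ContinuousAt (fun b' => ‖dslope F a b'‖) b :=
      (((Complex.differentiableOn_dslope (hE.mem_nhds ha)).2 hF).continuousOn.continuousAt
        (hE.mem_nhds hb)).norm
    have h5 : ∀ᶠ b' in 𝓝 b, ‖dslope F a b'‖ < m :=
      h4.eventually (gt_mem_nhds (by beta_reduce; rwa [dslope_comm a b, h, norm_zero]))
    filter_upwards [h5] with b' hb'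
    rwa [dslope_comm]
  filter_upwards [h2, h3, hE.mem_nhds hb] with b' hb1 hb2 hb3
  refine ⟨hb3, ?_⟩
  -- Without a zero in the disk, `1 / dslope F b'` would satisfy the maximum principle; but it is
  -- below `1 / m` on the circle and larger at the centre.
  by_contra! hcon
  have hd : DiffContOnCl ℂ (dslope F b') (Metric.ball a R) :=
    ((Complex.differentiableOn_dslope (hE.mem_nhds hb3)).2 hF).diffContOnCl_ball hRE
  have hd' := hd.inv fun z hz => hcon z (hRE (by rwa [closure_ball a hR.ne'] at hz))
  have := Complex.norm_le_of_forall_mem_frontier_norm_le Metric.isBounded_ball hd' (C := m⁻¹)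
    (fun z hz => by
      rw [frontier_ball a hR.ne'] at hz
      rw [Pi.inv_apply, norm_inv]
      exact inv_anti₀ hm (hb1 z hz).le)
    (subset_closure (Metric.mem_ball_self hR))
  rw [Pi.inv_apply, norm_inv] at this
  have hpos : 0 < ‖dslope F b' a‖ := norm_pos_iff.2 (hcon a ha)
  exact absurd ((inv_le_inv₀ hpos hm).1 this) (not_le.2 hb2)

/-- A critical point is a diagonal zero of the difference quotient. It persists for every nearby
`b`, injectivity puts the new zero on the diagonal, so the derivative vanishes on a disk and `F` is
constant there. -/
theorem deriv_ne_zero_of_injOn (hE : IsOpen E) (hF : DifferentiableOn ℂ F E) (hinj : InjOn F E)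
    {a : ℂ} (ha : a ∈ E) : deriv F a ≠ 0 := by
  have hnc : ∀ x ∈ E, ¬∀ᶠ z in 𝓝 x, F z = F x := by
    intro x hx hev
    obtain ⟨z, ⟨hz1, hz2⟩, hz3⟩ := ((hev.and (hE.mem_nhds hx)).filter_mono
      (nhdsWithin_le_nhds (s := {x}ᶜ)) |>.and self_mem_nhdsWithin).exists
    exact hz3 (hinj hz2 hx hz1)
  intro h0
  have h1 := eventually_exists_dslope_eq_zero hE hF ha ha (hnc a ha) (by rwa [dslope_same])
  obtain ⟨r, hr, hball⟩ := Metric.eventually_nhds_iff_ball.1 h1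
  refine hnc a ha (Metric.eventually_nhds_iff_ball.2 ⟨r, hr, fun z hz => ?_⟩)
  refine Metric.isOpen_ball.is_const_of_deriv_eq_zero (convex_ball a r).isPreconnected
    (hF.mono fun z hz => (hball z hz).1) (fun b hb => ?_) hz (Metric.mem_ball_self hr)
  obtain ⟨hbE, a', ha', hz'⟩ := hball b hb
  rw [hinj ha' hbE (eq_of_dslope_eq_zero hz'), dslope_same] at hz'
  exact hz'

theorem exists_differentiableOn_inverse (hE : IsOpen E) (hF : DifferentiableOn ℂ F E)
    (hinj : InjOn F E) :
    ∃ g : ℂ → ℂ, (∀ v ∈ E, g (F v) = v) ∧ DifferentiableOn ℂ g (F '' E) := by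
  refine ⟨Function.invFunOn F E, fun v hv => hinj.leftInvOn_invFunOn hv, ?_⟩
  rintro _ ⟨v, hv, rfl⟩
  have hd := deriv_ne_zero_of_injOn hE hF hinj hv
  have hA : AnalyticAt ℂ F v := hF.analyticAt (hE.mem_nhds hv)
  have hmap : map F (𝓝 v) = 𝓝 (F v) := hA.hasStrictDerivAt.map_nhds_eq hd
  have hleft : ∀ᶠ z in 𝓝 v, Function.invFunOn F E (F z) = z := by
    filter_upwards [hE.mem_nhds hv] with z hz using hinj.leftInvOn_invFunOn hz
  have hcont : ContinuousAt (Function.invFunOn F E) (F v) := by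
    rw [ContinuousAt, hinj.leftInvOn_invFunOn hv, ← hmap, tendsto_map'_iff]
    exact tendsto_id.congr' (hleft.mono fun z hz => hz.symm)
  have hright : ∀ᶠ w in 𝓝 (F v), F (Function.invFunOn F E w) = w := by
    rw [← hmap, eventually_map]
    exact hleft.mono fun z hz => by rw [hz]
  refine (HasDerivAt.of_local_left_inverse hcont ?_ hd hright).differentiableAt
    |>.differentiableWithinAt
  rw [hinj.leftInvOn_invFunOn hv]
  exact hA.differentiableAt.hasDerivAt

/-- A proper holomorphic function to the unit disk with a single simple zero is bijective. -/
theorem bijOn_ball_of_proper (hE : IsOpen E) (hF : DifferentiableOn ℂ F E)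
    (hmaps : MapsTo F E (Metric.ball 0 1))
    (hproper : ∀ t < 1, IsCompact {v ∈ E | ‖F v‖ ≤ t}) (h0 : 0 ∈ E) (hF0 : F 0 = 0)
    (hzero : ∀ v ∈ E, F v = 0 → v = 0) (hd : deriv F 0 ≠ 0) :
    BijOn F E (Metric.ball 0 1) := by
  have hA : ∀ x ∈ E, AnalyticAt ℂ F x := fun x hx => hF.analyticAt (hE.mem_nhds hx)
  have hcl : ∀ S : Set ℂ, IsOpen S → S.Nonempty →
      (∀ K, IsCompact K → K ⊆ E → S ⊆ K → ∀ x ∈ closure S, x ∈ S) → ∀ K, IsCompact K → K ⊆ E →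
      ¬ S ⊆ K := by
    intro S hSo hSn hS K hK hKE hSK
    have : S = univ := IsClopen.eq_univ ⟨isClosed_of_closure_subset (hS K hK hKE hSK), hSo⟩ hSn
    exact noncompact_univ ℂ (hK.of_isClosed_subset isClosed_univ (this ▸ hSK))
  -- The set where `F` is locally equal to `F a` lies in a compact subset of `E` and is closed there
  -- by the identity principle, so it would be clopen and bounded in the plane. This replaces
  -- connectedness of `E`.
  have hnc : ∀ a ∈ E, ¬∀ᶠ z in 𝓝 a, F z = F a := by
    intro a ha hev
    refine hcl {v | v ∈ E ∧ ∀ᶠ z in 𝓝 v, F z = F a} ?_ ⟨a, ha, hev⟩ ?_ _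
      (hproper ‖F a‖ (mem_ball_zero_iff.1 (hmaps ha))) (fun v hv => hv.1)
      (fun v hv => ⟨hv.1, by rw [hv.2.self_of_nhds]⟩)
    · rw [isOpen_iff_mem_nhds]
      rintro v ⟨hv1, hv2⟩
      filter_upwards [hE.mem_nhds hv1, hv2.eventually_nhds] with z h1 h2 using ⟨h1, h2⟩
    · intro K hK hKE hSK x hx
      have hxE : x ∈ E := hKE (hK.isClosed.closure_subset_iff.2 hSK hx)
      refine ⟨hxE, ?_⟩
      rcases (hA x hxE).eventually_eq_or_eventually_ne analyticAt_const with h1 | h1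
      · exact h1
      · obtain ⟨y, hy, hyS⟩ := mem_closure_iff_nhds.1 hx _ (mem_nhdsWithin_iff_exists_mem_nhds_inter.1
          (show {y | F y ≠ F a} ∈ 𝓝[≠] x from h1)).choose_spec.1
        rcases eq_or_ne y x with rfl | hyx
        · exact hyS.2
        · exact absurd hyS.2.self_of_nhds ((mem_nhdsWithin_iff_exists_mem_nhds_inter.1
            (show {y | F y ≠ F a} ∈ 𝓝[≠] x from h1)).choose_spec.2 ⟨hy, hyx⟩)
  have hopen : ∀ a ∈ E, 𝓝 (F a) ≤ map F (𝓝 a) := fun a ha =>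
    (hA a ha).eventually_constant_or_nhds_le_map_nhds.resolve_left (hnc a ha)
  -- The compactness condition makes `B` relatively closed in the disk; connectedness does the rest.
  have hcov : ∀ B : Set ℂ, IsOpen B → (Metric.ball 0 1 ∩ B).Nonempty →
      (∀ t < 1, ∃ C, IsCompact C ∧ C ⊆ B ∧ B ∩ Metric.ball 0 t ⊆ C) → Metric.ball 0 1 ⊆ B := by
    intro B hBo hBn hB
    refine (convex_ball (0 : ℂ) 1).isPreconnected.subset_of_closure_inter_subset hBo hBn ?_
    rintro w ⟨hw, hw1⟩
    obtain ⟨t, ht1, ht2⟩ := exists_between (mem_ball_zero_iff.1 hw1)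
    obtain ⟨C, hC, hCB, hBC⟩ := hB t ht2
    have h1 : w ∈ closure (Metric.ball 0 t ∩ B) :=
      Metric.isOpen_ball.inter_closure ⟨mem_ball_zero_iff.2 ht1, hw⟩
    exact hCB (hC.isClosed.closure_subset_iff.2 (inter_comm _ _ ▸ hBC) h1)
  have hcK : ∀ t, ContinuousOn F {v ∈ E | ‖F v‖ ≤ t} := fun t => hF.continuousOn.mono fun v hv => hv.1
  have hsurj : Metric.ball 0 1 ⊆ F '' E := by
    refine hcov _ ?_ ⟨0, by simp, 0, h0, hF0⟩ fun t ht =>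
      ⟨_, (hproper t ht).image_of_continuousOn (hcK t), image_mono fun v hv => hv.1, ?_⟩
    · rw [isOpen_iff_mem_nhds]
      rintro _ ⟨a, ha, rfl⟩
      exact hopen a ha (image_mem_map (hE.mem_nhds ha))
    · rintro _ ⟨⟨a, ha, rfl⟩, h1⟩
      exact ⟨a, ⟨ha, (mem_ball_zero_iff.1 h1).le⟩, rfl⟩
  -- The values with a multiple preimage form a set that is open (persistence of zeros) and
  -- relatively closed (properness). It misses `0`, which has one simple preimage, so it misses the
  -- disk.
  set B : Set ℂ := {w | ∃ a ∈ E, ∃ b ∈ E, F a = w ∧ dslope F b a = 0}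
  have hBall : ¬ Metric.ball 0 1 ⊆ B := by
    intro hsub
    obtain ⟨a, ha, b, hb, hab, hz⟩ := hsub (Metric.mem_ball_self one_pos)
    have hb0 : F b = 0 := by rw [← eq_of_dslope_eq_zero hz, hab]
    rw [hzero a ha hab, hzero b hb hb0, dslope_same] at hz
    exact hd hz
  have hBempty : ¬ (Metric.ball 0 1 ∩ B).Nonempty := by
    intro hBn
    refine hBall (hcov B ?_ hBn fun t ht => ?_)
    · rw [isOpen_iff_mem_nhds]
      rintro _ ⟨a, ha, b, hb, rfl, hz⟩
      rw [eq_of_dslope_eq_zero hz]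
      refine hopen b hb (mem_map.2 ?_)
      filter_upwards [eventually_exists_dslope_eq_zero hE hF ha hb (hnc a ha) hz] with b' hb'
      obtain ⟨hb'E, a', ha', hz'⟩ := hb'
      exact ⟨a', ha', b', hb'E, eq_of_dslope_eq_zero hz', hz'⟩
    · set K := {v ∈ E | ‖F v‖ ≤ t}
      have hK : IsCompact K := hproper t ht
      set Z : Set (ℂ × ℂ) := {p | p ∈ K ×ˢ K ∧ dslope F p.2 p.1 = 0}
      have hZ : IsCompact Z := by
        refine (hK.prod hK).of_isClosed_subset (isClosed_of_closure_subset fun p hp => ?_)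
          fun p hp => hp.1
        have hpK : p ∈ K ×ˢ K :=
          (hK.prod hK).isClosed.closure_subset_iff.2 (fun p hp => hp.1) hp
        refine ⟨hpK, by_contra fun hne => ?_⟩
        obtain ⟨q, hq1, hq2⟩ := mem_closure_iff_nhds.1 hp _
          (eventually_dslope_ne_zero hE hF hpK.1.1 hpK.2.1 hne)
        exact hq1 hq2.2
      refine ⟨(fun p : ℂ × ℂ => F p.1) '' Z, hZ.image_of_continuousOn ?_, ?_, ?_⟩
      · exact hF.continuousOn.comp continuousOn_fst fun p hp => hp.1.1.1
      · rintro _ ⟨p, ⟨⟨hp1, hp2⟩, hz⟩, rfl⟩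
        exact ⟨p.1, hp1.1, p.2, hp2.1, rfl, hz⟩
      · rintro _ ⟨⟨a, ha, b, hb, rfl, hz⟩, h1⟩
        have h2 := (mem_ball_zero_iff.1 h1).le
        exact ⟨(a, b), ⟨⟨⟨ha, h2⟩, hb, by rw [← eq_of_dslope_eq_zero hz]; exact h2⟩, hz⟩, rfl⟩
  refine ⟨hmaps, fun a ha b hb hab => by_contra fun hne => ?_, hsurj⟩
  refine hBempty ⟨F a, hmaps ha, a, ha, b, hb, rfl, ?_⟩
  rw [dslope_of_ne _ hne, slope_def_field, hab, sub_self, zero_div]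

end

end MandelbrotRiemann

namespace MandelbrotRiemann

/-! ### The uniformization of the exterior in the coordinate `1 / c` -/

theorem IsExternalCoord.ne_zero {c u : ℂ} (hu : IsExternalCoord c u) : u ≠ 0 :=
  hu.choose_spec.choose_spec.2.1

theorem IsExternalCoord.norm_iterate_mul_sub_one_le {c u : ℂ} (hu : IsExternalCoord c u) {n : ℕ}
    (hd : (c, u ^ 2 ^ n) ∈ invDomain) :
    ‖(quad c)^[n] c * u ^ 2 ^ n - 1‖ ≤ 2 * (‖c‖ * ‖u ^ 2 ^ n‖ ^ 2) := by
  obtain ⟨s, h, H, hu0, hus, he⟩ := hu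
  have h1 := H.iterate_div rfl hus hu0 n
  rw [he, mul_div_cancel_right₀ _ hu0] at h1
  rw [h1, div_mul_cancel₀ _ (pow_ne_zero _ hu0)]
  exact H.norm_sub_one_le rfl (norm_pow_lt_of_norm_lt H.le_one hus (by positivity)) hd

theorem far_of_large {c : ℂ} (hc : 1000 ≤ ‖c‖) : Far c ((quad c)^[1] c) := by
  have : ‖c‖ ^ 2 - ‖c‖ ≤ ‖quad c c‖ := by
    have := norm_sub_le_norm_add (c ^ 2) c
    rwa [norm_pow] at this
  refine ⟨?_, ?_⟩ <;> simp only [Function.iterate_one] <;> nlinarith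

/-- Here `‖u‖^2` times the Böttcher modulus of `c^2 + c` is `1`, and that modulus is at least `‖c‖^2
/ 2`. -/
theorem IsExternalCoord.norm_le_of_large {c u : ℂ} (hu : IsExternalCoord c u)
    (hc : 1000 ≤ ‖c‖) : ‖u‖ * ‖c‖ ≤ 2 := by
  have h1 := hu.norm_eq (far_of_large hc)
  have h2 := (far_of_large hc).le_norm_bottcher
  rw [Function.iterate_one] at h1 h2
  have h3 : ‖c‖ ^ 2 - ‖c‖ ≤ ‖quad c c‖ := by
    have := norm_sub_le_norm_add (c ^ 2) c
    rwa [norm_pow] at this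
  have h4 : ‖c‖ ^ 2 / 2 ≤ ‖bottcher c (quad c c)‖ := by nlinarith
  have h5 : ‖u‖ ^ 2 * (‖c‖ ^ 2 / 2) ≤ 1 := by
    rw [← h1, pow_one]
    gcongr
  nlinarith [norm_nonneg u, norm_nonneg c, mul_nonneg (norm_nonneg u) (norm_nonneg c)]

theorem IsExternalCoord.norm_mul_sub_one_le_of_large {c u : ℂ} (hu : IsExternalCoord c u)
    (hc : 1000 ≤ ‖c‖) : ‖c * u - 1‖ ≤ 8 / ‖c‖ := by
  have h1 := hu.norm_le_of_large hc
  have hpos : 0 < ‖c‖ := by linarith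
  have h2 : ‖u‖ ≤ 2 / ‖c‖ := by rwa [le_div_iff₀ hpos]
  have h3 : ‖u‖ ≤ 2 / 1000 := h2.trans (by gcongr)
  have h4 : ‖c‖ * ‖u‖ ^ 2 ≤ 4 / ‖c‖ := by
    rw [le_div_iff₀ hpos]
    nlinarith [mul_nonneg (norm_nonneg u) (norm_nonneg c)]
  have h5 : 4 / ‖c‖ ≤ 4 / 1000 := by gcongr
  have hd : (c, u ^ 2 ^ 0) ∈ invDomain := by
    rw [pow_zero, pow_one]
    refine ⟨?_, (h4.trans h5).trans_lt (by norm_num)⟩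
    simp only
    nlinarith [norm_nonneg u]
  have := hu.norm_iterate_mul_sub_one_le hd
  simp only [Function.iterate_zero, id, pow_zero, pow_one] at this
  refine this.trans ?_
  rw [show (8 : ℝ) / ‖c‖ = 2 * (4 / ‖c‖) by ring]
  gcongr

/-- With `A = (2Y)^(2^m) ≥ 2Y ≥ 2`, one step gives at most `A^2 / 2 + 2Y ≤ A^2`. -/
theorem norm_iterate_le {c z : ℂ} {Y : ℝ} (hY : 1 ≤ Y) (hc : ‖c‖ ≤ Y) (hz : ‖z‖ ≤ Y) (m : ℕ) :
    2 * ‖(quad c)^[m] z‖ ≤ (2 * Y) ^ 2 ^ m := by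
  induction m with
  | zero => simpa using hz
  | succ m ih =>
    rw [Function.iterate_succ_apply', pow_succ 2 m, pow_mul]
    have h1 : 2 * Y ≤ (2 * Y) ^ 2 ^ m := le_self_pow₀ (by linarith) (by positivity)
    refine (mul_le_mul_of_nonneg_left (norm_add_le _ _) two_pos.le).trans ?_
    rw [norm_pow]
    nlinarith [norm_nonneg ((quad c)^[m] z)]

/-- Slow escape forces `‖u‖` near `1`: follow the orbit `m` more steps into the far region, use the
exact escape rate there, and extract a `2^m`-th root. This drives properness. -/
theorem IsExternalCoord.one_le_mul {c u : ℂ} (hu : IsExternalCoord c u) (n : ℕ) {Y : ℝ}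
    (hY : 1 ≤ Y) (hc : ‖c‖ ≤ Y) (hz : ‖(quad c)^[n] c‖ ≤ Y) : 1 ≤ ‖u‖ ^ 2 ^ n * (2 * Y) := by
  obtain ⟨m, hm⟩ := exists_far_of_notMem hu.notMem
  have hf : Far c ((quad c)^[m + n] c) := by
    rw [add_comm, Function.iterate_add_apply]
    exact hm.iterate n
  have h1 := hu.norm_eq hf
  have h2 := hf.norm_bottcher_le
  have h3 := norm_iterate_le hY hc hz m
  rw [← Function.iterate_add_apply] at h3
  have h4 : 1 ≤ (‖u‖ ^ 2 ^ n * (2 * Y)) ^ 2 ^ m := by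
    rw [mul_pow, ← pow_mul, ← pow_add, add_comm n, ← h1]
    gcongr
    exact h2.trans h3
  by_contra! hlt
  exact absurd h4 (not_le.2 (pow_lt_one₀ (by positivity) hlt (by positivity)))

/-- The exterior of the Mandelbrot set in the coordinate `1 / c`. -/
def recipExterior : Set ℂ := {v | v = 0 ∨ v⁻¹ ∉ mandelbrotSet}

open Classical in
/-- The reciprocal of the external coordinate as a function of `1 / c`. -/
noncomputable def recipCoord (v : ℂ) : ℂ := if v = 0 then 0 else externalCoord v⁻¹

theorem recipCoord_zero : recipCoord 0 = 0 := if_pos rfl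

theorem isExternalCoord_recipCoord {v : ℂ} (hv : v ∈ recipExterior) (hv0 : v ≠ 0) :
    IsExternalCoord v⁻¹ (recipCoord v) := by
  rw [recipCoord, if_neg hv0]
  exact isExternalCoord_externalCoord (hv.resolve_left hv0)

theorem norm_inv_ge {v : ℂ} (hv0 : v ≠ 0) (hv : ‖v‖ < 1 / 1000) : 1000 ≤ ‖v⁻¹‖ := by
  have hpos : 0 < ‖v‖ := norm_pos_iff.2 hv0
  rw [norm_inv, le_inv_comm₀ (by norm_num) hpos]
  linarith

theorem ball_subset_recipExterior : Metric.ball 0 (1 / 1000) ⊆ recipExterior := by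
  intro v hv
  by_cases h0 : v = 0
  · exact Or.inl h0
  · exact Or.inr (notMem_of_far (far_of_large (norm_inv_ge h0 (mem_ball_zero_iff.1 hv))))

theorem isOpen_recipExterior : IsOpen recipExterior := by
  rw [isOpen_iff_mem_nhds]
  intro v hv
  by_cases h0 : v = 0
  · subst h0
    exact mem_of_superset (Metric.ball_mem_nhds _ (by norm_num)) ball_subset_recipExterior
  · obtain ⟨n, hn⟩ := exists_far_of_notMem (hv.resolve_left h0)
    filter_upwards [(continuousAt_inv₀ h0).eventually
      ((isOpen_setOf_far_iterate n).mem_nhds hn)] with w hw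
    exact Or.inr (notMem_of_far hw)

theorem norm_lt_four_of_mem {v : ℂ} (hv : v ∈ recipExterior) : ‖v‖ < 4 := by
  by_cases h0 : v = 0
  · simp [h0]
  · by_contra! h4
    refine hv.resolve_left h0 (mem_mandelbrotSet_of_norm_le ?_)
    rw [norm_inv, one_div]
    exact inv_anti₀ (by norm_num) h4

/-- The estimate for large `c` reads `|recipCoord v - v| ≤ 8 |v|^2`. -/
theorem hasDerivAt_recipCoord_zero : HasDerivAt recipCoord 1 0 := by
  have h1 : (fun v => recipCoord v - v) =O[𝓝 0] fun v => ‖v - 0‖ ^ 2 := by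
    refine Asymptotics.IsBigO.of_bound 8 ?_
    filter_upwards [Metric.ball_mem_nhds (0 : ℂ) (show (0 : ℝ) < 1 / 1000 by norm_num)] with v hv
    by_cases h0 : v = 0
    · simp [h0, recipCoord_zero]
    · have h2 := (isExternalCoord_recipCoord (ball_subset_recipExterior hv)
        h0).norm_mul_sub_one_le_of_large (norm_inv_ge h0 (mem_ball_zero_iff.1 hv))
      have h3 : recipCoord v - v = v * (v⁻¹ * recipCoord v - 1) := by field_simp
      rw [h3, norm_mul, sub_zero, norm_pow, norm_norm]
      rw [norm_inv, div_inv_eq_mul] at h2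
      nlinarith [norm_nonneg v]
  have h2 := (h1.hasFDerivAt one_lt_two).hasDerivAt.add (hasDerivAt_id (0 : ℂ))
  simpa [Pi.add_def] using h2

theorem differentiableOn_recipCoord : DifferentiableOn ℂ recipCoord recipExterior := by
  intro v hv
  refine DifferentiableAt.differentiableWithinAt ?_
  by_cases h0 : v = 0
  · subst h0
    exact hasDerivAt_recipCoord_zero.differentiableAt
  · have h1 : DifferentiableAt ℂ (fun v => externalCoord v⁻¹) v :=
      DifferentiableAt.comp (g := externalCoord) v (continuousAt_differentiableAt_externalCoord (hv.resolve_left h0)).2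
        (differentiableAt_inv h0)
    refine h1.congr_of_eventuallyEq ?_
    filter_upwards [isOpen_ne.mem_nhds h0] with w hw
    rw [recipCoord, if_neg hw]

theorem norm_recipCoord_lt_one {v : ℂ} (hv : v ∈ recipExterior) : ‖recipCoord v‖ < 1 := by
  by_cases h0 : v = 0
  · simp [h0, recipCoord_zero]
  · exact (isExternalCoord_recipCoord hv h0).norm_lt_one

theorem isCompact_recipCoord_le {t : ℝ} (ht : t < 1) :
    IsCompact {v ∈ recipExterior | ‖recipCoord v‖ ≤ t} := by
  refine Metric.isCompact_of_isClosed_isBounded ?_ (Metric.isBounded_ball (x := 0) (r := 4)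
    |>.subset fun v hv => mem_ball_zero_iff.2 (norm_lt_four_of_mem hv.1))
  rw [← isOpen_compl_iff, isOpen_iff_mem_nhds]
  intro v hv
  by_cases hvE : v ∈ recipExterior
  · have h1 : t < ‖recipCoord v‖ := not_le.1 fun h => hv ⟨hvE, h⟩
    have h2 := (differentiableOn_recipCoord.continuousOn.continuousAt
      (isOpen_recipExterior.mem_nhds hvE)).norm.eventually (lt_mem_nhds h1)
    filter_upwards [h2] with w hw hw'
    exact absurd hw'.2 (not_le.2 hw)
  · have h0 : v ≠ 0 := fun h => hvE (Or.inl h)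
    have hM : v⁻¹ ∈ mandelbrotSet := by_contra fun h => hvE (Or.inr h)
    obtain ⟨B, hB⟩ := hM
    set Y := max (max B ‖v⁻¹‖) 1 + 1
    have hY1 : 1 ≤ Y := by
      have := le_max_right (max B ‖v⁻¹‖) 1
      simp only [Y]
      linarith
    have hYc : ‖v⁻¹‖ < Y := ((le_max_right _ _).trans (le_max_left _ _)).trans_lt (lt_add_one _)
    have hYB : B < Y := ((le_max_left _ _).trans (le_max_left _ _)).trans_lt (lt_add_one _)
    have ht' : max t 0 < 1 := max_lt ht one_pos
    -- At a boundary parameter the orbit is bounded. Nearby its iterate of index `n` is still below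
    -- `Y`, so for this `n` the coordinate modulus must exceed `t`.
    obtain ⟨n, hn⟩ : ∃ n : ℕ, (max t 0) ^ 2 ^ n * (2 * Y) < 1 := by
      have h1 := ((tendsto_pow_atTop_nhds_zero_of_lt_one (le_max_right t 0) ht').comp
        (tendsto_pow_atTop_atTop_of_one_lt one_lt_two)).mul_const (2 * Y)
      rw [zero_mul] at h1
      exact (h1.eventually (gt_mem_nhds one_pos)).exists
    have hn' : ‖(quad v⁻¹)^[n] v⁻¹‖ < Y := by
      have h1 : ‖(quad v⁻¹)^[n + 1] 0‖ ≤ B := hB ⟨n + 1, rfl⟩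
      rw [iterate_quad_zero] at h1
      exact h1.trans_lt hYB
    have hinv := continuousAt_inv₀ h0
    have h1 := hinv.norm.eventually (gt_mem_nhds hYc)
    have h2 : ContinuousAt (fun w : ℂ => ‖(quad w⁻¹)^[n] w⁻¹‖) v :=
      (ContinuousAt.comp (g := fun p : ℂ × ℂ => (quad p.1)^[n] p.2)
        (continuous_iterate_quad n).continuousAt (hinv.prodMk hinv)).norm
    filter_upwards [h1, h2.eventually (gt_mem_nhds hn'), isOpen_ne.mem_nhds h0] with w a b hw0 hw
    have h3 := (isExternalCoord_recipCoord hw.1 hw0).one_le_mul n hY1 a.le b.le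
    have h4 : ‖recipCoord w‖ ^ 2 ^ n ≤ (max t 0) ^ 2 ^ n :=
      pow_le_pow_left₀ (norm_nonneg _) (hw.2.trans (le_max_left _ _)) _
    have h5 := mul_le_mul_of_nonneg_right h4 (show 0 ≤ 2 * Y by linarith)
    linarith

theorem bijOn_recipCoord : BijOn recipCoord recipExterior (Metric.ball 0 1) :=
  bijOn_ball_of_proper isOpen_recipExterior differentiableOn_recipCoord
    (fun _ hv => mem_ball_zero_iff.2 (norm_recipCoord_lt_one hv))
    (fun _ ht => isCompact_recipCoord_le ht) (Or.inl rfl) recipCoord_zero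
    (fun _ hv h => by_contra fun h0 => (isExternalCoord_recipCoord hv h0).ne_zero h)
    (by rw [hasDerivAt_recipCoord_zero.deriv]; exact one_ne_zero)

theorem exists_inverse_recipCoord :
    ∃ g : ℂ → ℂ, DifferentiableOn ℂ g (Metric.ball 0 1) ∧ ∀ v ∈ recipExterior,
      g (recipCoord v) = v := by
  obtain ⟨g, hg, hd⟩ := exists_differentiableOn_inverse isOpen_recipExterior
    differentiableOn_recipCoord bijOn_recipCoord.injOn
  exact ⟨g, by rwa [bijOn_recipCoord.image_eq] at hd, hg⟩

/-- The conformal map of the unit disk onto the exterior of the Mandelbrot set in the coordinate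
`1 / c`. -/
noncomputable def recipMap : ℂ → ℂ := exists_inverse_recipCoord.choose

theorem differentiableOn_recipMap : DifferentiableOn ℂ recipMap (Metric.ball 0 1) :=
  exists_inverse_recipCoord.choose_spec.1

theorem recipMap_recipCoord {v : ℂ} (hv : v ∈ recipExterior) : recipMap (recipCoord v) = v :=
  exists_inverse_recipCoord.choose_spec.2 v hv

theorem recipMap_mem_and {u : ℂ} (hu : ‖u‖ < 1) :
    recipMap u ∈ recipExterior ∧ recipCoord (recipMap u) = u := by
  obtain ⟨v, hv, rfl⟩ := bijOn_recipCoord.surjOn (mem_ball_zero_iff.2 hu)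
  rw [recipMap_recipCoord hv]
  exact ⟨hv, rfl⟩

theorem bijOn_recipMap : BijOn recipMap (Metric.ball 0 1) recipExterior := by
  refine ⟨fun u hu => (recipMap_mem_and (mem_ball_zero_iff.1 hu)).1, fun u hu u' hu' he => ?_,
    fun v hv => ⟨recipCoord v, bijOn_recipCoord.mapsTo hv, recipMap_recipCoord hv⟩⟩
  rw [← (recipMap_mem_and (mem_ball_zero_iff.1 hu)).2, he,
    (recipMap_mem_and (mem_ball_zero_iff.1 hu')).2]

theorem recipMap_zero : recipMap 0 = 0 := by
  have := recipMap_recipCoord (v := 0) (Or.inl rfl)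
  rwa [recipCoord_zero] at this

theorem hasDerivAt_recipMap_zero : HasDerivAt recipMap 1 0 := by
  have h1 : HasDerivAt recipMap (1 : ℂ)⁻¹ 0 := by
    refine HasDerivAt.of_local_left_inverse (f := recipCoord) ?_ ?_ one_ne_zero ?_
    · exact differentiableOn_recipMap.continuousOn.continuousAt
        (Metric.ball_mem_nhds _ one_pos)
    · rw [recipMap_zero]
      exact hasDerivAt_recipCoord_zero
    · filter_upwards [Metric.ball_mem_nhds (0 : ℂ) one_pos] with u hu
      exact (recipMap_mem_and (mem_ball_zero_iff.1 hu)).2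
  rwa [inv_one] at h1

theorem recipMap_ne_zero {u : ℂ} (hu : ‖u‖ < 1) (hu0 : u ≠ 0) : recipMap u ≠ 0 := by
  intro h0
  have := (recipMap_mem_and hu).2
  rw [h0, recipCoord_zero] at this
  exact hu0 this.symm

theorem isExternalCoord_recipMap {u : ℂ} (hu : ‖u‖ < 1) (hu0 : u ≠ 0) :
    IsExternalCoord (recipMap u)⁻¹ u := by
  obtain ⟨h1, h2⟩ := recipMap_mem_and hu
  have := isExternalCoord_recipCoord h1 (recipMap_ne_zero hu hu0)
  rwa [h2] at this

end MandelbrotRiemann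

namespace MandelbrotRiemann

open RiemannSphere OnePoint

/-! ### The chart of the sphere at infinity -/

theorem chart_infty_apply (q : OnePoint ℂ) : chart ∞ q = (toComplex q)⁻¹ := by
  rw [chart, if_pos rfl]

theorem chart_infty_coe (z : ℂ) : chart ∞ (z : OnePoint ℂ) = z⁻¹ := chart_infty_apply _

theorem chart_infty_infty : chart ∞ ∞ = 0 := by
  rw [chart_infty_apply]
  exact inv_zero

theorem chart_coe (z : ℂ) : chart (z : OnePoint ℂ) = toComplex := by
  rw [chart, if_neg (coe_ne_infty z)]

theorem chartInv_coe (z : ℂ) : chartInv (z : OnePoint ℂ) = fun u : ℂ => (u : OnePoint ℂ) := by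
  rw [chartInv, if_neg (coe_ne_infty z)]

theorem chartInv_infty_zero : chartInv ∞ 0 = ∞ := by
  rw [chartInv, if_pos rfl]
  exact if_pos rfl

theorem chartInv_infty_of_ne {u : ℂ} (hu : u ≠ 0) : chartInv ∞ u = ((u⁻¹ : ℂ) : OnePoint ℂ) := by
  rw [chartInv, if_pos rfl]
  exact if_neg hu

theorem chart_chartInv_infty (u : ℂ) : chart ∞ (chartInv ∞ u) = u := by
  by_cases hu : u = 0
  · rw [hu, chartInv_infty_zero, chart_infty_infty]
  · rw [chartInv_infty_of_ne hu, chart_infty_coe, inv_inv]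

theorem toComplex_chartInv_infty (u : ℂ) : toComplex (chartInv ∞ u) = u⁻¹ := by
  rw [← inv_inj, ← chart_infty_apply, chart_chartInv_infty, inv_inv]

theorem chartInv_chart_infty {q : OnePoint ℂ} (hq : q ≠ ((0 : ℂ) : OnePoint ℂ)) :
    chartInv ∞ (chart ∞ q) = q := by
  induction q using OnePoint.rec with
  | infty => rw [chart_infty_infty, chartInv_infty_zero]
  | coe z =>
    have hz : z ≠ 0 := fun h => hq (by rw [h])
    rw [chart_infty_coe, chartInv_infty_of_ne (inv_ne_zero hz), inv_inv]

theorem cobounded_eq_coclosedCompact : Bornology.cobounded ℂ = coclosedCompact ℂ := by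
  rw [coclosedCompact_eq_cocompact, Metric.cobounded_eq_cocompact]

theorem continuous_chartInv_infty : Continuous (chartInv ∞) := by
  rw [continuous_iff_continuousAt]
  intro u
  by_cases hu : u = 0
  · subst hu
    rw [ContinuousAt, chartInv_infty_zero, ← nhdsNE_sup_pure, tendsto_sup]
    constructor
    · refine ((tendsto_coe_infty (X := ℂ)).comp
        (cobounded_eq_coclosedCompact ▸ tendsto_inv₀_nhdsNE_zero)).congr' ?_
      filter_upwards [self_mem_nhdsWithin] with u hu
      exact (chartInv_infty_of_ne hu).symm
    · rw [tendsto_pure_left]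
      intro s hs
      rw [chartInv_infty_zero]
      exact mem_of_mem_nhds hs
  · have h1 : ContinuousAt (fun u : ℂ => ((u⁻¹ : ℂ) : OnePoint ℂ)) u :=
      continuous_coe.continuousAt.comp (continuousAt_inv₀ hu)
    refine h1.congr ?_
    filter_upwards [isOpen_ne.mem_nhds hu] with w hw
    exact (chartInv_infty_of_ne hw).symm

theorem continuousAt_chart_infty {q : OnePoint ℂ} (hq : q ≠ ((0 : ℂ) : OnePoint ℂ)) :
    ContinuousAt (chart ∞) q := by
  induction q using OnePoint.rec with
  | infty =>
    rw [continuousAt_infty', chart_infty_infty, ← cobounded_eq_coclosedCompact]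
    exact tendsto_inv₀_cobounded.congr fun z => (chart_infty_coe z).symm
  | coe z =>
    have hz : z ≠ 0 := fun h => hq (by rw [h])
    rw [continuousAt_coe]
    exact (continuousAt_inv₀ hz).congr (.of_forall fun z => (chart_infty_coe z).symm)

theorem bijOn_chart_infty {W : Set (OnePoint ℂ)} {E : Set ℂ}
    (h0 : ((0 : ℂ) : OnePoint ℂ) ∉ W) (h : ∀ u, chartInv ∞ u ∈ W ↔ u ∈ E) :
    BijOn (chart ∞) W E := by
  have hl : ∀ q ∈ W, chartInv ∞ (chart ∞ q) = q := fun q hq =>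
    chartInv_chart_infty fun he => h0 (he ▸ hq)
  refine ⟨fun q hq => ?_, fun q hq q' hq' he => ?_, fun u hu => ?_⟩
  · rw [← h, hl q hq]
    exact hq
  · rw [← hl q hq, he, hl q' hq']
  · exact ⟨chartInv ∞ u, (h u).2 hu, chart_chartInv_infty u⟩

/-! ### The two exterior domains in the coordinate at infinity -/

theorem coe_mem_exteriorDisk {z : ℂ} : (z : OnePoint ℂ) ∈ exteriorDisk ↔ 1 < ‖z‖ := by
  rw [exteriorDisk, mem_compl_iff, coe_injective.mem_set_image, mem_closedBall_zero_iff, not_le]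

theorem infty_mem_exteriorDisk : ∞ ∈ exteriorDisk := by
  rintro ⟨z, -, hz⟩
  exact coe_ne_infty z hz

theorem zero_notMem_exteriorDisk : ((0 : ℂ) : OnePoint ℂ) ∉ exteriorDisk := by
  rw [coe_mem_exteriorDisk, norm_zero]
  norm_num

theorem ne_zero_of_mem_exteriorDisk {q : OnePoint ℂ} (hq : q ∈ exteriorDisk) :
    q ≠ ((0 : ℂ) : OnePoint ℂ) := by
  rintro rfl
  exact zero_notMem_exteriorDisk hq

theorem coe_mem_mandelbrotExterior {z : ℂ} :
    (z : OnePoint ℂ) ∈ mandelbrotExterior ↔ z ∉ mandelbrotSet := by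
  rw [mandelbrotExterior, mem_compl_iff, coe_injective.mem_set_image]

theorem infty_mem_mandelbrotExterior : ∞ ∈ mandelbrotExterior := by
  rintro ⟨z, -, hz⟩
  exact coe_ne_infty z hz

theorem chartInv_infty_mem_exteriorDisk (u : ℂ) :
    chartInv ∞ u ∈ exteriorDisk ↔ u ∈ Metric.ball 0 1 := by
  by_cases hu : u = 0
  · rw [hu, chartInv_infty_zero]
    simp [infty_mem_exteriorDisk]
  · rw [chartInv_infty_of_ne hu, coe_mem_exteriorDisk, mem_ball_zero_iff, norm_inv,
      one_lt_inv₀ (norm_pos_iff.2 hu)]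

theorem chartInv_infty_mem_mandelbrotExterior (u : ℂ) :
    chartInv ∞ u ∈ mandelbrotExterior ↔ u ∈ recipExterior := by
  by_cases hu : u = 0
  · rw [hu, chartInv_infty_zero]
    simp [infty_mem_mandelbrotExterior, recipExterior]
  · rw [chartInv_infty_of_ne hu, coe_mem_mandelbrotExterior]
    simp [recipExterior, hu]

theorem bijOn_chart_exteriorDisk : BijOn (chart ∞) exteriorDisk (Metric.ball 0 1) :=
  bijOn_chart_infty zero_notMem_exteriorDisk chartInv_infty_mem_exteriorDisk

theorem zero_notMem_mandelbrotExterior : ((0 : ℂ) : OnePoint ℂ) ∉ mandelbrotExterior := by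
  rw [coe_mem_mandelbrotExterior, not_not]
  exact zero_mem_mandelbrotSet

theorem bijOn_chart_mandelbrotExterior : BijOn (chart ∞) mandelbrotExterior recipExterior :=
  bijOn_chart_infty zero_notMem_mandelbrotExterior chartInv_infty_mem_mandelbrotExterior

/-! ### The Riemann map of the exterior of the Mandelbrot set -/

/-- The Riemann map of the exterior of the Mandelbrot set. -/
noncomputable def riemannMap (q : OnePoint ℂ) : OnePoint ℂ := chartInv ∞ (recipMap (chart ∞ q))

theorem chart_riemannMap (q : OnePoint ℂ) : chart ∞ (riemannMap q) = recipMap (chart ∞ q) :=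
  chart_chartInv_infty _

theorem riemannMap_infty : riemannMap ∞ = ∞ := by
  rw [riemannMap, chart_infty_infty, recipMap_zero, chartInv_infty_zero]

theorem bijOn_riemannMap : BijOn riemannMap exteriorDisk mandelbrotExterior := by
  have h1 := bijOn_recipMap.comp bijOn_chart_exteriorDisk
  have h2 : ∀ q ∈ exteriorDisk, recipMap (chart ∞ q) ∈ recipExterior := fun q hq => h1.mapsTo hq
  refine ⟨fun q hq => (chartInv_infty_mem_mandelbrotExterior _).2 (h2 q hq),
    fun q hq q' hq' he => h1.injOn hq hq' ?_, fun w hw => ?_⟩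
  · have := congrArg (chart ∞) he
    rwa [chart_riemannMap, chart_riemannMap] at this
  · obtain ⟨q, hq, he⟩ := h1.surjOn (bijOn_chart_mandelbrotExterior.mapsTo hw)
    refine ⟨q, hq, ?_⟩
    rw [riemannMap, show recipMap (chart ∞ q) = chart ∞ w from he, chartInv_chart_infty]
    rintro rfl
    exact zero_notMem_mandelbrotExterior hw

theorem norm_chart_lt_one {q : OnePoint ℂ} (hq : q ∈ exteriorDisk) : ‖chart ∞ q‖ < 1 :=
  mem_ball_zero_iff.1 (bijOn_chart_exteriorDisk.mapsTo hq)

theorem holomorphicAt_riemannMap {q : OnePoint ℂ} (hq : q ∈ exteriorDisk) :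
    HolomorphicAt riemannMap q := by
  have hA : ∀ u : ℂ, ‖u‖ < 1 → AnalyticAt ℂ recipMap u := fun u hu =>
    differentiableOn_recipMap.analyticAt (Metric.isOpen_ball.mem_nhds (mem_ball_zero_iff.2 hu))
  have hq1 := norm_chart_lt_one hq
  refine ⟨?_, ?_⟩
  · exact continuous_chartInv_infty.continuousAt.comp (((hA _ hq1).continuousAt).comp
      (continuousAt_chart_infty (ne_zero_of_mem_exteriorDisk hq)))
  · induction q using OnePoint.rec with
    | infty =>
      rw [riemannMap_infty]
      refine (hA _ hq1).congr (.of_forall fun u => ?_)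
      simp only [Function.comp_apply]
      rw [chart_riemannMap, chart_chartInv_infty]
    | coe z =>
      have hz : z ≠ 0 := fun h => ne_zero_of_mem_exteriorDisk hq (by rw [h])
      rw [chart_infty_coe] at hq1
      have hz0 := recipMap_ne_zero hq1 (inv_ne_zero hz)
      have h1 : riemannMap z = (((recipMap z⁻¹)⁻¹ : ℂ) : OnePoint ℂ) := by
        rw [riemannMap, chart_infty_coe, chartInv_infty_of_ne hz0]
      rw [h1, chart_coe, chart_coe, chartInv_coe]
      have h2 : AnalyticAt ℂ (fun w => (recipMap w⁻¹)⁻¹) z :=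
        (AnalyticAt.comp (g := recipMap) (hA _ hq1) (analyticAt_inv hz)).inv hz0
      refine h2.congr (.of_forall fun w => ?_)
      simp only [Function.comp_apply]
      rw [riemannMap, chart_infty_coe, toComplex_chartInv_infty]

theorem isRiemannMap_riemannMap : IsRiemannMap mandelbrotExterior riemannMap where
  bijOn := bijOn_riemannMap
  holomorphic _ hq := holomorphicAt_riemannMap hq
  map_infty := riemannMap_infty
  deriv_pos := by
    refine ⟨1, one_pos, ?_⟩
    -- In the chart `1 / z` the quotient `φ(z) / z` is the reciprocal of the slope of `recipMap` at
    -- `0`.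
    have h1 := (hasDerivAt_iff_tendsto_slope_zero.1 hasDerivAt_recipMap_zero).comp
      (tendsto_inv₀_cobounded' (α := ℂ))
    have h2 := h1.inv₀ one_ne_zero
    rw [inv_one] at h2
    rw [Complex.ofReal_one]
    refine h2.congr fun z => ?_
    simp only [Function.comp_apply]
    rw [riemannMap, chart_infty_coe, toComplex_chartInv_infty, zero_add, recipMap_zero, sub_zero,
      smul_eq_mul, inv_inv, mul_inv, div_eq_mul_inv, mul_comm]

/-! ### Uniqueness -/

/-- Schwarz for `σ` and for its inverse gives `r ≤ 1` and `1 / r ≤ 1`; the equality case makes `σ`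
linear with slope `1`. -/
theorem eqOn_id_of_bijOn_ball {σ : ℂ → ℂ} (hb : BijOn σ (Metric.ball 0 1) (Metric.ball 0 1))
    (hd : DifferentiableOn ℂ σ (Metric.ball 0 1)) (h0 : σ 0 = 0) {r : ℝ} (hr : 0 < r)
    (hderiv : HasDerivAt σ r 0) : EqOn σ id (Metric.ball 0 1) := by
  have hm0 : (0 : ℂ) ∈ Metric.ball 0 1 := Metric.mem_ball_self one_pos
  have hmaps : MapsTo σ (Metric.ball 0 1) (Metric.closedBall (σ 0) 1) := by
    rw [h0]
    exact hb.mapsTo.mono_right Metric.ball_subset_closedBall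
  obtain ⟨τ, hτ, hτd⟩ := exists_differentiableOn_inverse Metric.isOpen_ball hd hb.injOn
  rw [hb.image_eq] at hτd
  have hτ0 : τ 0 = 0 := by
    have := hτ 0 hm0
    rwa [h0] at this
  have hτmaps : MapsTo τ (Metric.ball 0 1) (Metric.closedBall (τ 0) 1) := by
    intro w hw
    obtain ⟨v, hv, rfl⟩ := hb.surjOn hw
    rw [hτ v hv, hτ0]
    exact Metric.ball_subset_closedBall hv
  have h1 := Complex.norm_deriv_le_one_of_mapsTo_ball hd hmaps one_pos
  have h2 := Complex.norm_deriv_le_one_of_mapsTo_ball hτd hτmaps one_pos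
  have hτA : HasDerivAt τ (deriv τ 0) (σ 0) := by
    rw [h0]
    exact (hτd.differentiableAt (Metric.isOpen_ball.mem_nhds hm0)).hasDerivAt
  have h3 : deriv τ 0 * r = 1 := by
    refine (hτA.comp (0 : ℂ) hderiv).unique ((hasDerivAt_id 0).congr_of_eventuallyEq ?_)
    filter_upwards [Metric.isOpen_ball.mem_nhds hm0] with v hv using hτ v hv
  rw [hderiv.deriv, Complex.norm_real, Real.norm_of_nonneg hr.le] at h1
  have h4 : r = 1 := by
    refine le_antisymm h1 ?_
    have h5 := congrArg norm h3
    rw [norm_mul, Complex.norm_real, Real.norm_of_nonneg hr.le, norm_one] at h5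
    nlinarith
  have h5 : dslope σ 0 0 = 1 := by
    rw [dslope_same, hderiv.deriv, h4, Complex.ofReal_one]
  intro u hu
  have := Complex.affine_of_mapsTo_ball_of_norm_dslope_eq_div hd hmaps hm0
    (by rw [h5, norm_one, div_one]) hu
  rw [this, h0, h5]
  simp

/-- In the charts at infinity, `ψ` followed by `recipCoord` is an automorphism of the disk fixing
`0` with positive derivative. -/
theorem eqOn_riemannMap {ψ : OnePoint ℂ → OnePoint ℂ} (hψ : IsRiemannMap mandelbrotExterior ψ) :
    EqOn ψ riemannMap exteriorDisk := by
  obtain ⟨hb, hhol, hinf, r, hr, hlim⟩ := hψ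
  set G : ℂ → ℂ := fun u => chart ∞ (ψ (chartInv ∞ u)) with hG
  have hGb : BijOn G (Metric.ball 0 1) recipExterior := by
    refine bijOn_chart_mandelbrotExterior.comp (hb.comp ⟨fun u hu =>
      (chartInv_infty_mem_exteriorDisk u).2 hu, fun u _ u' _ he => ?_, fun q hq =>
      ⟨chart ∞ q, bijOn_chart_exteriorDisk.mapsTo hq,
        chartInv_chart_infty (ne_zero_of_mem_exteriorDisk hq)⟩⟩)
    rw [← chart_chartInv_infty u, he, chart_chartInv_infty]
  have hG0 : G 0 = 0 := by
    simp only [hG]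
    rw [chartInv_infty_zero, hinf, chart_infty_infty]
  have hGd : DifferentiableOn ℂ G (Metric.ball 0 1) := by
    intro u hu
    refine DifferentiableAt.differentiableWithinAt ?_
    by_cases hu0 : u = 0
    · subst hu0
      have h1 := (hhol ∞ infty_mem_exteriorDisk).2
      rw [hinf, chart_infty_infty] at h1
      exact h1.differentiableAt
    · have hp := (chartInv_infty_mem_exteriorDisk u).2 hu
      rw [chartInv_infty_of_ne hu0] at hp
      have hne : ψ (u⁻¹ : ℂ) ≠ ∞ := fun h => coe_ne_infty u⁻¹
        (hb.injOn hp infty_mem_exteriorDisk (by rw [h, hinf]))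
      obtain ⟨w, hw⟩ := ne_infty_iff_exists.1 hne
      have hw0 : w ≠ 0 := by
        rintro rfl
        exact zero_notMem_mandelbrotExterior (hw ▸ hb.mapsTo hp)
      have h1 := (hhol _ hp).2
      rw [← hw, chart_coe, chart_coe, chartInv_coe] at h1
      have h2 : DifferentiableAt ℂ (fun v : ℂ => (toComplex (ψ (v⁻¹ : ℂ)))⁻¹) u := by
        refine DifferentiableAt.inv (DifferentiableAt.comp
          (g := toComplex ∘ ψ ∘ fun u : ℂ => (u : OnePoint ℂ)) (f := fun v : ℂ => v⁻¹) u
          h1.differentiableAt (differentiableAt_inv hu0)) ?_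
        rw [← hw]
        exact hw0
      refine h2.congr_of_eventuallyEq ?_
      filter_upwards [isOpen_ne.mem_nhds hu0] with v hv
      simp only [hG]
      rw [chartInv_infty_of_ne hv, chart_infty_apply]
  have hGderiv : HasDerivAt G (r : ℂ)⁻¹ 0 := by
    rw [hasDerivAt_iff_tendsto_slope_zero]
    have h1 := (hlim.comp (tendsto_inv₀_nhdsNE_zero (α := ℂ))).inv₀
      (Complex.ofReal_ne_zero.2 hr.ne')
    refine h1.congr' ?_
    filter_upwards [self_mem_nhdsWithin] with u hu
    simp only [Function.comp_apply, zero_add]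
    rw [hG0, sub_zero, smul_eq_mul]
    simp only [hG]
    rw [chartInv_infty_of_ne hu, chart_infty_apply, inv_div, div_eq_mul_inv]
  have hσ : EqOn (recipCoord ∘ G) id (Metric.ball 0 1) := by
    refine eqOn_id_of_bijOn_ball (bijOn_recipCoord.comp hGb)
      (differentiableOn_recipCoord.comp hGd hGb.mapsTo) ?_ (inv_pos.2 hr) ?_
    · rw [Function.comp_apply, hG0, recipCoord_zero]
    · have h1 : HasDerivAt recipCoord 1 (G 0) := by
        rw [hG0]
        exact hasDerivAt_recipCoord_zero
      have h2 := h1.comp (0 : ℂ) hGderiv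
      rwa [one_mul, ← Complex.ofReal_inv] at h2
  intro q hq
  have hu := bijOn_chart_exteriorDisk.mapsTo hq
  have h1 : recipMap (recipCoord (G (chart ∞ q))) = G (chart ∞ q) :=
    recipMap_recipCoord (hGb.mapsTo hu)
  have h2 : recipCoord (G (chart ∞ q)) = chart ∞ q := hσ hu
  have h3 : G (chart ∞ q) = chart ∞ (ψ q) := by
    simp only [hG]
    rw [chartInv_chart_infty (ne_zero_of_mem_exteriorDisk hq)]
  rw [h2, h3] at h1
  rw [riemannMap, h1, chartInv_chart_infty]
  intro h0
  exact zero_notMem_mandelbrotExterior (h0 ▸ hb.mapsTo hq)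

end MandelbrotRiemann

namespace MandelbrotRiemann

/-! ### Taylor coefficients at the origin -/

/-- The `m`-th Taylor coefficient of `f` at the origin. -/
noncomputable def coef (f : ℂ → ℂ) (m : ℕ) : ℂ := iteratedDeriv m f 0 / m.factorial

theorem coef_zero (f : ℂ → ℂ) : coef f 0 = f 0 := by
  simp [coef]

theorem coef_add {f g : ℂ → ℂ} (hf : AnalyticAt ℂ f 0) (hg : AnalyticAt ℂ g 0) (m : ℕ) :
    coef (fun u => f u + g u) m = coef f m + coef g m := by
  rw [coef, iteratedDeriv_fun_add hf.contDiffAt hg.contDiffAt, add_div, coef, coef]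

theorem coef_mul {f g : ℂ → ℂ} (hf : AnalyticAt ℂ f 0) (hg : AnalyticAt ℂ g 0) (m : ℕ) :
    coef (fun u => f u * g u) m = ∑ i ∈ Finset.range (m + 1), coef f i * coef g (m - i) := by
  rw [coef, iteratedDeriv_fun_mul hf.contDiffAt hg.contDiffAt, Finset.sum_div]
  refine Finset.sum_congr rfl fun i hi => ?_
  have him : i ≤ m := Nat.lt_succ_iff.1 (Finset.mem_range.1 hi)
  have h1 : ((m.choose i * i.factorial * (m - i).factorial : ℕ) : ℂ) = m.factorial := by
    rw [Nat.choose_mul_factorial_mul_factorial him]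
  push_cast at h1
  have hm : (m.factorial : ℂ) ≠ 0 := Nat.cast_ne_zero.2 m.factorial_ne_zero
  have hi' : (i.factorial : ℂ) ≠ 0 := Nat.cast_ne_zero.2 i.factorial_ne_zero
  have hmi : ((m - i).factorial : ℂ) ≠ 0 := Nat.cast_ne_zero.2 (m - i).factorial_ne_zero
  rw [coef, coef, div_mul_div_comm, div_eq_div_iff hm (mul_ne_zero hi' hmi), ← h1]
  ring

theorem coef_pow (N m : ℕ) : coef (fun u => u ^ N) m = if m = N then 1 else 0 := by
  rw [coef, iteratedDeriv_fun_pow_zero]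
  split_ifs with h
  · rw [h]
    have hN : (N.factorial : ℂ) ≠ 0 := Nat.cast_ne_zero.2 N.factorial_ne_zero
    exact div_self hN
  · rw [Nat.cast_zero, zero_div]

theorem coef_pow_mul {f : ℂ → ℂ} (hf : AnalyticAt ℂ f 0) (N m : ℕ) :
    coef (fun u => u ^ N * f u) m = if N ≤ m then coef f (m - N) else 0 := by
  rw [coef_mul (by fun_prop) hf]
  simp only [coef_pow, ite_mul, one_mul, zero_mul, Finset.sum_ite_eq', Finset.mem_range,
    Nat.lt_succ_iff]

/-- Cauchy's estimate on circles shrinking to the origin. -/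
theorem coef_eq_zero_of_norm_le {f : ℂ → ℂ} {r C : ℝ} (hr : 0 < r) {N m : ℕ} (hm : m < N)
    (hf : DifferentiableOn ℂ f (Metric.ball 0 r))
    (hC : ∀ u ∈ Metric.ball (0 : ℂ) r, ‖f u‖ ≤ C * ‖u‖ ^ N) : coef f m = 0 := by
  have key : ∀ R ∈ Ioo 0 r, ‖iteratedDeriv m f 0‖ ≤ m.factorial * C * R ^ (N - m) := by
    intro R hR
    have hsub : Metric.closedBall (0 : ℂ) R ⊆ Metric.ball 0 r :=
      Metric.closedBall_subset_ball hR.2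
    have h1 := Complex.norm_iteratedDeriv_le_of_forall_mem_sphere_norm_le (C := C * R ^ N) m hR.1
      (hf.diffContOnCl_ball hsub) (fun z hz => by
        have := hC z (hsub (Metric.sphere_subset_closedBall hz))
        rwa [mem_sphere_zero_iff_norm.1 hz] at this)
    refine h1.trans_eq ?_
    rw [div_eq_iff (pow_ne_zero _ hR.1.ne'), mul_assoc _ _ (R ^ m), ← pow_add,
      Nat.sub_add_cancel hm.le, mul_assoc]
  have hlim : Tendsto (fun R : ℝ => m.factorial * C * R ^ (N - m)) (𝓝[>] 0) (𝓝 0) := by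
    have : ContinuousAt (fun R : ℝ => m.factorial * C * R ^ (N - m)) 0 := by fun_prop
    have h2 := this.tendsto.mono_left (nhdsWithin_le_nhds (s := Ioi 0))
    rwa [zero_pow (Nat.sub_ne_zero_of_lt hm), mul_zero] at h2
  have h3 : ‖iteratedDeriv m f 0‖ ≤ 0 :=
    ge_of_tendsto hlim (by filter_upwards [Ioo_mem_nhdsGT hr] with R hR using key R hR)
  rw [coef, norm_le_zero_iff.1 h3, zero_div]

/-- Cauchy's estimate on circles growing to the unit circle. -/
theorem norm_coef_le {f : ℂ → ℂ} {C : ℝ} (hf : DifferentiableOn ℂ f (Metric.ball 0 1))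
    (hC : ∀ u ∈ Metric.ball (0 : ℂ) 1, ‖f u‖ ≤ C) (m : ℕ) : ‖coef f m‖ ≤ C := by
  have hpos : (0 : ℝ) < m.factorial := Nat.cast_pos.2 m.factorial_pos
  have key : ∀ R ∈ Ioo (0 : ℝ) 1, ‖coef f m‖ ≤ C / R ^ m := by
    intro R hR
    have hsub : Metric.closedBall (0 : ℂ) R ⊆ Metric.ball 0 1 :=
      Metric.closedBall_subset_ball hR.2
    have h1 := Complex.norm_iteratedDeriv_le_of_forall_mem_sphere_norm_le (C := C) m hR.1
      (hf.diffContOnCl_ball hsub) (fun z hz => hC z (hsub (Metric.sphere_subset_closedBall hz)))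
    rw [coef, norm_div, Complex.norm_natCast, div_le_iff₀ hpos]
    refine h1.trans_eq ?_
    ring
  have hlim : Tendsto (fun R : ℝ => C / R ^ m) (𝓝[<] 1) (𝓝 C) := by
    have : ContinuousAt (fun R : ℝ => C / R ^ m) 1 :=
      ContinuousAt.div (by fun_prop) (by fun_prop) (by simp)
    have h2 := this.tendsto.mono_left (nhdsWithin_le_nhds (s := Iio 1))
    rwa [one_pow, div_one] at h2
  exact ge_of_tendsto hlim (by filter_upwards [Ioo_mem_nhdsLT one_pos] with R hR using key R hR)

theorem norm_sub_sum_coef_le {f : ℂ → ℂ} {C : ℝ} (hf : DifferentiableOn ℂ f (Metric.ball 0 1))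
    (hC : ∀ u ∈ Metric.ball (0 : ℂ) 1, ‖f u‖ ≤ C) (K : ℕ) {u : ℂ} (hu : ‖u‖ < 1) :
    ‖f u - ∑ m ∈ Finset.range K, coef f m * u ^ m‖ ≤ C * ‖u‖ ^ K * (1 - ‖u‖)⁻¹ := by
  have hs : HasSum (fun m => coef f m * u ^ m) (f u) := by
    have := Complex.hasSum_taylorSeries_on_ball (r := 1) (c := 0) (f := f) (z := u)
      (by simpa using hf) (by simpa using hu)
    refine this.congr_fun fun m => ?_
    rw [sub_zero, smul_eq_mul, smul_eq_mul, coef]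
    ring
  have h1 := (hasSum_nat_add_iff' K).2 hs
  have hgeo : HasSum (fun m => C * ‖u‖ ^ K * ‖u‖ ^ m) (C * ‖u‖ ^ K * (1 - ‖u‖)⁻¹) :=
    (hasSum_geometric_of_lt_one (norm_nonneg u) hu).mul_left _
  rw [← h1.tsum_eq]
  refine tsum_of_norm_bounded hgeo fun m => ?_
  rw [norm_mul, norm_pow, pow_add]
  have := norm_coef_le hf hC (m + K)
  calc _ ≤ C * (‖u‖ ^ m * ‖u‖ ^ K) := by gcongr
    _ = _ := by ring

/-! ### The normalized Riemann map and the iterates along it -/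

/-- `H u = u / recipMap u`, the Riemann map divided by the identity in the coordinate `u = 1 / z`. -/
noncomputable def normalizedMap (u : ℂ) : ℂ := (dslope recipMap 0 u)⁻¹

theorem dslope_recipMap_mul (u : ℂ) : dslope recipMap 0 u * u = recipMap u := by
  have := sub_smul_dslope recipMap 0 u
  rw [sub_zero, recipMap_zero, sub_zero, smul_eq_mul] at this
  rw [mul_comm, this]

theorem dslope_recipMap_ne_zero {u : ℂ} (hu : ‖u‖ < 1) : dslope recipMap 0 u ≠ 0 := by
  by_cases h0 : u = 0
  · rw [h0, dslope_same, hasDerivAt_recipMap_zero.deriv]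
    exact one_ne_zero
  · intro h
    have := dslope_recipMap_mul u
    rw [h, zero_mul] at this
    exact recipMap_ne_zero hu h0 this.symm

theorem normalizedMap_zero : normalizedMap 0 = 1 := by
  rw [normalizedMap, dslope_same, hasDerivAt_recipMap_zero.deriv, inv_one]

theorem normalizedMap_eq {u : ℂ} (h0 : u ≠ 0) : normalizedMap u = u * (recipMap u)⁻¹ := by
  rw [normalizedMap, ← dslope_recipMap_mul, mul_inv, mul_comm, mul_assoc, inv_mul_cancel₀ h0,
    mul_one]

theorem differentiableOn_normalizedMap : DifferentiableOn ℂ normalizedMap (Metric.ball 0 1) :=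
  DifferentiableOn.inv ((Complex.differentiableOn_dslope (Metric.ball_mem_nhds _ one_pos)).2
    differentiableOn_recipMap) fun _ hu => dslope_recipMap_ne_zero (mem_ball_zero_iff.1 hu)

theorem analyticAt_normalizedMap : AnalyticAt ℂ normalizedMap 0 :=
  differentiableOn_normalizedMap.analyticAt (Metric.ball_mem_nhds _ one_pos)

/-- The Mandelbrot set contains the disk of radius `1/4`, so `recipMap` maps into the disk of radius
`4` and the Schwarz lemma bounds its difference quotient at `0`. -/
theorem one_le_norm_normalizedMap {u : ℂ} (hu : ‖u‖ < 1) : 1 ≤ 4 * ‖normalizedMap u‖ := by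
  have h1 := Complex.norm_dslope_le_div_of_mapsTo_ball (R₂ := 4) differentiableOn_recipMap
    (fun v hv => by
      rw [recipMap_zero, mem_closedBall_zero_iff]
      exact (norm_lt_four_of_mem (bijOn_recipMap.mapsTo hv)).le) (mem_ball_zero_iff.2 hu)
  rw [div_one] at h1
  have h2 := norm_pos_iff.2 (dslope_recipMap_ne_zero hu)
  rw [normalizedMap, norm_inv, ← div_eq_mul_inv, le_div_iff₀ h2, one_mul]
  exact h1

/-- The modulus is `‖u‖ * ‖c‖`: at most `2` for large `c`, at most `1000` otherwise. -/
theorem norm_normalizedMap_le {u : ℂ} (hu : ‖u‖ < 1) : ‖normalizedMap u‖ ≤ 1000 := by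
  by_cases h0 : u = 0
  · rw [h0, normalizedMap_zero]
    norm_num
  · rw [normalizedMap_eq h0, norm_mul]
    rcases le_total 1000 ‖(recipMap u)⁻¹‖ with h | h
    · exact ((isExternalCoord_recipMap hu h0).norm_le_of_large h).trans (by norm_num)
    · nlinarith [norm_nonneg u, norm_nonneg (recipMap u)⁻¹]

/-- `u ^ 2 ^ n * f_c^n(c)` as a function of the uniformizing coordinate `u` of `c`. -/
noncomputable def scaledIterate : ℕ → ℂ → ℂ
  | 0, u => normalizedMap u
  | n + 1, u => scaledIterate n u * scaledIterate n u +
      u ^ (2 ^ (n + 1) - 1) * normalizedMap u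

theorem differentiableOn_scaledIterate (n : ℕ) :
    DifferentiableOn ℂ (scaledIterate n) (Metric.ball 0 1) := by
  induction n with
  | zero => exact differentiableOn_normalizedMap
  | succ n ih =>
    exact (ih.mul ih).add ((differentiableOn_id.pow _).mul differentiableOn_normalizedMap)

theorem analyticAt_scaledIterate (n : ℕ) : AnalyticAt ℂ (scaledIterate n) 0 :=
  (differentiableOn_scaledIterate n).analyticAt (Metric.ball_mem_nhds _ one_pos)

theorem scaledIterate_zero_right (n : ℕ) : scaledIterate n 0 = 1 := by
  induction n with
  | zero => exact normalizedMap_zero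
  | succ n ih =>
    have h : 2 ^ (n + 1) - 1 ≠ 0 := by
      have : 2 ≤ 2 ^ (n + 1) := Nat.le_self_pow n.succ_ne_zero 2
      omega
    rw [scaledIterate, ih, zero_pow h, zero_mul, mul_one, add_zero]

theorem scaledIterate_eq {u : ℂ} (h0 : u ≠ 0) (n : ℕ) :
    scaledIterate n u = (quad (recipMap u)⁻¹)^[n] (recipMap u)⁻¹ * u ^ 2 ^ n := by
  have h1 := normalizedMap_eq h0
  induction n with
  | zero => rw [scaledIterate, h1, Function.iterate_zero, id, pow_zero, pow_one, mul_comm]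
  | succ n ih =>
    have h2 : u ^ (2 ^ (n + 1) - 1) * u = u ^ 2 ^ (n + 1) := by
      rw [← pow_succ, Nat.sub_add_cancel Nat.one_le_two_pow]
    rw [scaledIterate, ih, h1, Function.iterate_succ_apply', quad, ← mul_assoc (u ^ _) u, h2,
      pow_succ 2 n, pow_mul u]
    ring

/-- The estimate for inverse coordinates at `u^(2^n)` gives `2 |c| |u|^(2^(n+1))`, and one factor
`|c| |u|` is at most `1000`. The radius `1/8000` ensures membership in `invDomain`. -/
theorem norm_scaledIterate_sub_one_le {u : ℂ} (hu : ‖u‖ < 1 / 8000) (n : ℕ) :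
    ‖scaledIterate n u - 1‖ ≤ 2000 * ‖u‖ ^ (2 ^ (n + 1) - 1) := by
  by_cases h0 : u = 0
  · rw [h0, scaledIterate_zero_right, sub_self, norm_zero]
    positivity
  have hu1 : ‖u‖ < 1 := hu.trans (by norm_num)
  have hN : 1 ≤ 2 ^ (n + 1) - 1 := by
    have : 2 ≤ 2 ^ (n + 1) := Nat.le_self_pow n.succ_ne_zero 2
    omega
  have h1 : ‖(recipMap u)⁻¹‖ * ‖u ^ 2 ^ n‖ ^ 2 ≤ 1000 * ‖u‖ ^ (2 ^ (n + 1) - 1) := by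
    have h2 : ‖u ^ 2 ^ n‖ ^ 2 = ‖u‖ ^ (2 ^ (n + 1) - 1) * ‖u‖ := by
      rw [← pow_succ, Nat.sub_add_cancel Nat.one_le_two_pow, norm_pow, ← pow_mul, pow_succ]
    have h3 := norm_normalizedMap_le hu1
    rw [normalizedMap_eq h0, norm_mul] at h3
    rw [h2]
    calc _ = ‖u‖ * ‖(recipMap u)⁻¹‖ * ‖u‖ ^ (2 ^ (n + 1) - 1) := by ring
      _ ≤ _ := by gcongr
  have h4 : ‖u‖ ^ (2 ^ (n + 1) - 1) ≤ ‖u‖ := pow_le_of_le_one (norm_nonneg _) hu1.le (by omega)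
  have hd : ((recipMap u)⁻¹, u ^ 2 ^ n) ∈ invDomain := by
    refine ⟨?_, h1.trans_lt (by linarith)⟩
    simp only
    have h5 : ‖u ^ 2 ^ n‖ ≤ ‖u‖ := by
      rw [norm_pow]
      exact pow_le_of_le_one (norm_nonneg _) hu1.le (by positivity)
    nlinarith [norm_nonneg (u ^ 2 ^ n)]
  rw [scaledIterate_eq h0]
  refine ((isExternalCoord_recipMap hu1 h0).norm_iterate_mul_sub_one_le hd).trans ?_
  linarith

/-- The coefficients of `scaledIterate`. -/
noncomputable def beta (n m : ℕ) : ℂ := coef (scaledIterate n) m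

theorem beta_zero_right (n : ℕ) : beta n 0 = 1 := by
  rw [beta, coef_zero, scaledIterate_zero_right]

theorem beta_eq_zero {n m : ℕ} (hm : m ≠ 0) (hmn : m ≤ n) : beta n m = 0 := by
  have hlt : m < 2 ^ (n + 1) - 1 := by
    have : n + 1 < 2 ^ (n + 1) := Nat.lt_two_pow_self
    omega
  have hd := differentiableOn_scaledIterate n
  have h1 : coef (fun u => scaledIterate n u + (-1 : ℂ)) m = 0 := by
    refine coef_eq_zero_of_norm_le (r := 1 / 8000) (by norm_num) hlt
      ((hd.mono (Metric.ball_subset_ball (by norm_num))).add_const _)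
      fun u hu => norm_scaledIterate_sub_one_le (mem_ball_zero_iff.1 hu) n
  rw [coef_add (analyticAt_scaledIterate n) analyticAt_const] at h1
  have h2 : coef (fun _ => (-1 : ℂ)) m = 0 := by
    rw [coef, iteratedDeriv_const, if_neg hm, zero_div]
  rwa [h2, add_zero] at h1

theorem beta_succ (n m : ℕ) : beta (n + 1) m =
    ∑ i ∈ Finset.range (m + 1), beta n i * beta n (m - i) +
      if 2 ^ (n + 1) - 1 ≤ m then beta 0 (m - (2 ^ (n + 1) - 1)) else 0 := by
  have hA := analyticAt_scaledIterate n
  have hp : AnalyticAt ℂ (fun u : ℂ => u ^ (2 ^ (n + 1) - 1)) 0 := by fun_prop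
  have h : scaledIterate (n + 1) = fun u => scaledIterate n u * scaledIterate n u +
      u ^ (2 ^ (n + 1) - 1) * normalizedMap u := rfl
  rw [beta, h, coef_add (f := fun u => scaledIterate n u * scaledIterate n u)
    (g := fun u => u ^ (2 ^ (n + 1) - 1) * normalizedMap u) (hA.mul hA)
    (hp.mul analyticAt_normalizedMap), coef_mul hA hA,
    coef_pow_mul analyticAt_normalizedMap]
  rfl

/-- The terms `i = 0` and `i = m + 1` of the convolution both equal `beta n (m + 1)`, as the
constant coefficients are `1`; solving for it expresses level `n` through level `n + 1` and lower
degrees. `beta_eq_zero` starts this descent in `n`. -/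
theorem beta_recursion (n m : ℕ) : beta n (m + 1) =
    2⁻¹ * (beta (n + 1) (m + 1) - ∑ i ∈ Finset.range m, beta n (i + 1) * beta n (m - i) -
      if 2 ^ (n + 1) - 1 ≤ m + 1 then beta 0 (m + 1 - (2 ^ (n + 1) - 1)) else 0) := by
  rw [beta_succ, Finset.sum_range_succ', Finset.sum_range_succ]
  simp only [Nat.add_sub_add_right, Nat.sub_self, beta_zero_right, Nat.sub_zero]
  ring

end MandelbrotRiemann

namespace MandelbrotRiemann

open RiemannSphere

/-! ### Arithmetic of complex rational numbers on codes -/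

/-- The code of `((a - b) + (c - d) i) / m`. -/
def mkCode (a b c d m : ℕ) : ℕ := Nat.pair (Nat.pair (Nat.pair a b) (Nat.pair c d)) (m - 1)

theorem rationalPoint_mkCode (a b c d : ℕ) {m : ℕ} (hm : 0 < m) :
    rationalPoint (mkCode a b c d m) = ⟨((a : ℝ) - b) / m, ((c : ℝ) - d) / m⟩ := by
  have h : ((m - 1 : ℕ) : ℝ) + 1 = m := by exact_mod_cast Nat.sub_add_cancel hm
  simp only [rationalPoint, mkCode, Nat.unpair_pair, h]

theorem primrec_mkCode {α : Type*} [Primcodable α] {a b c d m : α → ℕ} (ha : Primrec a)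
    (hb : Primrec b) (hc : Primrec c) (hd : Primrec d) (hm : Primrec m) :
    Primrec fun x => mkCode (a x) (b x) (c x) (d x) (m x) :=
  Primrec₂.natPair.comp (Primrec₂.natPair.comp (Primrec₂.natPair.comp ha hb)
    (Primrec₂.natPair.comp hc hd)) (Primrec.nat_sub.comp hm (Primrec.const 1))

theorem codeM_pos (i : ℕ) : 0 < codeM i := Nat.succ_pos _

/-- The code of a sum. -/
def addCode (i j : ℕ) : ℕ :=
  mkCode (codeA i * codeM j + codeA j * codeM i) (codeB i * codeM j + codeB j * codeM i)
    (codeC i * codeM j + codeC j * codeM i) (codeD i * codeM j + codeD j * codeM i)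
    (codeM i * codeM j)

theorem rationalPoint_addCode (i j : ℕ) :
    rationalPoint (addCode i j) = rationalPoint i + rationalPoint j := by
  have h1 := codeM_ne_zero i
  have h2 := codeM_ne_zero j
  rw [addCode, rationalPoint_mkCode _ _ _ _ (Nat.mul_pos (codeM_pos i) (codeM_pos j)),
    rationalPoint_eq i, rationalPoint_eq j]
  apply Complex.ext
  · simp only [Complex.add_re]
    push_cast
    field_simp
    ring
  · simp only [Complex.add_im]
    push_cast
    field_simp
    ring

/-- The code of the opposite. -/
def negCode (i : ℕ) : ℕ := mkCode (codeB i) (codeA i) (codeD i) (codeC i) (codeM i)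

theorem rationalPoint_negCode (i : ℕ) : rationalPoint (negCode i) = -rationalPoint i := by
  rw [negCode, rationalPoint_mkCode _ _ _ _ (codeM_pos i), rationalPoint_eq i]
  apply Complex.ext
  · simp only [Complex.neg_re]
    ring
  · simp only [Complex.neg_im]
    ring

/-- The code of a product. -/
def mulCode (i j : ℕ) : ℕ :=
  mkCode (codeA i * codeA j + codeB i * codeB j + (codeC i * codeD j + codeD i * codeC j))
    (codeA i * codeB j + codeB i * codeA j + (codeC i * codeC j + codeD i * codeD j))
    (codeA i * codeC j + codeB i * codeD j + (codeC i * codeA j + codeD i * codeB j))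
    (codeA i * codeD j + codeB i * codeC j + (codeC i * codeB j + codeD i * codeA j))
    (codeM i * codeM j)

theorem rationalPoint_mulCode (i j : ℕ) :
    rationalPoint (mulCode i j) = rationalPoint i * rationalPoint j := by
  have h1 := codeM_ne_zero i
  have h2 := codeM_ne_zero j
  rw [mulCode, rationalPoint_mkCode _ _ _ _ (Nat.mul_pos (codeM_pos i) (codeM_pos j)),
    rationalPoint_eq i, rationalPoint_eq j]
  apply Complex.ext
  · simp only [Complex.mul_re]
    push_cast
    field_simp
    ring
  · simp only [Complex.mul_im]
    push_cast
    field_simp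
    ring

/-- `(codeM i) ^ 2` times the squared modulus of the point with code `i`. -/
def normSqNum (i : ℕ) : ℕ := natSqDist (codeA i) (codeB i) + natSqDist (codeC i) (codeD i)

theorem normSqNum_cast (i : ℕ) :
    (normSqNum i : ℝ) = codeM i ^ 2 * Complex.normSq (rationalPoint i) := by
  have h1 := codeM_ne_zero i
  rw [normSqNum, Nat.cast_add, natSqDist_cast, natSqDist_cast, rationalPoint_eq,
    Complex.normSq_apply]
  simp only
  field_simp

/-- The code of the inverse (of a nonzero number). -/
def invCode (i : ℕ) : ℕ :=
  mkCode (codeM i * codeA i) (codeM i * codeB i) (codeM i * codeD i) (codeM i * codeC i)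
    (normSqNum i)

/-- Multiply by the conjugate; conjugation swaps the two halves of the imaginary difference. -/
theorem rationalPoint_invCode {i : ℕ} (hi : rationalPoint i ≠ 0) :
    rationalPoint (invCode i) = (rationalPoint i)⁻¹ := by
  have h1 := codeM_ne_zero i
  have h2 := normSqNum_cast i
  have h3 : (0 : ℝ) < normSqNum i := by
    have := Complex.normSq_pos.2 hi
    rw [h2]
    positivity
  have h4 : Complex.normSq (rationalPoint i) ≠ 0 := Complex.normSq_eq_zero.not.2 hi
  have hre : (rationalPoint i).re = ((codeA i : ℝ) - codeB i) / codeM i := by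
    rw [rationalPoint_eq]
  have him : (rationalPoint i).im = ((codeC i : ℝ) - codeD i) / codeM i := by
    rw [rationalPoint_eq]
  rw [invCode, rationalPoint_mkCode _ _ _ _ (Nat.cast_pos.1 h3)]
  apply Complex.ext
  · rw [Complex.inv_re, h2, hre]
    push_cast
    field_simp
  · rw [Complex.inv_im, h2, him]
    push_cast
    field_simp
    ring

/-- The code of `0`. -/
def zeroCode : ℕ := mkCode 0 0 0 0 1

/-- The code of `1`. -/
def oneCode : ℕ := mkCode 1 0 0 0 1

/-- The code of `1 / 2`. -/
def halfCode : ℕ := mkCode 1 0 0 0 2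

theorem rationalPoint_zeroCode : rationalPoint zeroCode = 0 := by
  rw [zeroCode, rationalPoint_mkCode _ _ _ _ one_pos]
  apply Complex.ext <;> simp

theorem rationalPoint_oneCode : rationalPoint oneCode = 1 := by
  rw [oneCode, rationalPoint_mkCode _ _ _ _ one_pos]
  apply Complex.ext <;> simp

theorem rationalPoint_halfCode : rationalPoint halfCode = 2⁻¹ := by
  rw [halfCode, rationalPoint_mkCode _ _ _ _ two_pos]
  apply Complex.ext <;> simp

theorem primrec_mul_add_mul {α : Type*} [Primcodable α] {a b c d : α → ℕ} (ha : Primrec a)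
    (hb : Primrec b) (hc : Primrec c) (hd : Primrec d) :
    Primrec fun x => a x * b x + c x * d x :=
  Primrec.nat_add.comp (Primrec.nat_mul.comp ha hb) (Primrec.nat_mul.comp hc hd)

theorem primrec_addCode : Primrec₂ addCode := by
  have h : ∀ {v : ℕ → ℕ}, Primrec v →
      Primrec fun x : ℕ × ℕ => v x.1 * codeM x.2 + v x.2 * codeM x.1 := fun hv =>
    primrec_mul_add_mul (hv.comp .fst) (primrec_codeM.comp .snd) (hv.comp .snd)
      (primrec_codeM.comp .fst)
  exact primrec_mkCode (h primrec_codeA) (h primrec_codeB) (h primrec_codeC) (h primrec_codeD)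
    (Primrec.nat_mul.comp (primrec_codeM.comp .fst) (primrec_codeM.comp .snd))

theorem primrec_mulCode : Primrec₂ mulCode := by
  have h : ∀ {a b c d a' b' c' d' : ℕ → ℕ}, Primrec a → Primrec b → Primrec c → Primrec d →
      Primrec a' → Primrec b' → Primrec c' → Primrec d' →
      Primrec fun x : ℕ × ℕ => a x.1 * a' x.2 + b x.1 * b' x.2 + (c x.1 * c' x.2 + d x.1 * d' x.2) :=
    fun ha hb hc hd ha' hb' hc' hd' => Primrec.nat_add.comp
      (primrec_mul_add_mul (ha.comp .fst) (ha'.comp .snd) (hb.comp .fst) (hb'.comp .snd))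
      (primrec_mul_add_mul (hc.comp .fst) (hc'.comp .snd) (hd.comp .fst) (hd'.comp .snd))
  have h' := fun {a' b' c' d' : ℕ → ℕ} => h (a' := a') (b' := b') (c' := c') (d' := d')
    primrec_codeA primrec_codeB primrec_codeC primrec_codeD
  exact primrec_mkCode (h' primrec_codeA primrec_codeB primrec_codeD primrec_codeC)
    (h' primrec_codeB primrec_codeA primrec_codeC primrec_codeD)
    (h' primrec_codeC primrec_codeD primrec_codeA primrec_codeB)
    (h' primrec_codeD primrec_codeC primrec_codeB primrec_codeA)
    (Primrec.nat_mul.comp (primrec_codeM.comp .fst) (primrec_codeM.comp .snd))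

theorem primrec_negCode : Primrec negCode :=
  primrec_mkCode primrec_codeB primrec_codeA primrec_codeD primrec_codeC primrec_codeM

theorem primrec_normSqNum : Primrec normSqNum :=
  Primrec.nat_add.comp (primrec_natSqDist.comp primrec_codeA primrec_codeB)
    (primrec_natSqDist.comp primrec_codeC primrec_codeD)

theorem primrec_invCode : Primrec invCode := by
  have h : ∀ {v : ℕ → ℕ}, Primrec v → Primrec fun x : ℕ => codeM x * v x := fun hv =>
    Primrec.nat_mul.comp primrec_codeM hv
  exact primrec_mkCode (h primrec_codeA) (h primrec_codeB) (h primrec_codeD) (h primrec_codeC)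
    primrec_normSqNum

/-- The code of a finite sum. -/
def sumCode (f : ℕ → ℕ) : ℕ → ℕ
  | 0 => zeroCode
  | n + 1 => addCode (sumCode f n) (f n)

theorem rationalPoint_sumCode (f : ℕ → ℕ) (n : ℕ) :
    rationalPoint (sumCode f n) = ∑ i ∈ Finset.range n, rationalPoint (f i) := by
  induction n with
  | zero => exact rationalPoint_zeroCode
  | succ n ih => rw [sumCode, rationalPoint_addCode, ih, Finset.sum_range_succ]

theorem primrec_sumCode {α : Type*} [Primcodable α] {f : α → ℕ → ℕ} {n : α → ℕ}
    (hf : Primrec₂ f) (hn : Primrec n) : Primrec fun x => sumCode (f x) (n x) := by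
  have h := Primrec.nat_rec' (f := n) (g := fun _ => zeroCode)
    (h := fun x (p : ℕ × ℕ) => addCode p.2 (f x p.1)) hn (Primrec.const _)
    (primrec_addCode.comp (Primrec.snd.comp .snd)
      (hf.comp .fst (Primrec.fst.comp .snd)))
  refine h.of_eq fun x => ?_
  induction n x with
  | zero => rfl
  | succ n ih => simp only [sumCode, ih]

/-- The code of a power. -/
def powCode (i : ℕ) : ℕ → ℕ
  | 0 => oneCode
  | n + 1 => mulCode (powCode i n) i

theorem rationalPoint_powCode (i n : ℕ) :
    rationalPoint (powCode i n) = rationalPoint i ^ n := by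
  induction n with
  | zero => rw [powCode, rationalPoint_oneCode, pow_zero]
  | succ n ih => rw [powCode, rationalPoint_mulCode, ih, pow_succ]

theorem primrec_powCode : Primrec₂ powCode := by
  have h := Primrec.nat_rec' (f := fun x : ℕ × ℕ => x.2) (g := fun _ => oneCode)
    (h := fun x (p : ℕ × ℕ) => mulCode p.2 x.1) Primrec.snd (Primrec.const _)
    (primrec_mulCode.comp (Primrec.snd.comp .snd) (Primrec.fst.comp .fst))
  refine h.of_eq fun x => ?_
  induction x.2 with
  | zero => rfl
  | succ n ih => simp only [powCode, ih]

/-! ### A table of the coefficients -/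

/-- The entry of the table of codes of `beta (K - j) m`, in position `m * (K + 1) + j`, computed from
the list `l` of the preceding entries. -/
def nextEntry (K : ℕ) (l : List ℕ) : ℕ :=
  let t := l.length
  let m := t / (K + 1)
  let j := t % (K + 1)
  if m = 0 then oneCode else if j = 0 then zeroCode else
    mulCode halfCode (addCode (l.getD (t - 1) 0) (negCode (addCode
      (sumCode (fun i => mulCode (l.getD ((i + 1) * (K + 1) + j) 0)
        (l.getD ((m - 1 - i) * (K + 1) + j) 0)) (m - 1))
      (if 2 ^ (K - j + 1) - 1 ≤ m then
        l.getD ((m - (2 ^ (K - j + 1) - 1)) * (K + 1) + K) 0 else zeroCode))))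

/-- The first `t` entries of the table. -/
def table (K : ℕ) : ℕ → List ℕ
  | 0 => []
  | t + 1 => table K t ++ [nextEntry K (table K t)]

theorem length_table (K t : ℕ) : (table K t).length = t := by
  induction t with
  | zero => rfl
  | succ t ih => rw [table, List.length_append, ih, List.length_singleton]

theorem table_getD {K t i : ℕ} (hi : i < t) : (table K t).getD i 0 = nextEntry K (table K i) := by
  induction t with
  | zero => exact absurd hi (Nat.not_lt_zero _)
  | succ t ih =>
    rw [table]
    rcases Nat.lt_succ_iff_lt_or_eq.1 hi with h | rfl
    · rw [List.getD_append _ _ _ _ (by rwa [length_table]), ih h]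
    · rw [List.getD_append_right _ _ _ _ (by rw [length_table]), length_table, Nat.sub_self]
      rfl

/-- Row `m` of the table descends from level `K` to level `0`. The column `j = 0` is known since `m
≤ K`; other entries use the left neighbour and earlier rows, so all lookups precede the current
position. -/
theorem rationalPoint_nextEntry {K m j : ℕ} (hm : m ≤ K) (hj : j ≤ K) :
    rationalPoint (nextEntry K (table K (m * (K + 1) + j))) = beta (K - j) m := by
  induction h : m * (K + 1) + j using Nat.strong_induction_on generalizing m j with
  | _ t ih =>
    subst h
    have hdiv : (m * (K + 1) + j) / (K + 1) = m := by
      rw [mul_comm, Nat.mul_add_div K.succ_pos, Nat.div_eq_of_lt (by omega), add_zero]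
    have hmod : (m * (K + 1) + j) % (K + 1) = j := by
      rw [mul_comm, Nat.mul_add_mod, Nat.mod_eq_of_lt (by omega)]
    have hval : ∀ m' j', m' ≤ K → j' ≤ K → m' * (K + 1) + j' < m * (K + 1) + j →
        rationalPoint ((table K (m * (K + 1) + j)).getD (m' * (K + 1) + j') 0) =
          beta (K - j') m' := fun m' j' h1 h2 h3 => by
      rw [table_getD h3, ih _ h3 h1 h2 rfl]
    rw [nextEntry]
    simp only [length_table, hdiv, hmod]
    rcases Nat.eq_zero_or_pos m with rfl | hm0
    · rw [if_pos rfl, rationalPoint_oneCode, beta_zero_right]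
    rw [if_neg hm0.ne']
    rcases Nat.eq_zero_or_pos j with rfl | hj0
    · rw [if_pos rfl, rationalPoint_zeroCode, Nat.sub_zero, beta_eq_zero hm0.ne' hm]
    rw [if_neg hj0.ne']
    obtain ⟨m, rfl⟩ := Nat.exists_eq_succ_of_ne_zero hm0.ne'
    obtain ⟨j, rfl⟩ := Nat.exists_eq_succ_of_ne_zero hj0.ne'
    simp only [Nat.succ_eq_add_one] at *
    rw [rationalPoint_mulCode, rationalPoint_addCode, rationalPoint_negCode,
      rationalPoint_addCode, rationalPoint_sumCode, rationalPoint_halfCode, beta_recursion]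
    have hlt : ∀ m' j', m' ≤ m → j' ≤ K → m' * (K + 1) + j' < (m + 1) * (K + 1) + (j + 1) := by
      intro m' j' h1 h2
      have : m' * (K + 1) ≤ m * (K + 1) := Nat.mul_le_mul_right _ h1
      rw [add_mul]
      omega
    have e1 : (m + 1) * (K + 1) + (j + 1) - 1 = (m + 1) * (K + 1) + j := rfl
    rw [e1, hval (m + 1) j hm (by omega) (by omega), show K - j = K - (j + 1) + 1 by omega]
    have e2 : ∑ i ∈ Finset.range (m + 1 - 1), rationalPoint (mulCode
        ((table K ((m + 1) * (K + 1) + (j + 1))).getD ((i + 1) * (K + 1) + (j + 1)) 0)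
        ((table K ((m + 1) * (K + 1) + (j + 1))).getD ((m + 1 - 1 - i) * (K + 1) + (j + 1)) 0)) =
        ∑ i ∈ Finset.range m, beta (K - (j + 1)) (i + 1) * beta (K - (j + 1)) (m - i) := by
      refine Finset.sum_congr rfl fun i hi => ?_
      have him := Finset.mem_range.1 hi
      rw [rationalPoint_mulCode, hval _ _ (by omega) hj (hlt _ _ (by omega) hj),
        hval _ _ (by omega) hj (hlt _ _ (by omega) hj), Nat.add_sub_cancel]
    rw [e2]
    have e3 : rationalPoint (if 2 ^ (K - (j + 1) + 1) - 1 ≤ m + 1 then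
        (table K ((m + 1) * (K + 1) + (j + 1))).getD
          ((m + 1 - (2 ^ (K - (j + 1) + 1) - 1)) * (K + 1) + K) 0 else zeroCode) =
        if 2 ^ (K - (j + 1) + 1) - 1 ≤ m + 1 then
          beta 0 (m + 1 - (2 ^ (K - (j + 1) + 1) - 1)) else 0 := by
      -- The shift is therefore at least `1`, and the entry of `beta 0` (column `K`) is taken from
      -- an earlier row.
      have : 2 ≤ 2 ^ (K - (j + 1) + 1) := Nat.le_self_pow (Nat.succ_ne_zero _) 2
      split_ifs with h
      · rw [hval _ _ (by omega) le_rfl (hlt _ _ (by omega) le_rfl), Nat.sub_self]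
      · exact rationalPoint_zeroCode
    rw [e3]
    ring

theorem primrec_nextEntry : Primrec₂ nextEntry := by
  have hK : Primrec fun x : ℕ × List ℕ => x.1 := .fst
  have hl : Primrec fun x : ℕ × List ℕ => x.2 := .snd
  have ht : Primrec fun x : ℕ × List ℕ => x.2.length := Primrec.list_length.comp hl
  have hm : Primrec fun x : ℕ × List ℕ => x.2.length / (x.1 + 1) :=
    Primrec.nat_div.comp ht (Primrec.succ.comp hK)
  have hj : Primrec fun x : ℕ × List ℕ => x.2.length % (x.1 + 1) :=
    Primrec.nat_mod.comp ht (Primrec.succ.comp hK)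
  have hN : Primrec fun x : ℕ × List ℕ => 2 ^ (x.1 - x.2.length % (x.1 + 1) + 1) - 1 :=
    Primrec.nat_sub.comp (primrec_pow_two.comp (Primrec.succ.comp (Primrec.nat_sub.comp hK hj)))
      (Primrec.const 1)
  have hget : ∀ {β : Type} [Primcodable β] {l : β → List ℕ} {K a b : β → ℕ}, Primrec l →
      Primrec K → Primrec a → Primrec b →
      Primrec fun x => (l x).getD (a x * (K x + 1) + b x) 0 := fun hl hK ha hb =>
    (Primrec.list_getD 0).comp hl (Primrec.nat_add.comp
      (Primrec.nat_mul.comp ha (Primrec.succ.comp hK)) hb)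
  have hsum : Primrec₂ fun (x : ℕ × List ℕ) (i : ℕ) =>
      mulCode (x.2.getD ((i + 1) * (x.1 + 1) + x.2.length % (x.1 + 1)) 0)
        (x.2.getD ((x.2.length / (x.1 + 1) - 1 - i) * (x.1 + 1) + x.2.length % (x.1 + 1)) 0) :=
    primrec_mulCode.comp
      (hget (hl.comp .fst) (hK.comp .fst) (Primrec.succ.comp .snd) (hj.comp .fst))
      (hget (hl.comp .fst) (hK.comp .fst) (Primrec.nat_sub.comp (Primrec.nat_sub.comp
        (hm.comp .fst) (Primrec.const 1)) .snd) (hj.comp .fst))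
  refine Primrec.ite (Primrec.eq.comp hm (Primrec.const 0)) (Primrec.const _)
    (Primrec.ite (Primrec.eq.comp hj (Primrec.const 0)) (Primrec.const _) ?_)
  refine primrec_mulCode.comp (Primrec.const _) (primrec_addCode.comp ((Primrec.list_getD 0).comp hl
    (Primrec.nat_sub.comp ht (Primrec.const 1))) (primrec_negCode.comp (primrec_addCode.comp
    (primrec_sumCode hsum (Primrec.nat_sub.comp hm (Primrec.const 1)))
    (Primrec.ite (Primrec.nat_le.comp hN hm) ?_ (Primrec.const _)))))
  exact hget hl hK (Primrec.nat_sub.comp hm hN) hK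

theorem primrec_table : Primrec₂ table := by
  have h := Primrec.nat_rec' (f := fun x : ℕ × ℕ => x.2) (g := fun _ => ([] : List ℕ))
    (h := fun x (p : ℕ × List ℕ) => p.2 ++ [nextEntry x.1 p.2]) Primrec.snd (Primrec.const _)
    (Primrec.list_concat.comp (Primrec.snd.comp .snd)
      (primrec_nextEntry.comp (Primrec.fst.comp .fst) (Primrec.snd.comp .snd)))
  refine h.of_eq fun x => ?_
  induction x.2 with
  | zero => rfl
  | succ n ih => simp only [table, ih]

/-- The code of `beta 0 m`, for `m ≤ K`. -/
def coefCode (K m : ℕ) : ℕ := nextEntry K (table K (m * (K + 1) + K))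

theorem rationalPoint_coefCode {K m : ℕ} (hm : m ≤ K) :
    rationalPoint (coefCode K m) = coef normalizedMap m := by
  rw [coefCode, rationalPoint_nextEntry hm le_rfl, Nat.sub_self]
  rfl

theorem primrec_coefCode : Primrec₂ coefCode :=
  primrec_nextEntry.comp .fst (primrec_table.comp .fst (Primrec.nat_add.comp
    (Primrec.nat_mul.comp .snd (Primrec.succ.comp .fst)) .fst))

/-- The code of `q * ∑ m < K, b m * q⁻ᵐ`, where `b m` are the coefficients of `normalizedMap` and `q`
is the point with code `i`. -/
def valueCode (K i : ℕ) : ℕ :=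
  mulCode i (sumCode (fun m => mulCode (coefCode K m) (powCode (invCode i) m)) K)

theorem rationalPoint_valueCode {K i : ℕ} (hi : rationalPoint i ≠ 0) :
    rationalPoint (valueCode K i) = rationalPoint i *
      ∑ m ∈ Finset.range K, coef normalizedMap m * (rationalPoint i)⁻¹ ^ m := by
  rw [valueCode, rationalPoint_mulCode, rationalPoint_sumCode]
  congr 1
  refine Finset.sum_congr rfl fun m hm => ?_
  rw [rationalPoint_mulCode, rationalPoint_coefCode (Finset.mem_range.1 hm).le,
    rationalPoint_powCode, rationalPoint_invCode hi]

theorem primrec_valueCode : Primrec₂ valueCode := by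
  refine primrec_mulCode.comp .snd (primrec_sumCode (f := fun (x : ℕ × ℕ) m =>
    mulCode (coefCode x.1 m) (powCode (invCode x.2) m)) ?_ .fst)
  exact primrec_mulCode.comp (primrec_coefCode.comp (Primrec.fst.comp .fst) .snd)
    (primrec_powCode.comp (primrec_invCode.comp (Primrec.snd.comp .fst)) .snd)

end MandelbrotRiemann

namespace MandelbrotRiemann

open RiemannSphere
open scoped OnePoint

/-! ### Estimates for the chordal metric -/

/-- Inversion is an isometry of the chordal metric, so errors can be measured in the coordinate `1 /
z`. -/
theorem dist_stereo_chartInv_infty (u v : ℂ) :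
    dist (stereo (chartInv ∞ u)) (stereo (chartInv ∞ v)) =
      Real.sqrt (4 * Complex.normSq (u - v) /
        ((1 + Complex.normSq u) * (1 + Complex.normSq v))) := by
  have key : ∀ {w : ℂ}, w ≠ 0 → dist (stereo (chartInv ∞ w)) (stereo (chartInv ∞ 0)) =
      Real.sqrt (4 * Complex.normSq w / (1 + Complex.normSq w)) := by
    intro w hw
    have hw' := Complex.normSq_pos.2 hw
    rw [chartInv_infty_of_ne hw, chartInv_infty_zero, dist_stereo_infty, Complex.normSq_inv]
    congr 1
    field_simp
    ring
  by_cases hu : u = 0 <;> by_cases hv : v = 0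
  · subst hu hv
    simp
  · subst hu
    rw [dist_comm, key hv]
    simp
  · subst hv
    rw [key hu]
    simp
  · have hu' := Complex.normSq_pos.2 hu
    have hv' := Complex.normSq_pos.2 hv
    rw [chartInv_infty_of_ne hu, chartInv_infty_of_ne hv, dist_stereo_coe, inv_sub_inv hu hv,
      Complex.normSq_div, Complex.normSq_mul, Complex.normSq_inv, Complex.normSq_inv,
      ← Complex.normSq_neg (v - u), neg_sub]
    congr 1
    field_simp
    ring

theorem dist_stereo_chartInv_infty_le (u v : ℂ) :
    dist (stereo (chartInv ∞ u)) (stereo (chartInv ∞ v)) ≤ 2 * ‖u - v‖ := by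
  rw [dist_stereo_chartInv_infty]
  refine Real.sqrt_le_iff.2 ⟨by positivity, ?_⟩
  have hu := Complex.normSq_nonneg u
  have hv := Complex.normSq_nonneg v
  rw [mul_pow, ← Complex.normSq_eq_norm_sq]
  refine div_le_of_le_mul₀ (by positivity)
    (mul_nonneg (by norm_num) (Complex.normSq_nonneg _)) ?_
  have h1 : 1 ≤ (1 + Complex.normSq u) * (1 + Complex.normSq v) := by nlinarith
  nlinarith [Complex.normSq_nonneg (u - v)]

theorem norm_sub_le_dist_stereo {u v : ℂ} (hu : ‖u‖ ≤ 1) (hv : ‖v‖ ≤ 1) :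
    ‖u - v‖ ≤ dist (stereo (chartInv ∞ u)) (stereo (chartInv ∞ v)) := by
  rw [dist_stereo_chartInv_infty]
  refine Real.le_sqrt_of_sq_le ?_
  have hu' : Complex.normSq u ≤ 1 := by
    rw [Complex.normSq_eq_norm_sq]
    nlinarith [norm_nonneg u]
  have hv' : Complex.normSq v ≤ 1 := by
    rw [Complex.normSq_eq_norm_sq]
    nlinarith [norm_nonneg v]
  have hu0 := Complex.normSq_nonneg u
  have hv0 := Complex.normSq_nonneg v
  rw [← Complex.normSq_eq_norm_sq, le_div_iff₀ (by positivity)]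
  have h1 : (1 + Complex.normSq u) * (1 + Complex.normSq v) ≤ 4 := by nlinarith
  nlinarith [Complex.normSq_nonneg (u - v)]

/-- Chordal distance is at most twice the relative error; a common large factor then does no harm.
-/
theorem dist_stereo_coe_le (z w : ℂ) :
    dist (stereo (z : OnePoint ℂ)) (stereo (w : OnePoint ℂ)) * ‖w‖ ≤ 2 * ‖z - w‖ := by
  have hz := Complex.normSq_nonneg z
  have hw := Complex.normSq_nonneg w
  rw [dist_stereo_coe]
  refine (pow_le_pow_iff_left₀ (by positivity) (by positivity) two_ne_zero).1 ?_
  rw [mul_pow, Real.sq_sqrt (by have := Complex.normSq_nonneg (z - w); positivity), mul_pow,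
    ← Complex.normSq_eq_norm_sq, ← Complex.normSq_eq_norm_sq, div_mul_eq_mul_div,
    div_le_iff₀ (by positivity)]
  have h1 : Complex.normSq w ≤ (1 + Complex.normSq z) * (1 + Complex.normSq w) := by nlinarith
  nlinarith [Complex.normSq_nonneg (z - w)]

/-! ### Error estimates -/

/-- Bernoulli gives `(1 + 2^(-j))^(2^j) ≥ 2`, and `(1 - x) (1 + x) ≤ 1`. -/
theorem one_sub_half_pow_le (j k : ℕ) :
    (1 - (1 / 2 : ℝ) ^ j) ^ (2 ^ j * k) ≤ (1 / 2) ^ k := by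
  have hpos : (0 : ℝ) < (1 / 2) ^ j := by positivity
  have hle : (1 / 2 : ℝ) ^ j ≤ 1 := pow_le_one₀ (by norm_num) (by norm_num)
  rw [pow_mul]
  refine pow_le_pow_left₀ (by positivity [sub_nonneg.2 hle]) ?_ k
  have h1 : 2 ≤ (1 + (1 / 2 : ℝ) ^ j) ^ 2 ^ j := by
    have := one_add_mul_le_pow (a := (1 / 2 : ℝ) ^ j) (by linarith) (2 ^ j)
    push_cast at this
    rw [← mul_pow] at this
    norm_num at this ⊢
    exact this
  have h2 : (1 - (1 / 2 : ℝ) ^ j) ^ 2 ^ j * (1 + (1 / 2 : ℝ) ^ j) ^ 2 ^ j ≤ 1 := by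
    rw [← mul_pow]
    exact pow_le_one₀ (mul_nonneg (by linarith) (by linarith)) (by nlinarith)
  have h3 : (0 : ℝ) ≤ (1 - (1 / 2 : ℝ) ^ j) ^ 2 ^ j := pow_nonneg (by linarith) _
  nlinarith

/-- Schwarz on the disk of radius `δ` about `v`, where values differ by less than `4 + 4`. -/
theorem norm_recipMap_sub_le {u v : ℂ} {δ : ℝ} (hv : ‖v‖ ≤ 1 - δ) (huv : ‖u - v‖ < δ) :
    ‖recipMap u - recipMap v‖ ≤ 8 / δ * ‖u - v‖ := by
  have hδ : 0 < δ := (norm_nonneg _).trans_lt huv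
  have hsub : Metric.ball v δ ⊆ Metric.ball 0 1 := by
    refine Metric.ball_subset_ball' ?_
    rw [dist_zero_right]
    linarith
  have hv1 : v ∈ Metric.ball (0 : ℂ) 1 := hsub (Metric.mem_ball_self hδ)
  have h := Complex.dist_le_div_mul_dist_of_mapsTo_ball (R₂ := 8) (z := u)
    (differentiableOn_recipMap.mono hsub) (fun w hw => ?_) (by rwa [mem_ball_iff_norm])
  · rwa [dist_eq_norm, dist_eq_norm] at h
  · rw [mem_closedBall_iff_norm]
    have h1 := norm_lt_four_of_mem (bijOn_recipMap.mapsTo (hsub hw))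
    have h2 := norm_lt_four_of_mem (bijOn_recipMap.mapsTo hv1)
    linarith [norm_sub_le (recipMap w) (recipMap v)]

/-- The number of coefficients that guarantee the precision `2 ^ (-n - 1)` on the disk of radius
`1 - 2 ^ (-j)`. -/
def numTerms (j n : ℕ) : ℕ := 2 ^ j * (n + j + 14)

theorem norm_normalizedMap_sub_le {j n : ℕ} {u : ℂ} (hu : ‖u‖ ≤ 1 - (1 / 2) ^ j) :
    ‖normalizedMap u - ∑ m ∈ Finset.range (numTerms j n), coef normalizedMap m * u ^ m‖ ≤
      1000 / 2 ^ 14 * (1 / 2) ^ n := by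
  have hpos : (0 : ℝ) < (1 / 2) ^ j := by positivity
  have hu1 : ‖u‖ < 1 := by linarith
  refine (norm_sub_sum_coef_le differentiableOn_normalizedMap
    (fun v hv => norm_normalizedMap_le (mem_ball_zero_iff.1 hv)) _ hu1).trans ?_
  have h1 : ‖u‖ ^ numTerms j n ≤ (1 / 2) ^ (n + j + 14) :=
    (pow_le_pow_left₀ (norm_nonneg _) hu _).trans (one_sub_half_pow_le j _)
  have h2 : (1 - ‖u‖)⁻¹ ≤ ((1 / 2) ^ j)⁻¹ := by
    gcongr
    linarith
  calc 1000 * ‖u‖ ^ numTerms j n * (1 - ‖u‖)⁻¹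
      ≤ 1000 * (1 / 2) ^ (n + j + 14) * ((1 / 2) ^ j)⁻¹ := by
        have : 0 ≤ (1 - ‖u‖)⁻¹ := inv_nonneg.2 (by linarith)
        gcongr
    _ = 1000 / 2 ^ 14 * (1 / 2) ^ n := by
        rw [pow_add, pow_add]
        field_simp

theorem dist_valueCode_lt {j n i : ℕ} (hi0 : rationalPoint i ≠ 0)
    (hi : ‖(rationalPoint i)⁻¹‖ ≤ 1 - (1 / 2) ^ j) :
    dist (stereo (rationalPoint (valueCode (numTerms j n) i) : OnePoint ℂ))
      (stereo (riemannMap (rationalPoint i : OnePoint ℂ))) < (1 / 2) ^ (n + 1) := by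
  rw [rationalPoint_valueCode hi0]
  set q := rationalPoint i
  set u := q⁻¹ with hu
  have hpos : (0 : ℝ) < (1 / 2) ^ j := by positivity
  have hu1 : ‖u‖ < 1 := by linarith
  have hu0 : u ≠ 0 := inv_ne_zero hi0
  have h1 : riemannMap (q : OnePoint ℂ) = ((q * normalizedMap u : ℂ) : OnePoint ℂ) := by
    rw [riemannMap, chart_infty_coe, chartInv_infty_of_ne (recipMap_ne_zero hu1 hu0),
      normalizedMap_eq hu0, ← mul_assoc, hu, mul_inv_cancel₀ hi0, one_mul]
  rw [h1]
  have h2 := dist_stereo_coe_le (q * ∑ m ∈ Finset.range (numTerms j n),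
    coef normalizedMap m * u ^ m) (q * normalizedMap u)
  rw [← mul_sub, norm_mul, norm_mul, norm_sub_rev] at h2
  have h3 := norm_normalizedMap_sub_le (n := n) hi
  have h4 := one_le_norm_normalizedMap hu1
  have hq : 0 < ‖q‖ := norm_pos_iff.2 hi0
  have hn : (0 : ℝ) < (1 / 2) ^ n := by positivity
  set D := dist (stereo ((q * ∑ m ∈ Finset.range (numTerms j n),
    coef normalizedMap m * u ^ m : ℂ) : OnePoint ℂ)) (stereo ((q * normalizedMap u : ℂ) : OnePoint ℂ))
  have hD : 0 ≤ D := dist_nonneg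
  set E := ‖normalizedMap u - ∑ m ∈ Finset.range (numTerms j n), coef normalizedMap m * u ^ m‖
  -- The factor `‖q‖` cancels. With `‖normalizedMap u‖ ≥ 1/4` this gives `D ≤ 8 E`, and `8 * 1000 /
  -- 2^14 < 1/2` explains the constant `14`.
  have h5 : D * ‖normalizedMap u‖ ≤ 2 * E := by
    refine le_of_mul_le_mul_left ?_ hq
    linarith
  have h6 : D ≤ 8 * E := by nlinarith
  rw [pow_succ]
  norm_num at h3 ⊢
  linarith

/-- The Lipschitz constant `8 * 2^j` and the factor `2` from the chordal metric turn `2^(-n-j-5)`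
into `2^(-n-1)`. -/
theorem dist_riemannMap_lt {p q : OnePoint ℂ} {j n : ℕ} (hp : p ∈ exteriorDisk) (hq0 : q ≠ (0 : ℂ))
    (hq : ‖chart ∞ q‖ ≤ 1 - (1 / 2) ^ j)
    (hd : dist (stereo q) (stereo p) < (1 / 2) ^ (n + j + 5)) :
    dist (stereo (riemannMap q)) (stereo (riemannMap p)) < (1 / 2) ^ (n + 1) := by
  have hp0 := ne_zero_of_mem_exteriorDisk hp
  have hp1 := norm_chart_lt_one hp
  have hpos : (0 : ℝ) < (1 / 2) ^ j := by positivity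
  rw [← chartInv_chart_infty hp0, ← chartInv_chart_infty hq0, dist_comm] at hd
  have h1 := (norm_sub_le_dist_stereo hp1.le (by linarith)).trans_lt hd
  have h2 : (1 / 2 : ℝ) ^ (n + j + 5) ≤ (1 / 2) ^ j :=
    pow_le_pow_of_le_one (by norm_num) (by norm_num) (by omega)
  have h3 := norm_recipMap_sub_le hq (h1.trans_le h2)
  rw [dist_comm]
  refine (dist_stereo_chartInv_infty_le _ _).trans_lt ?_
  have h4 : 8 / (1 / 2 : ℝ) ^ j * ‖chart ∞ p - chart ∞ q‖ <
      8 / (1 / 2 : ℝ) ^ j * (1 / 2) ^ (n + j + 5) := by gcongr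
  have h5 : 8 / (1 / 2 : ℝ) ^ j * (1 / 2) ^ (n + j + 5) = 1 / 2 * (1 / 2) ^ (n + 1) := by
    rw [pow_add _ (n + j), pow_add _ n j, pow_succ _ n]
    field_simp
    norm_num
  linarith

/-! ### The algorithm -/

/-- An integer form of the inequality `1 ≤ ‖q‖ * (1 - 2 ^ (-j))` for the point `q` with code `i`. -/
def FarFromDisk (j i : ℕ) : Prop :=
  2 ^ j * codeM i * (2 ^ j * codeM i) ≤ normSqNum i * ((2 ^ j - 1) * (2 ^ j - 1))

instance : DecidableRel FarFromDisk := fun _ _ => Nat.decLe _ _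

theorem farFromDisk_iff {j i : ℕ} : FarFromDisk j i ↔
    rationalPoint i ≠ 0 ∧ ‖(rationalPoint i)⁻¹‖ ≤ 1 - (1 / 2) ^ j := by
  have hM := codeM_ne_zero i
  have hle : (1 / 2 : ℝ) ^ j ≤ 1 := pow_le_one₀ (by norm_num) (by norm_num)
  have h1 : FarFromDisk j i ↔ 1 ≤ ‖rationalPoint i‖ * (1 - (1 / 2) ^ j) := by
    have h2 : ((2 ^ j - 1 : ℕ) : ℝ) = 2 ^ j * (1 - (1 / 2) ^ j) := by
      push_cast [Nat.cast_sub (Nat.one_le_two_pow (n := j))]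
      rw [mul_sub, ← mul_pow]
      norm_num
    rw [← one_le_sq_iff₀ (mul_nonneg (norm_nonneg _) (sub_nonneg.2 hle)), FarFromDisk,
      ← Nat.cast_le (α := ℝ), Nat.cast_mul (normSqNum i), Nat.cast_mul (2 ^ j - 1), h2,
      normSqNum_cast, Complex.normSq_eq_norm_sq]
    push_cast
    have hC : (0 : ℝ) < (2 ^ j * codeM i) ^ 2 := by positivity
    conv_rhs => rw [← mul_le_mul_iff_right₀ hC]
    refine Eq.to_iff ?_
    congr 1 <;> ring
  rw [h1]
  constructor
  · intro h
    have h0 : rationalPoint i ≠ 0 := by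
      intro h0
      rw [h0, norm_zero, zero_mul] at h
      linarith
    refine ⟨h0, ?_⟩
    rwa [norm_inv, inv_le_iff_one_le_mul₀' (norm_pos_iff.2 h0)]
  · rintro ⟨h0, h⟩
    rwa [norm_inv, inv_le_iff_one_le_mul₀' (norm_pos_iff.2 h0)] at h

/-- The algorithm for the Riemann map: wait until the last value read from the oracle is an
approximation by a point of the disk `|1 / z| ≤ 1 - 2 ^ (-j)` with precision `2 ^ (-n - j - 5)`, and
evaluate a partial sum of the Laurent series there. -/
def algorithm (x : List ℕ × ℕ) : Option ℕ :=
  if x.2 + 6 ≤ x.1.length ∧ FarFromDisk (x.1.length - (x.2 + 6)) (x.1.getD (x.1.length - 1) 0) then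
    some (valueCode (numTerms (x.1.length - (x.2 + 6)) x.2) (x.1.getD (x.1.length - 1) 0))
  else none

theorem primrec_algorithm : Primrec algorithm := by
  have hlen : Primrec fun x : List ℕ × ℕ => x.1.length := Primrec.list_length.comp .fst
  have hn : Primrec fun x : List ℕ × ℕ => x.2 + 6 := Primrec.nat_add.comp .snd (Primrec.const 6)
  have hj : Primrec fun x : List ℕ × ℕ => x.1.length - (x.2 + 6) := Primrec.nat_sub.comp hlen hn
  have hp : Primrec fun x : List ℕ × ℕ => 2 ^ (x.1.length - (x.2 + 6)) := primrec_pow_two.comp hj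
  have hi : Primrec fun x : List ℕ × ℕ => x.1.getD (x.1.length - 1) 0 :=
    (Primrec.list_getD 0).comp .fst (Primrec.nat_sub.comp hlen (Primrec.const 1))
  have hpM := Primrec.nat_mul.comp hp (primrec_codeM.comp hi)
  have hp1 := Primrec.nat_sub.comp hp (Primrec.const 1)
  refine Primrec.ite (PrimrecPred.and (Primrec.nat_le.comp hn hlen) (Primrec.nat_le.comp
    (Primrec.nat_mul.comp hpM hpM)
    (Primrec.nat_mul.comp (primrec_normSqNum.comp hi) (Primrec.nat_mul.comp hp1 hp1)))) ?_
    (Primrec.const none)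
  exact Primrec.option_some.comp (primrec_valueCode.comp (Primrec.nat_mul.comp hp
    (Primrec.nat_add.comp (Primrec.nat_add.comp .snd hj) (Primrec.const 14))) hi)

/-! ### Correctness and termination of the algorithm -/

theorem getD_map_range (p : ℕ → ℕ) {k i : ℕ} (hi : i < k) :
    ((List.range k).map p).getD i 0 = p i := by
  simp [List.getD_eq_getElem?_getD, hi]

/-- After `n + j + 6` values the last one read has index `n + j + 5`, matching the precision
required above. -/
theorem algorithm_eq (p : ℕ → ℕ) (n j : ℕ) : algorithm ((List.range (n + j + 6)).map p, n) =
    if FarFromDisk j (p (n + j + 5)) then some (valueCode (numTerms j n) (p (n + j + 5)))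
    else none := by
  have h1 : n + j + 6 - (n + 6) = j := by omega
  simp only [algorithm, List.length_map, List.length_range, h1,
    getD_map_range p (show n + j + 6 - 1 < n + j + 6 by omega)]
  refine if_congr ?_ rfl rfl
  exact and_iff_right (by omega)

theorem exists_of_algorithm_ne_none {p : ℕ → ℕ} {n k : ℕ}
    (h : algorithm ((List.range k).map p, n) ≠ none) : ∃ j, k = n + j + 6 := by
  by_contra! hk
  refine h (if_neg fun h' => hk (k - (n + 6)) ?_)
  have := h'.1
  rw [List.length_map, List.length_range] at this
  omega

theorem tendsto_of_isName {p : ℕ → ℕ} {x : OnePoint ℂ} (hp : computableSphere.IsName p x) :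
    Tendsto (fun k => (rationalPoint (p k) : OnePoint ℂ)) atTop (𝓝 x) := by
  rw [isEmbedding_stereo.tendsto_nhds_iff, tendsto_iff_dist_tendsto_zero]
  exact squeeze_zero (fun _ => dist_nonneg) (fun k => (hp k).le)
    (tendsto_pow_atTop_nhds_zero_of_lt_one (by norm_num) (by norm_num))

/-- Termination: the moduli `|1/z|` of the approximations converge to a number below `1`, while `1 -
2^(-j)` tends to `1`. -/
theorem exists_farFromDisk {p : ℕ → ℕ} {x : OnePoint ℂ} (hx : x ∈ exteriorDisk)
    (hp : computableSphere.IsName p x) (n : ℕ) : ∃ j, FarFromDisk j (p (n + j + 5)) := by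
  have hx0 := ne_zero_of_mem_exteriorDisk hx
  have hx1 := norm_chart_lt_one hx
  have ht : Tendsto (fun j => (rationalPoint (p (n + j + 5)) : OnePoint ℂ)) atTop (𝓝 x) :=
    (tendsto_of_isName hp).comp
      (tendsto_atTop_mono (fun j => (by omega : j ≤ n + j + 5)) tendsto_id)
  have h1 := ((continuousAt_chart_infty hx0).tendsto.comp ht).norm
  have h2 : Tendsto (fun j : ℕ => 1 - (1 / 2 : ℝ) ^ j) atTop (𝓝 (1 - 0)) :=
    (tendsto_pow_atTop_nhds_zero_of_lt_one (by norm_num) (by norm_num)).const_sub 1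
  rw [sub_zero] at h2
  have h3 := h1.eventually_lt h2 hx1
  have h4 := ht.eventually_ne hx0
  obtain ⟨j, hj, hj0⟩ := (h3.and h4).exists
  refine ⟨j, farFromDisk_iff.2 ⟨fun h => hj0 (by rw [h]), ?_⟩⟩
  simp only [Function.comp_apply, chart_infty_coe] at hj
  exact hj.le

/-- Truncation and oracle error contribute `2^(-n-1)` each. Every possible output is correct, so the
first one is. -/
theorem dist_algorithm_lt {p : ℕ → ℕ} {x : OnePoint ℂ} (hx : x ∈ exteriorDisk)
    (hp : computableSphere.IsName p x) {n k y : ℕ}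
    (hy : algorithm ((List.range k).map p, n) = some y) :
    computableSphere.dist (computableSphere.ideal y) (riemannMap x) < (1 / 2 : ℝ) ^ n := by
  obtain ⟨j, rfl⟩ := exists_of_algorithm_ne_none (by rw [hy]; exact Option.some_ne_none y)
  rw [algorithm_eq] at hy
  split_ifs at hy with h
  obtain ⟨h0, h1⟩ := farFromDisk_iff.1 h
  have hy' := Option.some_injective _ hy
  subst hy'
  have h2 := dist_valueCode_lt (n := n) h0 h1
  have h3 := dist_riemannMap_lt (q := (rationalPoint (p (n + j + 5)) : OnePoint ℂ)) (n := n) hx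
    (fun h => h0 (OnePoint.coe_injective h)) (by rwa [chart_infty_coe]) (hp (n + j + 5))
  refine (dist_triangle (stereo (rationalPoint _ : OnePoint ℂ)) _ (stereo (riemannMap x))).trans_lt
    ((add_lt_add h2 h3).trans_eq ?_)
  rw [pow_succ]
  ring

theorem computableFunctionOn_riemannMap :
    ComputableFunctionOn computableSphere computableSphere exteriorDisk riemannMap := by
  refine ⟨algorithm, primrec_algorithm.to_comp, fun x hx p hp n => ?_⟩
  have hex : ∃ k, algorithm ((List.range k).map p, n) ≠ none := by
    obtain ⟨j, hj⟩ := exists_farFromDisk hx hp n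
    refine ⟨n + j + 6, ?_⟩
    rw [algorithm_eq, if_pos hj]
    exact Option.some_ne_none _
  classical
  obtain ⟨y, hy⟩ := Option.ne_none_iff_exists'.1 (Nat.find_spec hex)
  exact ⟨y, ⟨Nat.find hex, hy, fun l hl => not_not.1 (Nat.find_min hex hl)⟩,
    dist_algorithm_lt hx hp hy⟩

end MandelbrotRiemann

theorem mainTheorem2 :
    ∃ φ : OnePoint ℂ → OnePoint ℂ,
      RiemannSphere.IsRiemannMap mandelbrotExterior φ ∧
      (∀ ψ : OnePoint ℂ → OnePoint ℂ, RiemannSphere.IsRiemannMap mandelbrotExterior ψ →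
        EqOn ψ φ RiemannSphere.exteriorDisk) ∧
      ComputableFunctionOn RiemannSphere.computableSphere RiemannSphere.computableSphere
        RiemannSphere.exteriorDisk φ :=
  ⟨MandelbrotRiemann.riemannMap, MandelbrotRiemann.isRiemannMap_riemannMap,
    fun _ hψ => MandelbrotRiemann.eqOn_riemannMap hψ,
    MandelbrotRiemann.computableFunctionOn_riemannMap⟩
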